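/- Work in the signature $\{\cdot,{}^{-1},1\}$ of groups. For groups $G,H$ let $G\wr H$ be the restricted regular wreath product $B\rtimes H$, where $B=\bigoplus_{h\in H}G$ and $H$ acts on $B$ by shifting coordinates by left multiplication. A computable $\Sigma_0$ or $\Pi_0$ formula is a finitary quantifier-free formula; for $n\ge 1$ a computable $\Sigma_n$ (respectively $\Pi_n$) formula is a disjunction (respectively conjunction) over a c.e. set of (indices of) formulas $\exists\bar x\,\psi$ (respectively $\forall\bar x\,\psi$), with $\bar x$ a finite tuple of variables and $\psi$ a computable $\Pi_m$ (respectively $\Sigma_m$) formula with $m<n$; a computable d-$\Sigma_n$ formula is the conjunction of a computable $\Sigma_n$ and a computable $\Pi_n$ formula. A Scott sentence of a countable structure $\mathcal A$ is an $\mathcal L_{\omega_1,\omega}$ sentence whose countable models are exactly the isomorphic copies of $\mathcal A$. The index set $I(\mathcal A)$ is the set of $e\in\mathbb N$ such that the $e$-th partial computable function $\varphi_e$ is the characteristic function of the atomic diagram (the set of Gödel numbers of the true atomic and negated atomic sentences) of a structure $\mathcal B\cong\mathcal A$ with universe a subset of $\mathbb N$. A set of natural numbers is d-$\Sigma_2$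 if it is a difference $S_1\setminus S_2$ of two $\Sigma_2$ sets, and it is $m$-complete d-$\Sigma_2$ if it is d-$\Sigma_2$ and every d-$\Sigma_2$ set is many-one reducible to it. **Theorem.** For every integer $d\ge 1$, the lamplighter group $L_d=(\mathbb Z/d\mathbb Z)\wr\mathbb Z$ has a computable d-$\Sigma_2$ Scott sentence, and its index set $I(L_d)$ is $m$-complete d-$\Sigma_2$. -/

import Mathlib

/-! ## Restricted regular wreath products and the lamplighter groups -/

/-- The base group of `G ≀ H`: the direct sum of copies of `G` indexed by `H`, realised as the
group of functions `H → G` that are trivial at all but finitely many points. -/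
def wreathBase (G H : Type) [Group G] : Subgroup (H → G) where
  carrier := {f | (Function.mulSupport f).Finite}
  one_mem' := by simp
  mul_mem' := fun {f g} hf hg => (hf.union hg).subset (Function.mulSupport_mul f g)
  inv_mem' := fun {f} hf => by simpa using hf

/-- Shift of a finitely supported function by left multiplication: `(h • f) x = f (h⁻¹ x)`. -/
def wreathShift {G H : Type} [Group G] [Group H] (h : H) (f : wreathBase G H) :
    wreathBase G H :=
  ⟨fun x => f.1 (h⁻¹ * x), by
    have hf : (Function.mulSupport f.1).Finite := f.2
    exact hf.preimage ((mul_right_injective h⁻¹).injOn)⟩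

/-- The shift action of `H` on the base group by automorphisms. -/
def wreathAction (G H : Type) [Group G] [Group H] : H →* MulAut (wreathBase G H) where
  toFun h :=
    { toFun := wreathShift h
      invFun := wreathShift h⁻¹
      left_inv := fun f => by ext x; simp [wreathShift]
      right_inv := fun f => by ext x; simp [wreathShift]
      map_mul' := fun f g => by ext x; simp [wreathShift] }
  map_one' := by ext f x; simp [wreathShift]
  map_mul' h k := by ext f x; simp [wreathShift, mul_assoc]

/-- The (regular, restricted) wreath product `G ≀ H`. -/
abbrev Wreath (G H : Type) [Group G] [Group H] : Type :=
  SemidirectProduct (wreathBase G H) H (wreathAction G H)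

/-- The lamplighter group `L_d = (ℤ/dℤ) ≀ ℤ`. -/
abbrev Lamplighter (d : ℕ) : Type := Wreath (Multiplicative (ZMod d)) (Multiplicative ℤ)

/-! ## Structures for the signature of groups -/

/-- A structure for the signature `{·, ⁻¹, 1}`; no axioms are imposed. -/
class GroupSig (M : Type) extends Mul M, Inv M, One M

instance Group.toGroupSig (G : Type) [Group G] : GroupSig G where

/-- Isomorphism of structures for the signature `{·, ⁻¹, 1}`. -/
def SigIso (M N : Type) [GroupSig M] [GroupSig N] : Prop :=
  ∃ f : M ≃ N, (∀ x y, f (x * y) = f x * f y) ∧ (∀ x, f x⁻¹ = (f x)⁻¹) ∧ f 1 = 1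

/-! ## Terms and finitary quantifier-free formulas, with their Gödel numberings -/

/-- Terms in the signature `{·, ⁻¹, 1}` over the symbols `x₀, x₁, …`. -/
inductive GTerm : Type
  | one : GTerm
  | var : ℕ → GTerm
  | inv : GTerm → GTerm
  | mul : GTerm → GTerm → GTerm

namespace GTerm

def eval {M : Type} [GroupSig M] (v : ℕ → M) : GTerm → M
  | one => 1
  | var k => v k
  | inv t => (t.eval v)⁻¹
  | mul s t => s.eval v * t.eval v

def vars : GTerm → Set ℕ
  | one => ∅
  | var k => {k}
  | inv t => t.vars
  | mul s t => s.vars ∪ t.vars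

/-- Gödel number of a term. -/
def toNat : GTerm → ℕ
  | one => 0
  | var k => 3 * k + 1
  | inv t => 3 * t.toNat + 2
  | mul s t => 3 * Nat.pair s.toNat t.toNat + 3

/-- The term with a given Gödel number. -/
def ofNat : ℕ → GTerm
  | 0 => one
  | n + 1 =>
    if n % 3 = 0 then var (n / 3)
    else if n % 3 = 1 then inv (ofNat (n / 3))
    else mul (ofNat (n / 3).unpair.1) (ofNat (n / 3).unpair.2)
termination_by n => n
decreasing_by
  · omega
  · have := Nat.unpair_left_le (n / 3); omega
  · have := Nat.unpair_right_le (n / 3); omega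

theorem ofNat_toNat (t : GTerm) : ofNat t.toNat = t := by
  induction t with
  | one => rw [toNat, ofNat]
  | var k =>
    rw [toNat, ofNat, if_pos (by omega)]
    congr 1; omega
  | inv t ih =>
    rw [toNat, ofNat, if_neg (by omega), if_pos (by omega),
      show (3 * t.toNat + 1) / 3 = t.toNat by omega, ih]
  | mul s t ihs iht =>
    rw [toNat, ofNat, if_neg (by omega), if_neg (by omega),
      show (3 * Nat.pair s.toNat t.toNat + 2) / 3 = Nat.pair s.toNat t.toNat by omega,
      Nat.unpair_pair, ihs, iht]

end GTerm

/-- Finitary quantifier-free formulas in the signature `{·, ⁻¹, 1}`. -/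
inductive QF : Type
  | eq : GTerm → GTerm → QF
  | not : QF → QF
  | and : QF → QF → QF
  | or : QF → QF → QF

namespace QF

def Realize {M : Type} [GroupSig M] (v : ℕ → M) : QF → Prop
  | eq s t => s.eval v = t.eval v
  | not p => ¬ p.Realize v
  | and p q => p.Realize v ∧ q.Realize v
  | or p q => p.Realize v ∨ q.Realize v

def vars : QF → Set ℕ
  | eq s t => s.vars ∪ t.vars
  | not p => p.vars
  | and p q => p.vars ∪ q.vars
  | or p q => p.vars ∪ q.vars

/-- Atomic formulas and negations of atomic formulas. -/
def IsLiteral (p : QF) : Prop :=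
  ∃ s t : GTerm, p = eq s t ∨ p = not (eq s t)

/-- Gödel number of a quantifier-free formula. -/
def toNat : QF → ℕ
  | eq s t => 4 * Nat.pair s.toNat t.toNat
  | not p => 4 * p.toNat + 1
  | and p q => 4 * Nat.pair p.toNat q.toNat + 2
  | or p q => 4 * Nat.pair p.toNat q.toNat + 3

/-- The quantifier-free formula with a given Gödel number. -/
def ofNat (n : ℕ) : QF :=
  if n % 4 = 0 then eq (GTerm.ofNat (n / 4).unpair.1) (GTerm.ofNat (n / 4).unpair.2)
  else if n % 4 = 1 then not (ofNat (n / 4))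
  else if n % 4 = 2 then and (ofNat (n / 4).unpair.1) (ofNat (n / 4).unpair.2)
  else or (ofNat (n / 4).unpair.1) (ofNat (n / 4).unpair.2)
termination_by n
decreasing_by
  · omega
  · have := Nat.unpair_left_le (n / 4); omega
  · have := Nat.unpair_right_le (n / 4); omega
  · have := Nat.unpair_left_le (n / 4); omega
  · have := Nat.unpair_right_le (n / 4); omega

theorem ofNat_toNat (p : QF) : ofNat p.toNat = p := by
  induction p with
  | eq s t =>
    rw [toNat, ofNat, if_pos (by omega), Nat.mul_div_cancel_left _ (by norm_num),
      Nat.unpair_pair, GTerm.ofNat_toNat, GTerm.ofNat_toNat]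
  | not p ih =>
    rw [toNat, ofNat, if_neg (by omega), if_pos (by omega),
      show (4 * p.toNat + 1) / 4 = p.toNat by omega, ih]
  | and p q ihp ihq =>
    rw [toNat, ofNat, if_neg (by omega), if_neg (by omega), if_pos (by omega),
      show (4 * Nat.pair p.toNat q.toNat + 2) / 4 = Nat.pair p.toNat q.toNat by omega,
      Nat.unpair_pair, ihp, ihq]
  | or p q ihp ihq =>
    rw [toNat, ofNat, if_neg (by omega), if_neg (by omega), if_neg (by omega),
      show (4 * Nat.pair p.toNat q.toNat + 3) / 4 = Nat.pair p.toNat q.toNat by omega,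
      Nat.unpair_pair, ihp, ihq]

end QF

/-! ## Partial computable functions and c.e. sets -/

/-- `φ_e`, the partial computable function with index `e`. -/
def phi (e : ℕ) : ℕ →. ℕ := (Denumerable.ofNat Nat.Partrec.Code e).eval

/-- `W_e`, the c.e. set with index `e`: the domain of `φ_e`. -/
def ceSet (e : ℕ) : Set ℕ := {i | (phi e i).Dom}

/-! ## The infinitary language -/

/-- Formulas of `L_{ω₁,ω}` in the signature `{·, ⁻¹, 1}`. The formula `disj S f` is the countable
disjunction of the `f i` with `i ∈ S` (so `S = ∅` gives falsity), `conj S f` the corresponding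
conjunction; `ex x p` and `all x p` quantify over a finite tuple `x` of variables. -/
inductive InfFormula : Type
  | qf : QF → InfFormula
  | not : InfFormula → InfFormula
  | conj : Set ℕ → (ℕ → InfFormula) → InfFormula
  | disj : Set ℕ → (ℕ → InfFormula) → InfFormula
  | ex : List ℕ → InfFormula → InfFormula
  | all : List ℕ → InfFormula → InfFormula

namespace InfFormula

/-- Satisfaction of a formula in a structure under an assignment of the variables. -/
def Realize {M : Type} [GroupSig M] : InfFormula → (ℕ → M) → Prop
  | qf p, v => p.Realize v
  | not p, v => ¬ p.Realize v
  | conj S f, v => ∀ i ∈ S, (f i).Realize v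
  | disj S f, v => ∃ i ∈ S, (f i).Realize v
  | ex x p, v => ∃ w : ℕ → M, (∀ k, k ∉ x → w k = v k) ∧ p.Realize w
  | all x p, v => ∀ w : ℕ → M, (∀ k, k ∉ x → w k = v k) → p.Realize w

def freeVars : InfFormula → Set ℕ
  | qf p => p.vars
  | not p => p.freeVars
  | conj S f => ⋃ i ∈ S, (f i).freeVars
  | disj S f => ⋃ i ∈ S, (f i).freeVars
  | ex x p => p.freeVars \ {k | k ∈ x}
  | all x p => p.freeVars \ {k | k ∈ x}

def IsSentence (p : InfFormula) : Prop := p.freeVars = ∅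

/-- `M ⊨ p`, for a sentence `p`. -/
def Models (M : Type) [GroupSig M] (p : InfFormula) : Prop := ∀ v : ℕ → M, p.Realize v

/-- The binary conjunction. -/
def and (p q : InfFormula) : InfFormula := conj {0, 1} fun i => if i = 0 then p else q

/-- The computable infinitary formula with index `e`, of kind `Σ_n` (if `sig = true`) or `Π_n`
(if `sig = false`). For `n = 0` it is the finitary quantifier-free formula with Gödel number `e`.
The computable `Σ_{n+1}` formula with index `e` is the disjunction over the c.e. set `W_e`, whose
member coding `(x, m, k)` contributes the formula `∃ x ψ`, where `x` is a finite tuple of variables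
and `ψ` is the computable `Π_m` formula with index `k` (a level `m > n` is read as `n`).
`Π_{n+1}` is dual. -/
def ofIndex : ℕ → Bool → ℕ → InfFormula
  | 0, _, e => qf (QF.ofNat e)
  | n + 1, true, e => disj (ceSet e) fun i =>
      let c := Denumerable.ofNat (List ℕ × ℕ × ℕ) i
      ex c.1 (ofIndex (min c.2.1 n) false c.2.2)
  | n + 1, false, e => conj (ceSet e) fun i =>
      let c := Denumerable.ofNat (List ℕ × ℕ × ℕ) i
      all c.1 (ofIndex (min c.2.1 n) true c.2.2)
termination_by n => n
decreasing_by all_goals omega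

def IsComputableSigma (n : ℕ) (p : InfFormula) : Prop := ∃ e, p = ofIndex n true e

def IsComputablePi (n : ℕ) (p : InfFormula) : Prop := ∃ e, p = ofIndex n false e

/-- Computable d-`Σ_n` formulas: conjunctions of a computable `Σ_n` and a computable `Π_n`
formula. -/
def IsComputableDSigma (n : ℕ) (p : InfFormula) : Prop :=
  ∃ q r : InfFormula, q.IsComputableSigma n ∧ r.IsComputablePi n ∧ p = q.and r

/-- `p` is a Scott sentence for `A`: it is a sentence whose countable models are exactly the
isomorphic copies of `A`. The models range over all structures of the signature, not only over
groups. -/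
def IsScottSentence (p : InfFormula) (A : Type) [GroupSig A] : Prop :=
  p.IsSentence ∧ ∀ (M : Type) [GroupSig M] [Countable M], p.Models M ↔ SigIso M A

end InfFormula

/-! ## Atomic diagrams and index sets -/

open Classical in
/-- The assignment that lets the constant `k` name the element `k` of a structure with universe
`U ⊆ ℕ` (constants outside `U` do not occur where this is used). -/
noncomputable def nameAssignment (U : Set ℕ) [GroupSig U] (k : ℕ) : U :=
  if h : k ∈ U then ⟨k, h⟩ else 1

/-- The atomic diagram, as a set of Gödel numbers, of a structure with universe `U ⊆ ℕ`: all
atomic and negated atomic sentences with constants from `U` that are true in the structure, the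
constant naming `k` being the symbol `x_k`. -/
def atomicDiagram (U : Set ℕ) [GroupSig U] : Set ℕ :=
  {n | ∃ p : QF, p.IsLiteral ∧ p.vars ⊆ U ∧ p.Realize (nameAssignment U) ∧ n = p.toNat}

/-- `φ_e` is (total and) the characteristic function of `D`. -/
def DecidesSet (e : ℕ) (D : Set ℕ) : Prop :=
  ∀ n, (n ∈ D → phi e n = Part.some 1) ∧ (n ∉ D → phi e n = Part.some 0)

/-- The index set `I(A)`: all `e` such that `φ_e` gives the atomic diagram of a structure (with
universe a subset of `ℕ`) isomorphic to `A`. -/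
def indexSet (A : Type) [GroupSig A] : Set ℕ :=
  {e | ∃ (U : Set ℕ) (_ : GroupSig U), DecidesSet e (atomicDiagram U) ∧ SigIso U A}

/-! ## The class d-`Σ₂` of sets of natural numbers and completeness -/

/-- `Σ₂` sets in the arithmetical hierarchy. -/
def IsSigmaTwo (S : Set ℕ) : Prop :=
  ∃ R : ℕ × ℕ × ℕ → Prop, ComputablePred R ∧ ∀ n, n ∈ S ↔ ∃ x, ∀ y, R (n, x, y)

/-- d-`Σ₂` sets: differences of two `Σ₂` sets. -/
def IsDSigmaTwo (S : Set ℕ) : Prop :=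
  ∃ S₁ S₂ : Set ℕ, IsSigmaTwo S₁ ∧ IsSigmaTwo S₂ ∧ S = S₁ \ S₂

/-- `S` is `m`-complete d-`Σ₂`. -/
def IsMCompleteDSigmaTwo (S : Set ℕ) : Prop :=
  IsDSigmaTwo S ∧
    ∀ T : Set ℕ, IsDSigmaTwo T → ManyOneReducible (fun n => n ∈ T) (fun n => n ∈ S)

/-! ## Computability of operations on terms and formulas -/

/-! Write `L_d` as `R ⋊ ℤ` with `R = (ℤ/d)[T, T⁻¹]`, and call the `ℤ`-coordinate the position. The
pairs `x`, `y` with `x` a unit of `R` and `y` of position `±1` have a Π₁ description, `IsStdPair`: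
`x` has exponent `d`, its conjugates by powers of `y` commute and satisfy no further relations, `y`
has infinite order and is not a proper power modulo elements of exponent `d`, and `x` is not a
non-unit multiple of any element. The last condition needs a decidable list of non-units: an element
of `R` is a unit exactly when, modulo each prime `q ∣ d`, precisely one coefficient survives
(`isUnit_polyEval`, `countP_of_isUnit_polyEval`).

In `L_d` every standard pair generates (`LampGroup.generates_of_isStdPair`), and any group generated
by a standard pair is `L_d` (`IsStdPair.nonempty_mulEquiv`). So among groups `L_d` is characterised
by "some pair is standard", which is Σ₂, and "every standard pair generates", which is Π₂, since
"not standard, or this word equation holds for `z`" is Σ₁. Asking for a single pair that is standard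
and generates would only give a Σ₃ sentence. The same two conditions, read off the values of `φ_e`
together with Π₂ axioms saying that `φ_e` decides the diagram of a group, put the index set into
d-Σ₂ (`mem_indexSet_lamplighter_iff`).

For hardness, Σ₂ sets `S₁`, `S₂` are turned into computable monotone counters `c`, `c'` that are
bounded exactly on members (`exists_counter`). Take the lamp group over the subgroup `A` of `ℚ × ℚ`
generated by the `(2^(-c s), 0)` and, for each `s`, by `(2^t, 0)` where `t` is the first stage at
which `c'` exceeds `c' s`, or by `(0, 1)` if there is no such stage. If `c` is bounded and `c'` is
not, then `A` is infinite cyclic. If `c` is unbounded, `A` contains a nonzero element divisible by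
all powers of 2; if `c'` is bounded, `A` has rank two; both are visible in the lamp group. The word
problem is nevertheless decidable uniformly (`wordSum_counterPos_eq_zero_iff`): a jump not yet
settled is either too large or independent, so it cannot cancel the settled letters. A uniformly
decidable word problem yields computable indices (`exists_computable_mem_indexSet_iff`). -/

theorem GTerm.toNat_ofNat (n : ℕ) : (GTerm.ofNat n).toNat = n := by
  induction n using Nat.strong_induction_on with
  | _ n ih =>
    match n with
    | 0 => rw [GTerm.ofNat, GTerm.toNat]
    | n + 1 =>
      rw [GTerm.ofNat]
      have h1 := Nat.unpair_left_le (n / 3)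
      have h2 := Nat.unpair_right_le (n / 3)
      split_ifs with h h'
      · rw [GTerm.toNat]; omega
      · rw [GTerm.toNat, ih _ (by omega)]; omega
      · rw [GTerm.toNat, ih _ (by omega), ih _ (by omega), Nat.pair_unpair]; omega

theorem QF.toNat_ofNat (n : ℕ) : (QF.ofNat n).toNat = n := by
  induction n using Nat.strong_induction_on with
  | _ n ih =>
    rw [QF.ofNat]
    have h1 := Nat.unpair_left_le (n / 4)
    have h2 := Nat.unpair_right_le (n / 4)
    split_ifs with h h' h''
    · rw [QF.toNat, GTerm.toNat_ofNat, GTerm.toNat_ofNat, Nat.pair_unpair]; omega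
    · rw [QF.toNat, ih _ (by omega)]; omega
    · rw [QF.toNat, ih _ (by omega), ih _ (by omega), Nat.pair_unpair]; omega
    · rw [QF.toNat, ih _ (by omega), ih _ (by omega), Nat.pair_unpair]; omega

def GTerm.equivNat : GTerm ≃ ℕ := ⟨GTerm.toNat, GTerm.ofNat, GTerm.ofNat_toNat, GTerm.toNat_ofNat⟩

def QF.equivNat : QF ≃ ℕ := ⟨QF.toNat, QF.ofNat, QF.ofNat_toNat, QF.toNat_ofNat⟩

instance : Denumerable GTerm := Denumerable.mk' GTerm.equivNat

instance : Denumerable QF := Denumerable.mk' QF.equivNat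

theorem GTerm.primrec_toNat : Primrec GTerm.toNat := Primrec.encode

theorem QF.primrec_toNat : Primrec QF.toNat := Primrec.encode

theorem GTerm.primrec_ofNat : Primrec GTerm.ofNat := Primrec.ofNat GTerm

theorem GTerm.primrec_of_toNat {α : Type*} [Primcodable α] {f : α → GTerm}
    (h : Primrec fun a => (f a).toNat) : Primrec f :=
  Primrec.encode_iff.1 h

theorem QF.primrec_of_toNat {α : Type*} [Primcodable α] {f : α → QF}
    (h : Primrec fun a => (f a).toNat) : Primrec f :=
  Primrec.encode_iff.1 h

theorem GTerm.primrec_var : Primrec GTerm.var :=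
  GTerm.primrec_of_toNat <| Primrec.nat_add.comp
    (Primrec.nat_mul.comp (.const 3) .id) (.const 1)

theorem GTerm.primrec_inv : Primrec GTerm.inv :=
  GTerm.primrec_of_toNat <| Primrec.nat_add.comp
    (Primrec.nat_mul.comp (.const 3) GTerm.primrec_toNat) (.const 2)

theorem GTerm.primrec_mul : Primrec₂ GTerm.mul :=
  GTerm.primrec_of_toNat (f := fun p : GTerm × GTerm => p.1.mul p.2) <| Primrec.nat_add.comp
    (Primrec.nat_mul.comp (.const 3) (Primrec₂.natPair.comp
      (GTerm.primrec_toNat.comp .fst) (GTerm.primrec_toNat.comp .snd))) (.const 3)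

theorem QF.primrec_eq : Primrec₂ QF.eq :=
  QF.primrec_of_toNat (f := fun p : GTerm × GTerm => QF.eq p.1 p.2) <|
    Primrec.nat_mul.comp (.const 4) (Primrec₂.natPair.comp
      (GTerm.primrec_toNat.comp .fst) (GTerm.primrec_toNat.comp .snd))

theorem QF.primrec_not : Primrec QF.not :=
  QF.primrec_of_toNat <| Primrec.nat_add.comp
    (Primrec.nat_mul.comp (.const 4) QF.primrec_toNat) (.const 1)

/-- Structural recursion on terms. -/
def GTerm.fold {σ : Type*} (o : σ) (v : ℕ → σ) (i : σ → σ) (m : σ → σ → σ) : GTerm → σ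
  | one => o
  | var k => v k
  | inv t => i (t.fold o v i m)
  | mul s t => m (s.fold o v i m) (t.fold o v i m)

theorem Computable.ite {α σ : Type*} [Primcodable α] [Primcodable σ] {p : α → Prop}
    [DecidablePred p] {f g : α → σ} (hp : ComputablePred p) (hf : Computable f)
    (hg : Computable g) : Computable fun a => if p a then f a else g a := by
  obtain ⟨D, hD⟩ := hp
  refine (Computable.cond hD hf hg).of_eq fun a => ?_
  by_cases h : p a <;> simp [h]

/-- Subterms have smaller Gödel numbers, so structural recursion on terms is course-of-values
recursion on numbers. The list `l` below holds the values at all smaller numbers. -/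
theorem Computable.gterm_fold {α σ : Type*} [Primcodable α] [Primcodable σ] {o : α → σ}
    {v : α → ℕ → σ} {i : α → σ → σ} {m : α → σ × σ → σ} (ho : Computable o)
    (hv : Computable₂ v) (hi : Computable₂ i) (hm : Computable₂ m) :
    Computable₂ fun a t => GTerm.fold (o a) (v a) (i a) (fun x y => m a (x, y)) t := by
  let f : α → ℕ → σ := fun a n =>
    GTerm.fold (o a) (v a) (i a) (fun x y => m a (x, y)) (GTerm.ofNat n)
  have hf : Computable₂ f := by
    refine Computable.nat_strong_rec f (g := fun a l =>
      Nat.casesOn l.length (some (o a)) fun k =>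
        if k % 3 = 0 then some (v a (k / 3))
        else if k % 3 = 1 then (l[k / 3]?).map (i a)
        else (l[(k / 3).unpair.1]?).bind fun x =>
          (l[(k / 3).unpair.2]?).map fun y => m a (x, y)) ?_ ?_
    · have hdiv : Computable fun p : (α × List σ) × ℕ => p.2 / 3 :=
        (Primrec.nat_div.comp Primrec.snd (.const 3)).to_comp
      have hmod (r : ℕ) : ComputablePred fun p : (α × List σ) × ℕ => p.2 % 3 = r :=
        PrimrecPred.computablePred
          (Primrec.eq.comp (Primrec.nat_mod.comp Primrec.snd (.const 3)) (.const r))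
      have hl : Computable fun p : (α × List σ) × ℕ => p.1.2 :=
        Computable.snd.comp Computable.fst
      have ha : Computable fun p : (α × List σ) × ℕ => p.1.1 :=
        Computable.fst.comp Computable.fst
      refine Computable.nat_casesOn (Computable.list_length.comp Computable.snd)
        (Computable.option_some.comp (ho.comp Computable.fst)) ?_
      refine Computable.ite (hmod 0)
        (Computable.option_some.comp (hv.comp ha hdiv)) ?_
      refine Computable.ite (hmod 1) ?_ ?_
      · exact Computable.option_map (Computable.list_getElem?.comp hl hdiv)
          (hi.comp (ha.comp Computable.fst) Computable.snd)
      · refine Computable.option_bind (Computable.list_getElem?.comp hl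
          (Computable.fst.comp (Computable.unpair.comp hdiv))) ?_
        refine Computable.option_map (Computable.list_getElem?.comp (hl.comp Computable.fst)
          (Computable.snd.comp (Computable.unpair.comp (hdiv.comp Computable.fst)))) ?_
        exact hm.comp (ha.comp (Computable.fst.comp Computable.fst))
          (Computable.pair (Computable.snd.comp Computable.fst) Computable.snd)
    · intro a n
      simp only [List.length_map, List.length_range]
      match n with
      | 0 => simp [f, GTerm.ofNat, GTerm.fold]
      | n + 1 =>
        have h1 := Nat.unpair_left_le (n / 3)
        have h2 := Nat.unpair_right_le (n / 3)
        simp only [f]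
        rw [GTerm.ofNat]
        have e0 : n / 3 < n + 1 := by omega
        have e1 : (n / 3).unpair.1 < n + 1 := by omega
        have e2 : (n / 3).unpair.2 < n + 1 := by omega
        split_ifs with h h'
        · simp [GTerm.fold]
        · simp [GTerm.fold, e0]
        · simp [GTerm.fold, e1, e2]
  refine (hf.comp Computable.fst (GTerm.primrec_toNat.to_comp.comp Computable.snd)).of_eq ?_
  rintro ⟨a, t⟩
  simp [f, GTerm.ofNat_toNat]

/-! ## Bounded sums and quantifiers -/

theorem Computable.sum_range {α : Type*} [Primcodable α] {F : α → ℕ → ℕ} {k : α → ℕ}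
    (hF : Computable₂ F) (hk : Computable k) :
    Computable fun a => ∑ j ∈ Finset.range (k a), F a j := by
  refine (Computable.nat_rec (f := k) (g := fun _ => 0) (h := fun a p => p.2 + F a p.1) hk
    (Computable.const 0) ?_).of_eq fun a => ?_
  · exact Primrec.nat_add.to_comp.comp (Computable.snd.comp Computable.snd)
      (hF.comp Computable.fst (Computable.fst.comp Computable.snd))
  · induction k a with
    | zero => rfl
    | succ n ih => rw [Finset.sum_range_succ, ← ih]

/-- A bounded universal quantifier is the vanishing of the number of counterexamples. -/
theorem ComputablePred.forall_lt {α : Type*} [Primcodable α] {P : α → ℕ → Prop} {k : α → ℕ}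
    (hP : ComputablePred fun p : α × ℕ => P p.1 p.2) (hk : Computable k) :
    ComputablePred fun a => ∀ j < k a, P a j := by
  classical
  have hs := Computable.sum_range (F := fun a j => if P a j then 0 else 1)
    (Computable.ite hP (Computable.const 0) (Computable.const 1)) hk
  have h0 : ComputablePred fun n : ℕ => n = 0 :=
    PrimrecPred.computablePred (Primrec.eq.comp .id (.const 0))
  obtain ⟨D, hD⟩ := h0
  refine ComputablePred.of_eq (p := fun a => (∑ j ∈ Finset.range (k a),
    if P a j then 0 else 1) = 0) ?_ fun a => ?_
  · exact ⟨inferInstance, (hD.comp hs).of_eq fun a => by simp⟩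
  · rw [Finset.sum_eq_zero_iff]
    simp

theorem ComputablePred.comp {α β : Type*} [Primcodable α] [Primcodable β] {p : β → Prop}
    {f : α → β} (hp : ComputablePred p) (hf : Computable f) :
    ComputablePred fun a => p (f a) := by
  obtain ⟨D, hD⟩ := hp
  exact ⟨fun a => D (f a), hD.comp hf⟩

theorem ComputablePred.and {α : Type*} [Primcodable α] {p q : α → Prop}
    (hp : ComputablePred p) (hq : ComputablePred q) : ComputablePred fun a => p a ∧ q a := by
  obtain ⟨D, hD⟩ := hp
  obtain ⟨E, hE⟩ := hq
  exact ⟨inferInstance, (Primrec.and.to_comp.comp hD hE).of_eq fun a => by simp⟩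

theorem ComputablePred.or {α : Type*} [Primcodable α] {p q : α → Prop}
    (hp : ComputablePred p) (hq : ComputablePred q) : ComputablePred fun a => p a ∨ q a := by
  obtain ⟨D, hD⟩ := hp
  obtain ⟨E, hE⟩ := hq
  exact ⟨inferInstance, (Primrec.or.to_comp.comp hD hE).of_eq fun a => by simp⟩

theorem ComputablePred.nat_eq {α : Type*} [Primcodable α] {f g : α → ℕ}
    (hf : Computable f) (hg : Computable g) : ComputablePred fun a => f a = g a := by
  refine ComputablePred.comp (p := fun q : ℕ × ℕ => q.1 = q.2) ?_ (hf.pair hg)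
  exact PrimrecPred.computablePred (Primrec.eq.comp .fst .snd)

theorem ComputablePred.dvd_const {α : Type*} [Primcodable α] {f : α → ℕ} (d : ℕ)
    (hf : Computable f) : ComputablePred fun a => d ∣ f a := by
  refine (ComputablePred.nat_eq ((Primrec.nat_mod.comp .id (.const d)).to_comp.comp hf)
    (Computable.const 0)).of_eq fun a => ?_
  exact (Nat.dvd_iff_mod_eq_zero).symm

/-! ## Indices -/

theorem exists_phi_eq {f : ℕ →. ℕ} (hf : Nat.Partrec f) : ∃ e, phi e = f := by
  obtain ⟨c, hc⟩ := Nat.Partrec.Code.exists_code.1 hf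
  exact ⟨Encodable.encode c, by rw [phi, Denumerable.ofNat_encode, hc]⟩

/-- The unbounded search for a preimage under `g` halts exactly on the range. -/
theorem exists_ceSet_eq_range {g : ℕ → ℕ} (hg : Computable g) : ∃ e, ceSet e = Set.range g := by
  have hp : Partrec fun n => Nat.rfind fun j => Part.some (decide (g j = n)) := by
    refine Partrec.rfind (p := fun n j => Part.some (decide (g j = n))) ?_
    exact (Primrec.eq.decide.to_comp.comp (hg.comp Computable.snd) Computable.fst).partrec
  obtain ⟨e, he⟩ := exists_phi_eq (Partrec.nat_iff.1 hp)
  refine ⟨e, ?_⟩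
  ext i
  simp only [ceSet, he, Set.mem_ofPred_eq, Set.mem_range]
  refine Nat.rfind_dom.trans ⟨?_, ?_⟩
  · rintro ⟨j, hj, -⟩
    exact ⟨j, by simpa using hj⟩
  · rintro ⟨j, hj⟩
    exact ⟨j, by simpa using hj, fun _ => trivial⟩

/-- The `s`-`m`-`n` theorem for total functions. -/
theorem exists_computable_index {F : ℕ → ℕ → ℕ} (hF : Computable₂ F) :
    ∃ f : ℕ → ℕ, Computable f ∧ ∀ n c, phi (f n) c = Part.some (F n c) := by
  have hp : Nat.Partrec fun m : ℕ => Part.some (F m.unpair.1 m.unpair.2) := by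
    refine Partrec.nat_iff.1 ?_
    exact (hF.comp (Computable.fst.comp Computable.unpair)
      (Computable.snd.comp Computable.unpair)).partrec
  obtain ⟨c, hc⟩ := Nat.Partrec.Code.exists_code.1 hp
  refine ⟨fun n => Encodable.encode (Nat.Partrec.Code.curry c n), ?_, fun n k => ?_⟩
  · exact Computable.encode.comp
      (Nat.Partrec.Code.primrec₂_curry.to_comp.comp (Computable.const c) Computable.id)
  · rw [phi, Denumerable.ofNat_encode, Nat.Partrec.Code.eval_curry, hc]
    simp

open LaurentPolynomial

/-! ## Polynomial expressions with natural coefficients -/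

/-- `c₀ + c₁ τ + c₂ τ² + ⋯`. -/
def polyEval {R : Type*} [CommRing R] (τ : R) : List ℕ → R
  | [] => 0
  | c :: l => c + τ * polyEval τ l

theorem map_polyEval {R S : Type*} [CommRing R] [CommRing S] (f : R →+* S) (τ : R) (c : List ℕ) :
    f (polyEval τ c) = polyEval (f τ) c := by
  induction c with
  | nil => simp [polyEval]
  | cons a l ih => simp [polyEval, ih]

theorem exists_polyEval_add {R : Type*} [CommRing R] (τ : R) (c c' : List ℕ) :
    ∃ c'', polyEval τ c'' = polyEval τ c + polyEval τ c' := by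
  induction c generalizing c' with
  | nil => exact ⟨c', by simp [polyEval]⟩
  | cons a l ih =>
    cases c' with
    | nil => exact ⟨a :: l, by simp [polyEval]⟩
    | cons b m =>
      obtain ⟨n, hn⟩ := ih m
      exact ⟨(a + b) :: n, by simp only [polyEval, hn]; push_cast; ring⟩

theorem polyEval_replicate_append {R : Type*} [CommRing R] (τ : R) (n a : ℕ) :
    polyEval τ (List.replicate n 0 ++ [a]) = a * τ ^ n := by
  induction n with
  | zero => simp [polyEval]
  | succ n ih => simp only [List.replicate_succ, List.cons_append, polyEval, ih]; push_cast; ring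

theorem polyEval_eq_zero {R : Type*} [CommRing R] (τ : R) {q : ℕ} (hq : (q : R) = 0)
    {c : List ℕ} (h : ∀ i ∈ c, q ∣ i) : polyEval τ c = 0 := by
  induction c with
  | nil => rfl
  | cons a l ih =>
    obtain ⟨b, rfl⟩ := h a (by simp)
    simp [polyEval, ih fun i hi => h i (by simp [hi]), hq]

theorem exists_polyEval_eq_monomial {R : Type*} [CommRing R] (τ : R) {q : ℕ} (hq : (q : R) = 0)
    {c : List ℕ} (h : c.countP (fun i => ¬ q ∣ i) = 1) :
    ∃ a i : ℕ, ¬ q ∣ a ∧ polyEval τ c = a * τ ^ i := by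
  induction c with
  | nil => simp at h
  | cons a l ih =>
    rw [List.countP_cons] at h
    by_cases ha : q ∣ a
    · obtain ⟨b, i, hb, hi⟩ := ih (by simpa [ha] using h)
      obtain ⟨m, rfl⟩ := ha
      refine ⟨b, i + 1, hb, ?_⟩
      rw [polyEval, hi]
      push_cast
      rw [hq]
      ring
    · refine ⟨a, 0, ha, ?_⟩
      have : l.countP (fun i => ¬ q ∣ i) = 0 := by simpa [ha] using h
      rw [List.countP_eq_zero] at this
      rw [polyEval, polyEval_eq_zero τ hq (c := l) (by simpa using this)]
      ring

/-- If exactly one coefficient is nonzero modulo each prime factor of `d`, then the expression is a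
unit in every ring in which `d = 0` and `τ` is a unit. -/
theorem isUnit_polyEval {R : Type*} [CommRing R] {d : ℕ} (hd : 1 ≤ d) (hR : (d : R) = 0) {τ : R}
    (hτ : IsUnit τ) {c : List ℕ}
    (h : ∀ q : ℕ, q.Prime → q ∣ d → c.countP (fun i => ¬ q ∣ i) = 1) :
    IsUnit (polyEval τ c) := by
  -- A non-unit lies in a maximal ideal. The residue field has prime characteristic `q ∣ d`, and
  -- there the expression becomes a single term `a τ ^ i` with `a` and `τ` nonzero, so it cannot
  -- vanish.
  by_contra hu
  obtain ⟨M, hM, hmem⟩ := exists_max_ideal_of_mem_nonunits hu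
  let _ : Field (R ⧸ M) := Ideal.Quotient.field M
  have hdK : (d : R ⧸ M) = 0 := by
    have := congrArg (Ideal.Quotient.mk M) hR
    simpa using this
  obtain ⟨q, hq⟩ := CharP.exists (R ⧸ M)
  have hqd : q ∣ d := (CharP.cast_eq_zero_iff (R ⧸ M) q d).1 hdK
  have hq0 : q ≠ 0 := by rintro rfl; exact absurd (Nat.eq_zero_of_zero_dvd hqd) (by omega)
  have hqp : q.Prime := (CharP.char_is_prime_or_zero (R ⧸ M) q).resolve_right hq0
  obtain ⟨a, i, ha, hi⟩ := exists_polyEval_eq_monomial (Ideal.Quotient.mk M τ)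
    (CharP.cast_eq_zero (R ⧸ M) q) (h q hqp hqd)
  rw [← map_polyEval, Ideal.Quotient.eq_zero_iff_mem.2 hmem] at hi
  have hτ' : IsUnit (Ideal.Quotient.mk M τ) := hτ.map _
  have := (mul_eq_zero.1 hi.symm).resolve_right (pow_ne_zero _ hτ'.ne_zero)
  exact ha ((CharP.cast_eq_zero_iff (R ⧸ M) q a).1 this)

theorem dvd_of_polyEval_X_eq_zero {q : ℕ} {c : List ℕ}
    (h : polyEval (Polynomial.X : Polynomial (ZMod q)) c = 0) : ∀ i ∈ c, q ∣ i := by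
  induction c with
  | nil => simp
  | cons a l ih =>
    have h0 : (a : ZMod q) = 0 := by
      have := congrArg (Polynomial.coeff · 0) h
      simpa [polyEval] using this
    have h1 : polyEval (Polynomial.X : Polynomial (ZMod q)) l = 0 := by
      ext n
      have := congrArg (Polynomial.coeff · (n + 1)) h
      simpa only [polyEval, ← Polynomial.C_eq_natCast, Polynomial.coeff_add,
        Polynomial.coeff_C_succ, Polynomial.coeff_X_mul, zero_add, Polynomial.coeff_zero] using this
    intro i hi
    rcases List.mem_cons.1 hi with rfl | hi
    · exact (ZMod.natCast_eq_zero_iff _ _).1 h0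
    · exact ih h1 i hi

theorem countP_of_polyEval_X_eq {q : ℕ} {c : List ℕ} {u : ZMod q} (hu : u ≠ 0) {k : ℕ}
    (h : polyEval (Polynomial.X : Polynomial (ZMod q)) c = Polynomial.C u * Polynomial.X ^ k) :
    c.countP (fun i => ¬ q ∣ i) = 1 := by
  induction c generalizing k with
  | nil =>
    have := congrArg (Polynomial.coeff · k) h
    simp [polyEval] at this
    exact absurd this.symm hu
  | cons a l ih =>
    have h0 := congrArg (Polynomial.coeff · 0) h
    have h1 (n : ℕ) := congrArg (Polynomial.coeff · (n + 1)) h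
    simp only [polyEval, ← Polynomial.C_eq_natCast, Polynomial.coeff_add,
      Polynomial.coeff_C_succ, Polynomial.coeff_X_mul, zero_add] at h1
    cases k with
    | zero =>
      have ha : ¬ q ∣ a := by
        rw [← ZMod.natCast_eq_zero_iff]
        simp [polyEval] at h0
        rwa [h0]
      have hl : polyEval (Polynomial.X : Polynomial (ZMod q)) l = 0 := by
        ext n
        simpa [Polynomial.coeff_C_succ] using h1 n
      have := List.countP_eq_zero (p := fun i => decide ¬ q ∣ i) (l := l)
      rw [List.countP_cons, this.2 (by simpa using dvd_of_polyEval_X_eq_zero hl)]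
      simp [ha]
    | succ k =>
      have ha : q ∣ a := by
        rw [← ZMod.natCast_eq_zero_iff]
        simpa [polyEval, pow_succ] using h0
      rw [List.countP_cons, ih (k := k)]
      · simp [ha]
      · ext n
        rw [h1 n, pow_succ, ← mul_assoc, Polynomial.coeff_mul_X]

theorem toLaurent_polyEval {R : Type*} [CommRing R] (c : List ℕ) :
    Polynomial.toLaurent (polyEval (Polynomial.X : Polynomial R) c) = polyEval (T 1) c := by
  rw [map_polyEval, Polynomial.toLaurent_X]

theorem dvd_of_polyEval_T_eq_zero {d : ℕ} {c : List ℕ}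
    (h : polyEval (T 1 : (ZMod d)[T;T⁻¹]) c = 0) : ∀ i ∈ c, d ∣ i := by
  rw [← toLaurent_polyEval, Polynomial.toLaurent_eq_zero] at h
  exact dvd_of_polyEval_X_eq_zero h

/-- A unit of the ring of Laurent polynomials has exactly one nonzero coefficient modulo each prime
factor of `d`. -/
theorem countP_of_isUnit_polyEval {d q : ℕ} (hq : q.Prime) (hqd : q ∣ d) {c : List ℕ}
    (h : IsUnit (polyEval (T 1 : (ZMod d)[T;T⁻¹]) c)) : c.countP (fun i => ¬ q ∣ i) = 1 := by
  have : Fact q.Prime := ⟨hq⟩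
  let x : ((ZMod q)[T;T⁻¹])ˣ := (isUnit_T (R := ZMod q) 1).unit
  -- Reduction of the coefficients modulo `q`.
  let φ : (ZMod d)[T;T⁻¹] →+* (ZMod q)[T;T⁻¹] :=
    eval₂ (C.comp (ZMod.castHom hqd (ZMod q))) x
  have hφ : φ (T 1) = T 1 := by
    simp only [φ, eval₂_T, zpow_one]
    rfl
  have h' := h.map φ
  rw [map_polyEval, hφ] at h'
  obtain ⟨g, hg⟩ := h'.exists_right_inv
  -- Clearing denominators in the inverse shows that the reduced polynomial divides a power of `X`.
  -- As `X` is prime over a field, the polynomial is a nonzero constant times a power of `X`.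
  obtain ⟨n, g', hg'⟩ := exists_T_pow g
  have hp : polyEval (Polynomial.X : Polynomial (ZMod q)) c * g' = Polynomial.X ^ n := by
    apply Polynomial.toLaurent_injective
    rw [map_mul, toLaurent_polyEval, hg', ← mul_assoc, hg, Polynomial.toLaurent_X_pow, one_mul]
  obtain ⟨k, -, hk⟩ := (dvd_prime_pow Polynomial.prime_X n).1 ⟨g', hp.symm⟩
  obtain ⟨u, hu⟩ := hk.symm
  obtain ⟨r, hr, hru⟩ := Polynomial.isUnit_iff.1 u.isUnit
  refine countP_of_polyEval_X_eq hr.ne_zero (k := k) ?_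
  rw [← hu, hru, mul_comm]

theorem natCast_laurent_eq_zero (d : ℕ) : ((d : ℕ) : (ZMod d)[T;T⁻¹]) = 0 := by
  rw [← map_natCast (C : ZMod d →+* (ZMod d)[T;T⁻¹]), ZMod.natCast_self, map_zero]

/-- A high power of `T ε` moves all exponents to the side of `ε`. Both signs are needed because the
second member of a standard pair may shift either way; having all large `k` available lets two
summands share one `k`. -/
theorem exists_polyEval_eq_T_mul {d : ℕ} (hd : 1 ≤ d) {ε : ℤ} (hε : ε = 1 ∨ ε = -1)
    (r : (ZMod d)[T;T⁻¹]) :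
    ∃ k₀ : ℕ, ∀ k : ℕ, k₀ ≤ k → ∃ c : List ℕ, T (ε * k) * r = polyEval (T ε) c := by
  have : NeZero d := ⟨by omega⟩
  induction r using LaurentPolynomial.induction_on' with
  | add p q hp hq =>
    obtain ⟨k₁, h₁⟩ := hp
    obtain ⟨k₂, h₂⟩ := hq
    refine ⟨max k₁ k₂, fun k hk => ?_⟩
    obtain ⟨c₁, hc₁⟩ := h₁ k (by omega)
    obtain ⟨c₂, hc₂⟩ := h₂ k (by omega)
    obtain ⟨c, hc⟩ := exists_polyEval_add (T ε : (ZMod d)[T;T⁻¹]) c₁ c₂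
    exact ⟨c, by rw [mul_add, hc₁, hc₂, hc]⟩
  | C_mul_T n a =>
    -- Since `ε * ε = 1`, the exponent `ε * k + n` is `ε` times `k + ε * n`, which is nonnegative
    -- once `k` is at least `|n|`.
    refine ⟨n.natAbs, fun k hk => ⟨List.replicate (k + ε * n).toNat 0 ++ [a.val], ?_⟩⟩
    have hn : ((k + ε * n).toNat : ℤ) = k + ε * n := by
      apply Int.toNat_of_nonneg
      rcases hε with rfl | rfl <;> omega
    rw [polyEval_replicate_append, T_pow, hn, ← map_natCast (C : ZMod d →+* (ZMod d)[T;T⁻¹]),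
      ZMod.natCast_zmod_val, mul_left_comm, ← T_add]
    congr 2
    rcases hε with rfl | rfl <;> ring

/-! ## Lamplighter groups over an arbitrary abelian group -/

/-- The group `(ℤ/dℤ) ≀ A`, with the base written as the additive group of the group ring. -/
@[ext]
structure LampGroup (d : ℕ) (A : Type) [AddCommGroup A] where
  lamps : AddMonoidAlgebra (ZMod d) A
  pos : A

namespace LampGroup

variable {d : ℕ} {A : Type} [AddCommGroup A]

noncomputable instance : Mul (LampGroup d A) :=
  ⟨fun x y => ⟨x.lamps + AddMonoidAlgebra.single x.pos 1 * y.lamps, x.pos + y.pos⟩⟩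

noncomputable instance : One (LampGroup d A) := ⟨⟨0, 0⟩⟩

noncomputable instance : Inv (LampGroup d A) :=
  ⟨fun x => ⟨-(AddMonoidAlgebra.single (-x.pos) 1 * x.lamps), -x.pos⟩⟩

@[simp] theorem mul_lamps (x y : LampGroup d A) :
    (x * y).lamps = x.lamps + AddMonoidAlgebra.single x.pos 1 * y.lamps := rfl

@[simp] theorem mul_pos' (x y : LampGroup d A) : (x * y).pos = x.pos + y.pos := rfl

@[simp] theorem one_lamps : (1 : LampGroup d A).lamps = 0 := rfl

@[simp] theorem one_pos : (1 : LampGroup d A).pos = 0 := rfl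

@[simp] theorem inv_lamps (x : LampGroup d A) :
    x⁻¹.lamps = -(AddMonoidAlgebra.single (-x.pos) 1 * x.lamps) := rfl

@[simp] theorem inv_pos' (x : LampGroup d A) : x⁻¹.pos = -x.pos := rfl

noncomputable instance : Group (LampGroup d A) :=
  Group.ofLeftAxioms
    (fun x y z => by
      ext1
      · simp only [mul_lamps, mul_pos', mul_add, ← mul_assoc, AddMonoidAlgebra.single_mul_single,
          mul_one, add_assoc]
      · exact add_assoc _ _ _)
    (fun x => by
      ext1
      · simp [← AddMonoidAlgebra.one_def]
      · simp)
    (fun x => by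
      ext1 <;> simp)

/-- The projection to `A`. -/
def posHom : LampGroup d A →* Multiplicative A where
  toFun x := Multiplicative.ofAdd x.pos
  map_one' := rfl
  map_mul' _ _ := rfl

@[simp] theorem pow_pos' (x : LampGroup d A) (k : ℕ) : (x ^ k).pos = k • x.pos := by
  induction k with
  | zero => simp
  | succ k ih => rw [pow_succ, mul_pos', ih, succ_nsmul]

@[simp] theorem zpow_pos' (x : LampGroup d A) (k : ℤ) : (x ^ k).pos = k • x.pos :=
  congrArg Multiplicative.toAdd (map_zpow (posHom (d := d) (A := A)) x k)

/-- The inclusion of the base. -/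
noncomputable def base (r : AddMonoidAlgebra (ZMod d) A) : LampGroup d A := ⟨r, 0⟩

@[simp] theorem base_lamps (r : AddMonoidAlgebra (ZMod d) A) : (base r).lamps = r := rfl

@[simp] theorem base_pos (r : AddMonoidAlgebra (ZMod d) A) : (base r).pos = 0 := rfl

theorem eq_base {x : LampGroup d A} (hx : x.pos = 0) : x = base x.lamps := by
  ext1
  · rfl
  · exact hx

theorem base_injective : Function.Injective (base : AddMonoidAlgebra (ZMod d) A → _) :=
  fun _ _ h => congrArg lamps h

@[simp] theorem base_zero : base (0 : AddMonoidAlgebra (ZMod d) A) = 1 := rfl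

theorem base_mul (r s : AddMonoidAlgebra (ZMod d) A) : base r * base s = base (r + s) := by
  ext1 <;> simp [← AddMonoidAlgebra.one_def]

theorem base_pow (r : AddMonoidAlgebra (ZMod d) A) (k : ℕ) :
    base r ^ k = base ((k : AddMonoidAlgebra (ZMod d) A) * r) := by
  induction k with
  | zero => simp
  | succ k ih => rw [pow_succ, ih, base_mul]; push_cast; ring_nf

theorem natCast_eq_zero : ((d : ℕ) : AddMonoidAlgebra (ZMod d) A) = 0 := by
  rw [AddMonoidAlgebra.natCast_def, ZMod.natCast_self, AddMonoidAlgebra.single_zero]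

theorem base_pow_self (r : AddMonoidAlgebra (ZMod d) A) : base r ^ d = 1 := by
  rw [base_pow, natCast_eq_zero, zero_mul, base_zero]

/-- The base is commutative, so the lamps of `y` cancel and only its position acts, as
multiplication by a monomial. -/
theorem conj_base (y : LampGroup d A) (r : AddMonoidAlgebra (ZMod d) A) :
    y * base r * y⁻¹ = base (AddMonoidAlgebra.single y.pos 1 * r) := by
  rw [mul_inv_eq_iff_eq_mul]
  ext1 <;> simp [← AddMonoidAlgebra.one_def, add_comm]

/-- The shift by `a`. -/
noncomputable def shift (a : A) : LampGroup d A := ⟨0, a⟩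

@[simp] theorem shift_lamps (a : A) : (shift a : LampGroup d A).lamps = 0 := rfl

@[simp] theorem shift_pos (a : A) : (shift a : LampGroup d A).pos = a := rfl

theorem shift_add (a b : A) : (shift (a + b) : LampGroup d A) = shift a * shift b := by
  ext1 <;> simp

/-- Functoriality in the abelian group. -/
noncomputable def map {B : Type} [AddCommGroup B] (φ : A →+ B) :
    LampGroup d A →* LampGroup d B where
  toFun x := ⟨AddMonoidAlgebra.mapDomainRingHom (ZMod d) φ x.lamps, φ x.pos⟩
  map_one' := by ext1 <;> simp
  map_mul' x y := by
    ext1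
    · change AddMonoidAlgebra.mapDomainRingHom (ZMod d) φ (x.lamps + _ * y.lamps) = _
      rw [map_add, map_mul]
      simp
    · simp

theorem map_injective {B : Type} [AddCommGroup B] {φ : A →+ B} (hφ : Function.Injective φ) :
    Function.Injective (map φ : LampGroup d A →* LampGroup d B) := by
  intro x y h
  ext1
  · exact AddMonoidAlgebra.mapDomain_injective hφ (congrArg lamps h)
  · exact hφ (congrArg pos h)

end LampGroup

/-- The lamplighter group in terms of Laurent polynomials. -/
noncomputable def lamplighterEquiv (d : ℕ) : Lamplighter d ≃* LampGroup d ℤ where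
  toFun x :=
    ⟨.ofCoeff (Finsupp.ofSupportFinite (fun i => (x.left.1 (Multiplicative.ofAdd i)).toAdd)
      (x.left.2.preimage Multiplicative.ofAdd.injective.injOn)), x.right.toAdd⟩
  invFun y :=
    ⟨⟨fun i => Multiplicative.ofAdd (y.lamps.coeff i.toAdd),
      y.lamps.coeff.hasFiniteSupport.preimage Multiplicative.toAdd.injective.injOn⟩,
      Multiplicative.ofAdd y.pos⟩
  left_inv x := rfl
  right_inv y := by
    ext i
    · rfl
    · rfl
  map_mul' x y := by
    ext i
    · simp only [LampGroup.mul_lamps, AddMonoidAlgebra.coeff_add, Finsupp.add_apply,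
        AddMonoidAlgebra.coeff_single_mul_apply, one_mul]
      rfl
    · rfl

/-! ## Standard pairs of generators -/

/-- The product of the `yⁱ x^(cᵢ) y⁻ⁱ`. -/
def horner {M : Type*} [Group M] (x y : M) : List ℕ → M
  | [] => 1
  | c :: l => x ^ c * (y * horner x y l * y⁻¹)

/-- Coefficient lists of certain non-units of `(ℤ/dℤ)[T, T⁻¹]`; every non-unit has an associate
of this form. -/
def NonunitCoeffs (d : ℕ) (c : List ℕ) : Prop :=
  (∃ q ∈ d.primeFactorsList, c.countP (fun i => ¬ q ∣ i) ≠ 1) ∧ 0 < c.sum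

/-- A universal description of the pairs of elements of the lamplighter group which consist of a
generator of the base, as a module, and of a shift by `1` or `-1`. -/
structure IsStdPair {M : Type*} [Group M] (d : ℕ) (x y : M) : Prop where
  pow_eq_one : x ^ d = 1
  commute : ∀ k : ℕ, x * (y ^ k * x * y⁻¹ ^ k) = y ^ k * x * y⁻¹ ^ k * x
  pow_ne_one : ∀ k : ℕ, y ^ (k + 1) ≠ 1
  horner_ne_one : ∀ c : List ℕ, (¬ ∀ i ∈ c, d ∣ i) → horner x y c ≠ 1
  -- In the lamplighter group the elements with trivial `d`-th power are those of position `0`, so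
  -- this prevents the position of `y` from being a proper multiple of another position.
  primitive : ∀ (w : M) (k : ℕ), (y⁻¹ * w ^ (k + 2)) ^ d ≠ 1
  ne_horner : ∀ (w : M) (c : List ℕ), NonunitCoeffs d c → x ≠ horner w y c

/-- Every element is a product of a base element generated by `x` and a shift, up to conjugation
by powers of `y`. -/
def Generates {M : Type*} [Group M] (x y : M) : Prop :=
  ∀ z : M, ∃ (m n : ℕ) (c : List ℕ), y ^ m * z = horner x y c * y ^ n

namespace LampGroup

variable {d : ℕ}

/-- The dictionary between words and the module structure: conjugation by `y` is multiplication by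
`T y.pos`, so Horner words in a base element are its multiples by polynomials. -/
theorem horner_base (r : (ZMod d)[T;T⁻¹]) (y : LampGroup d ℤ) (c : List ℕ) :
    horner (base r) y c = base (polyEval (T y.pos) c * r) := by
  induction c with
  | nil => simp [horner, polyEval]
  | cons a l ih =>
    rw [horner, ih, conj_base, base_pow, base_mul, polyEval, add_mul, mul_assoc]
    rfl

theorem horner_pos (z y : LampGroup d ℤ) (c : List ℕ) :
    (horner z y c).pos = c.sum * z.pos := by
  induction c with
  | nil => simp [horner]
  | cons a l ih =>
    simp [horner, ih]
    ring

theorem pos_eq_zero_of_pow_eq_one {z : LampGroup d ℤ} {k : ℕ} (hk : 1 ≤ k) (h : z ^ k = 1) :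
    z.pos = 0 := by
  have := congrArg pos h
  simp only [pow_pos', one_pos, nsmul_eq_mul, mul_eq_zero] at this
  exact this.resolve_left (by exact_mod_cast (by omega : k ≠ 0))

theorem isStdPair_base_shift (hd : 1 ≤ d) :
    IsStdPair d (base 1 : LampGroup d ℤ) (shift 1) where
  pow_eq_one := base_pow_self _
  commute k := by
    rw [inv_pow, conj_base, base_mul, base_mul, add_comm]
  pow_ne_one k h := by
    have := congrArg pos h
    simp at this
    omega
  horner_ne_one c hc h := by
    rw [horner_base, ← base_zero, mul_one] at h
    exact hc (dvd_of_polyEval_T_eq_zero (base_injective h))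
  primitive w k h := by
    have := pos_eq_zero_of_pow_eq_one hd h
    simp only [mul_pos', inv_pos', shift_pos, pow_pos', nsmul_eq_mul] at this
    have h1 : ((k + 2 : ℕ) : ℤ) ∣ 1 := ⟨w.pos, by omega⟩
    have h2 := Int.le_of_dvd (by norm_num) h1
    omega
  ne_horner w c hc h := by
    obtain ⟨⟨q, hq, hne⟩, hs⟩ := hc
    have hp := congrArg pos h
    rw [horner_pos, base_pos] at hp
    -- This is what the positive coefficient sum is for: it forces `w` into the base, where the
    -- equation exhibits the polynomial as a divisor of `1`.
    have hw : w.pos = 0 := (mul_eq_zero.1 hp.symm).resolve_left (by exact_mod_cast hs.ne')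
    rw [eq_base hw, horner_base] at h
    have h1 := base_injective h
    refine hne (countP_of_isUnit_polyEval (Nat.prime_of_mem_primeFactorsList hq)
      (Nat.dvd_of_mem_primeFactorsList hq) ?_)
    exact IsUnit.of_mul_eq_one _ h1.symm

theorem pos_of_isStdPair (hd : 1 ≤ d) {x y : LampGroup d ℤ} (h : IsStdPair d x y) :
    y.pos = 1 ∨ y.pos = -1 := by
  have h0 : y.pos ≠ 0 := by
    intro h0
    refine h.pow_ne_one (d - 1) ?_
    rw [Nat.sub_add_cancel hd, eq_base h0, base_pow_self]
  by_contra hne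
  -- If the position of `y` has absolute value at least 2, then `y` agrees modulo the base with a
  -- proper power of the unit shift in its direction. The exponent is written as `k + 2` with `k =
  -- |y.pos| - 2`.
  refine h.primitive (shift y.pos.sign) (y.pos.natAbs - 2) ?_
  have h2 : y.pos.natAbs - 2 + 2 = y.pos.natAbs := by omega
  have h3 : (y⁻¹ * shift y.pos.sign ^ (y.pos.natAbs - 2 + 2)).pos = 0 := by
    have := Int.sign_mul_natAbs y.pos
    rw [h2]
    simp only [mul_pos', inv_pos', pow_pos', shift_pos, nsmul_eq_mul]
    rw [mul_comm, this]
    omega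
  rw [eq_base h3, base_pow_self]

theorem isUnit_of_isStdPair (hd : 1 ≤ d) {x y : LampGroup d ℤ} (h : IsStdPair d x y) :
    IsUnit x.lamps := by
  have hε := pos_of_isStdPair hd h
  have hx := eq_base (pos_eq_zero_of_pow_eq_one hd h.pow_eq_one)
  set r := x.lamps
  by_contra hr
  obtain ⟨k, hk⟩ := exists_polyEval_eq_T_mul hd hε r
  obtain ⟨c, hc⟩ := hk k le_rfl
  have hc' : polyEval (T y.pos) (d :: c) = T (y.pos * (k + 1)) * r := by
    rw [polyEval, natCast_laurent_eq_zero, ← hc, zero_add, ← mul_assoc, ← T_add]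
    congr 2
    ring
  -- The monomial `w` undoes the shift that made `r` polynomial. The extra leading coefficient `d`
  -- vanishes in the ring; it makes the coefficient sum positive at the cost of one more shift,
  -- hence `k + 1`.
  refine h.ne_horner (base (T (-(y.pos * (k + 1))))) (d :: c) ⟨?_, ?_⟩ ?_
  · by_contra hq
    push Not at hq
    refine hr (isUnit_of_mul_isUnit_right (x := T (y.pos * (k + 1))) ?_)
    rw [← hc']
    refine isUnit_polyEval hd (natCast_laurent_eq_zero d) (isUnit_T _) fun q hqp hqd => ?_
    exact hq q ((Nat.mem_primeFactorsList (by omega)).2 ⟨hqp, hqd⟩)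
  · simp
    omega
  · rw [horner_base, hc', hx, mul_assoc, mul_comm r, ← mul_assoc, ← T_add]
    simp

/-- Strip the position of `z` with a power of `y`. The remaining base element is a multiple of the
unit `x`, and conjugation by a high power of `y` makes the multiplier a polynomial in `T y.pos`. -/
theorem generates_of_isStdPair (hd : 1 ≤ d) {x y : LampGroup d ℤ} (h : IsStdPair d x y) :
    Generates x y := by
  have hε := pos_of_isStdPair hd h
  have hε2 : y.pos * y.pos = 1 := by rcases hε with h | h <;> simp [h]
  have hx := eq_base (pos_eq_zero_of_pow_eq_one hd h.pow_eq_one)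
  obtain ⟨u, hu⟩ := isUnit_of_isStdPair hd h
  intro z
  have hz0 : (z * y ^ (-(z.pos * y.pos))).pos = 0 := by
    simp [mul_assoc, hε2]
  have hz := eq_base hz0
  set s := (z * y ^ (-(z.pos * y.pos))).lamps
  obtain ⟨k, hk⟩ := exists_polyEval_eq_T_mul hd hε (s * ↑u⁻¹)
  -- The exponent has two tasks: to make the multiplier polynomial, and to make `m + z.pos * y.pos`
  -- a natural number.
  set m := max k (z.pos * y.pos).natAbs
  obtain ⟨c, hc⟩ := hk m (le_max_left _ _)
  have hm : ((m + z.pos * y.pos).toNat : ℤ) = m + z.pos * y.pos := by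
    apply Int.toNat_of_nonneg
    have : (z.pos * y.pos).natAbs ≤ m := le_max_right _ _
    omega
  refine ⟨m, (m + z.pos * y.pos).toNat, c, ?_⟩
  have hh : horner x y c = y ^ m * base s * (y ^ m)⁻¹ := by
    rw [hx, horner_base, conj_base, ← hc, ← hu, mul_assoc, mul_assoc, Units.inv_mul, mul_one,
      pow_pos', nsmul_eq_mul, mul_comm y.pos]
    rfl
  rw [hh, ← zpow_natCast y (Int.toNat _), hm, ← hz, zpow_add, zpow_natCast, zpow_neg]
  group

end LampGroup

/-! ## Recognising the lamplighter group -/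

section Recognise

variable {M : Type} [Group M] {d : ℕ} {x y : M}

/-- The hypothesis compares `x` only with its forward conjugates; conjugating by powers of `y` and
symmetry give all pairs. -/
theorem IsStdPair.commute_conj (h : IsStdPair d x y) (i j : ℤ) :
    Commute (y ^ i * x * y ^ (-i)) (y ^ j * x * y ^ (-j)) := by
  have key (n : ℕ) (i : ℤ) :
      Commute (y ^ i * x * y ^ (-i)) (y ^ (i + n) * x * y ^ (-(i + n))) := by
    have h1 : Commute x (y ^ n * x * (y ^ n)⁻¹) := by
      have := h.commute n
      rwa [inv_pow] at this
    have h2 := h1.map (MulAut.conj (y ^ i))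
    simp only [MulAut.conj_apply] at h2
    have e1 : y ^ i * x * y ^ (-i) = y ^ i * x * (y ^ i)⁻¹ := by rw [zpow_neg]
    have e2 : y ^ (i + n) * x * y ^ (-(i + n)) =
        y ^ i * (y ^ n * x * (y ^ n)⁻¹) * (y ^ i)⁻¹ := by
      rw [zpow_neg, zpow_add, zpow_natCast]
      group
    rw [e1, e2]
    exact h2
  rcases le_total i j with hij | hij
  · obtain ⟨n, rfl⟩ := Int.le.dest hij
    exact key n i
  · obtain ⟨n, rfl⟩ := Int.le.dest hij
    exact (key n j).symm

/-- The homomorphism from the base of the lamplighter group determined by a pair of elements. -/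
theorem IsStdPair.exists_baseHom (hd : 1 ≤ d) (h : IsStdPair d x y) :
    ∃ B : (ZMod d)[T;T⁻¹] → M, (∀ r s, B (r + s) = B r * B s) ∧
      (∀ n r, B (T n * r) = y ^ n * B r * y ^ (-n)) ∧ ∀ c : ℕ, B c = x ^ c := by
  have : NeZero d := ⟨by omega⟩
  let u : ℤ → M := fun i => y ^ i * x * y ^ (-i)
  have hcomm : ∀ a ∈ Set.range u, ∀ b ∈ Set.range u, a * b = b * a := by
    rintro _ ⟨i, rfl⟩ _ ⟨j, rfl⟩
    exact h.commute_conj i j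
  -- `M` is not abelian, so the map is built into the abelian subgroup generated by the conjugates,
  -- where the universal property of a direct sum is available.
  let _ : CommGroup (Subgroup.closure (Set.range u)) :=
    { (inferInstance : Group (Subgroup.closure (Set.range u))) with
      mul_comm := (Subgroup.isMulCommutative_closure hcomm).is_comm.comm }
  let u' : ℤ → Subgroup.closure (Set.range u) := fun i =>
    ⟨u i, Subgroup.subset_closure ⟨i, rfl⟩⟩
  have hu' (i : ℤ) (n : ℕ) : ((u' i ^ n : Subgroup.closure (Set.range u)) : M) =
      y ^ i * x ^ n * y ^ (-i) := by
    induction n with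
    | zero => simp
    | succ n ih =>
      rw [pow_succ, Subgroup.coe_mul, ih, pow_succ]
      simp only [u', u, zpow_neg]
      group
  have hpow (i : ℤ) : zmultiplesHom _ (Additive.ofMul (u' i)) (d : ℤ) = 0 := by
    rw [zmultiplesHom_apply, natCast_zsmul, ← ofMul_pow, ofMul_eq_zero]
    ext
    rw [hu', h.pow_eq_one]
    simp
  -- The summand at `i` maps through `ℤ/d` because the `i`-th conjugate of `x` has exponent `d`.
  let b : ℤ → ZMod d →+ Additive (Subgroup.closure (Set.range u)) := fun i =>
    ZMod.lift d ⟨zmultiplesHom _ (Additive.ofMul (u' i)), hpow i⟩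
  let B' : (ZMod d)[T;T⁻¹] →+ Additive (Subgroup.closure (Set.range u)) :=
    (Finsupp.liftAddHom b).comp AddMonoidAlgebra.coeffAddEquiv.toAddMonoidHom
  let B : (ZMod d)[T;T⁻¹] → M := fun r => ((B' r).toMul : Subgroup.closure (Set.range u))
  have hadd (r s : (ZMod d)[T;T⁻¹]) : B (r + s) = B r * B s := by
    simp only [B, map_add, toMul_add, Subgroup.coe_mul]
  have hsingle (i : ℤ) (n : ℕ) :
      B (AddMonoidAlgebra.single i (n : ZMod d)) = y ^ i * x ^ n * y ^ (-i) := by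
    have : B' (AddMonoidAlgebra.single i (n : ZMod d)) = n • Additive.ofMul (u' i) := by
      change Finsupp.liftAddHom b (Finsupp.single i (n : ZMod d)) = _
      rw [Finsupp.liftAddHom_apply_single]
      have := ZMod.lift_coe d ⟨zmultiplesHom _ (Additive.ofMul (u' i)), hpow i⟩ (n : ℤ)
      simp only [b]
      rw [Int.cast_natCast] at this
      rw [this]
      simp
    simp only [B, this, ← ofMul_pow, toMul_ofMul, hu']
  have hzero : B 0 = 1 := by simp [B]
  refine ⟨B, hadd, fun n r => ?_, fun c => ?_⟩
  · induction r using AddMonoidAlgebra.induction_linear with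
    | zero => simp [hzero]
    | add r s hr hs =>
      rw [mul_add, hadd, hr, hs, hadd, zpow_neg]
      group
    | single i a =>
      rw [← ZMod.natCast_zmod_val a, hsingle, T, AddMonoidAlgebra.single_mul_single, one_mul,
        hsingle, zpow_neg, zpow_neg, zpow_neg, zpow_add]
      group
  · rw [AddMonoidAlgebra.natCast_def, hsingle]
    simp

/-- The base homomorphism extends by powers of `y` to the whole lamp group. Surjectivity is
generation; injectivity combines the infinite order of `y` with the absence of relations among the
conjugates of `x`. -/
theorem IsStdPair.nonempty_mulEquiv (hd : 1 ≤ d) (h : IsStdPair d x y) (hg : Generates x y) :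
    Nonempty (LampGroup d ℤ ≃* M) := by
  obtain ⟨B, hadd, hT, hnat⟩ := h.exists_baseHom hd
  have hB0 : B 0 = 1 := by
    have := hadd 0 0
    rwa [add_zero, left_eq_mul] at this
  have hhorner (c : List ℕ) : horner x y c = B (polyEval (T 1) c) := by
    induction c with
    | nil => rw [polyEval, hB0, horner]
    | cons a l ih => rw [polyEval, hadd, hnat, hT, horner, ih, zpow_neg, zpow_one]
  let Φ : LampGroup d ℤ →* M :=
    MonoidHom.mk' (fun z => B z.lamps * y ^ z.pos) fun z w => by
      have : AddMonoidAlgebra.single z.pos 1 * w.lamps = T z.pos * w.lamps := rfl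
      rw [LampGroup.mul_lamps, this, LampGroup.mul_pos', hadd, hT, zpow_add, zpow_neg]
      group
  have hpow (r : (ZMod d)[T;T⁻¹]) : B r ^ d = 1 := by
    have := map_pow Φ (LampGroup.base r) d
    rw [LampGroup.base_pow_self, map_one] at this
    simpa [Φ] using this.symm
  refine ⟨MulEquiv.ofBijective Φ ⟨?_, ?_⟩⟩
  · rw [injective_iff_map_eq_one]
    intro z hz
    change B z.lamps * y ^ z.pos = 1 at hz
    have hp : z.pos = 0 := by
      by_contra hne
      -- For a kernel element, `y ^ z.pos` is inverse to an image of the base, hence has exponent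
      -- `d`.
      have h1 : y ^ (z.pos * d) = 1 := by
        rw [zpow_mul, eq_inv_of_mul_eq_one_right hz, zpow_natCast, inv_pow, hpow, inv_one]
      have h2 : y ^ (z.pos * d).natAbs = 1 := by
        rcases Int.natAbs_eq (z.pos * d) with h3 | h3
        · rw [h3, zpow_natCast] at h1
          exact h1
        · rw [h3, zpow_neg, zpow_natCast, inv_eq_one] at h1
          exact h1
      have h3 : (z.pos * d).natAbs ≠ 0 := by
        rw [Int.natAbs_ne_zero]
        exact mul_ne_zero hne (by exact_mod_cast (by omega : d ≠ 0))
      obtain ⟨k, hk⟩ := Nat.exists_eq_succ_of_ne_zero h3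
      exact h.pow_ne_one k (by rw [← Nat.succ_eq_add_one, ← hk, h2])
    rw [hp, zpow_zero, mul_one] at hz
    -- The relations are only excluded for polynomial multipliers, so the kernel element is first
    -- shifted to a polynomial.
    obtain ⟨k, hk⟩ := exists_polyEval_eq_T_mul hd (ε := 1) (Or.inl rfl) z.lamps
    obtain ⟨c, hc⟩ := hk k le_rfl
    have hc1 : horner x y c = 1 := by
      rw [hhorner, ← hc, hT, hz]
      simp
    have hdvd : ∀ i ∈ c, d ∣ i := by
      by_contra hne
      exact h.horner_ne_one c hne hc1
    rw [polyEval_eq_zero _ (natCast_laurent_eq_zero d) hdvd] at hc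
    have hl : z.lamps = 0 := (isUnit_T _).mul_right_eq_zero.1 hc
    ext1
    · exact hl
    · exact hp
  · intro z
    obtain ⟨m, n, c, hz⟩ := hg z
    have hy : Φ (LampGroup.shift 1) = y := by
      change B 0 * y ^ (1 : ℤ) = y
      rw [hB0, zpow_one, one_mul]
    have hb : Φ (LampGroup.base (polyEval (T 1) c)) = horner x y c := by
      change B _ * y ^ (0 : ℤ) = _
      rw [zpow_zero, mul_one, hhorner]
      rfl
    refine ⟨(LampGroup.shift 1 ^ m)⁻¹ * (LampGroup.base (polyEval (T 1) c) *
      LampGroup.shift 1 ^ n), ?_⟩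
    rw [map_mul, map_mul, map_inv, map_pow, map_pow, hy, hb, ← hz]
    group

end Recognise

theorem horner_map {M N : Type*} [Group M] [Group N] (f : M ≃* N) (x y : M) (c : List ℕ) :
    f (horner x y c) = horner (f x) (f y) c := by
  induction c with
  | nil => simp [horner]
  | cons a l ih => simp [horner, ih]

/-! ## Terms and literals expressing that a pair is standard -/

namespace GTerm

def pow (t : GTerm) (k : ℕ) : GTerm := Nat.rec one (fun _ s => mul s t) k

/-- A `foldr` rather than a pattern match, so that primitive recursiveness is immediate. -/
def horner (x y : GTerm) (c : List ℕ) : GTerm :=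
  c.foldr (fun a s => mul (pow x a) (mul (mul y s) (inv y))) one

theorem eval_pow {M : Type} [Group M] (v : ℕ → M) (t : GTerm) (k : ℕ) :
    (t.pow k).eval v = t.eval v ^ k := by
  induction k with
  | zero => rw [pow_zero]; rfl
  | succ k ih => rw [pow_succ, ← ih]; rfl

theorem eval_horner {M : Type} [Group M] (v : ℕ → M) (x y : GTerm) (c : List ℕ) :
    (horner x y c).eval v = _root_.horner (x.eval v) (y.eval v) c := by
  induction c with
  | nil => rfl
  | cons a l ih => rw [_root_.horner, ← ih, ← eval_pow]; rfl

theorem vars_pow (t : GTerm) (k : ℕ) : (t.pow k).vars ⊆ t.vars := by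
  induction k with
  | zero => exact Set.empty_subset _
  | succ k ih => exact Set.union_subset ih subset_rfl

theorem vars_horner (x y : GTerm) (c : List ℕ) : (horner x y c).vars ⊆ x.vars ∪ y.vars := by
  induction c with
  | nil => exact Set.empty_subset _
  | cons a l ih =>
    have hy : y.vars ⊆ x.vars ∪ y.vars := Set.subset_union_right
    exact Set.union_subset ((vars_pow x a).trans Set.subset_union_left)
      (Set.union_subset (Set.union_subset hy ih) hy)

theorem primrec_pow : Primrec₂ pow :=
  Primrec.nat_rec' (f := fun p : GTerm × ℕ => p.2) (g := fun _ => one)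
    (h := fun p q => mul q.2 p.1) Primrec.snd (Primrec.const _)
    (primrec_mul.comp (Primrec.snd.comp Primrec.snd) (Primrec.fst.comp Primrec.fst))

theorem primrec_horner {α : Type*} [Primcodable α] {x y : α → GTerm} {c : α → List ℕ}
    (hx : Primrec x) (hy : Primrec y) (hc : Primrec c) :
    Primrec fun a => horner (x a) (y a) (c a) := by
  refine Primrec.list_foldr (h := fun a p => mul (pow (x a) p.1) (mul (mul (y a) p.2) (inv (y a))))
    hc (Primrec.const one) ?_
  have hy' : Primrec fun p : α × ℕ × GTerm => y p.1 := hy.comp Primrec.fst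
  exact primrec_mul.comp
    (primrec_pow.comp (hx.comp Primrec.fst) (Primrec.fst.comp Primrec.snd))
    (primrec_mul.comp (primrec_mul.comp hy' (Primrec.snd.comp Primrec.snd))
      (primrec_inv.comp hy'))

end GTerm

instance (d : ℕ) : DecidablePred (NonunitCoeffs d) := fun c => by
  unfold NonunitCoeffs; infer_instance

theorem primrecPred_nonunitCoeffs (d : ℕ) : PrimrecPred (NonunitCoeffs d) := by
  have hcount (q : ℕ) : Primrec fun c : List ℕ => c.countP (fun i => ¬ q ∣ i) := by
    refine (Primrec.list_foldr (f := fun c : List ℕ => c) (g := fun _ => 0)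
      (h := fun _ p => p.2 + if p.1 % q = 0 then 0 else 1) Primrec.id (Primrec.const 0)
      ?_).of_eq fun c => ?_
    · exact Primrec.nat_add.comp (Primrec.snd.comp Primrec.snd)
        (Primrec.ite (Primrec.eq.comp (Primrec.nat_mod.comp (Primrec.fst.comp Primrec.snd)
          (Primrec.const q)) (Primrec.const 0)) (Primrec.const 0) (Primrec.const 1))
    · induction c with
      | nil => rfl
      | cons a l ih =>
        rw [List.foldr_cons, ih, List.countP_cons]
        simp only [Nat.dvd_iff_mod_eq_zero]
        by_cases h : a % q = 0 <;> simp [h]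
  -- The primes dividing the fixed `d` form a constant list, so the quantifier over them is a finite
  -- disjunction.
  have hex (L : List ℕ) :
      PrimrecPred fun c : List ℕ => ∃ q ∈ L, c.countP (fun i => ¬ q ∣ i) ≠ 1 := by
    induction L with
    | nil => exact (Primrec.primrecPred (p := fun _ => False) (Primrec.const false)).of_eq (by simp)
    | cons a L ih =>
      exact (((Primrec.eq.comp (hcount a) (Primrec.const 1)).not).or ih).of_eq (by simp)
  have hsum : Primrec fun c : List ℕ => c.sum :=
    Primrec.list_foldr (f := fun c : List ℕ => c) (g := fun _ => 0)
      (h := fun _ p => p.1 + p.2) Primrec.id (Primrec.const 0)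
      (Primrec.nat_add.comp (Primrec.fst.comp Primrec.snd) (Primrec.snd.comp Primrec.snd))
  exact (hex d.primeFactorsList).and (Primrec.nat_lt.comp (Primrec.const 0) hsum)

theorem primrecPred_forall_dvd (d : ℕ) : PrimrecPred fun c : List ℕ => ∀ i ∈ c, d ∣ i :=
  PrimrecPred.forall_mem_list ((Primrec.eq.comp (Primrec.nat_mod.comp Primrec.id
    (Primrec.const d)) (Primrec.const 0)).of_eq fun _ => (Nat.dvd_iff_mod_eq_zero).symm)

/-- The two sides of the equations and inequations which say that `x`, `y` is a standard pair. -/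
def stdTerms (d : ℕ) (x y w : GTerm) (j : ℕ × ℕ × List ℕ) : GTerm × GTerm :=
  if j.1 = 0 then (x.pow d, .one)
  else if j.1 = 1 then
    (x.mul (((y.pow j.2.1).mul x).mul (y.inv.pow j.2.1)),
      (((y.pow j.2.1).mul x).mul (y.inv.pow j.2.1)).mul x)
  else if j.1 = 2 then (y.pow (j.2.1 + 1), .one)
  -- Coefficient lists to which the condition does not apply receive the dummy inequation `y ^ 1 ≠
  -- 1`, an instance of `pow_ne_one`. This keeps the family total on all codes.
  else if j.1 = 3 then if ∀ i ∈ j.2.2, d ∣ i then (y.pow 1, .one) else (x.horner y j.2.2, .one)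
  else if j.1 = 4 then ((y.inv.mul (w.pow (j.2.1 + 2))).pow d, .one)
  else if NonunitCoeffs d j.2.2 then (x, w.horner y j.2.2) else (y.pow 1, .one)

/-- An equation or an inequation. -/
def literal (b : Bool) (p : GTerm × GTerm) : QF :=
  bif b then .eq p.1 p.2 else .not (.eq p.1 p.2)

/-- The conditions with tags 0 and 1 are equations, all others are inequations. -/
def stdLit (d : ℕ) (x y w : GTerm) (j : ℕ × ℕ × List ℕ) : QF :=
  literal (decide (j.1 < 2)) (stdTerms d x y w j)

/-- The negation is again a literal, as it must be to be read off an atomic diagram. -/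
def stdNeg (d : ℕ) (x y w : GTerm) (j : ℕ × ℕ × List ℕ) : QF :=
  literal (!decide (j.1 < 2)) (stdTerms d x y w j)

def genLit (x y z : GTerm) (j : ℕ × ℕ × List ℕ) : QF :=
  .eq ((y.pow j.1).mul z) ((x.horner y j.2.2).mul (y.pow j.2.1))

theorem isLiteral_literal (b : Bool) (p : GTerm × GTerm) : (literal b p).IsLiteral :=
  ⟨p.1, p.2, by cases b <;> simp [literal]⟩

theorem vars_literal (b : Bool) (p : GTerm × GTerm) :
    (literal b p).vars = p.1.vars ∪ p.2.vars := by
  cases b <;> rfl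

theorem vars_stdTerms (d : ℕ) (x y w : GTerm) (j : ℕ × ℕ × List ℕ) :
    (stdTerms d x y w j).1.vars ∪ (stdTerms d x y w j).2.vars ⊆
      x.vars ∪ y.vars ∪ w.vars := by
  have hp := GTerm.vars_pow
  have hh := GTerm.vars_horner
  have hx : x.vars ⊆ x.vars ∪ y.vars ∪ w.vars := fun _ h => Or.inl (Or.inl h)
  have hy : y.vars ⊆ x.vars ∪ y.vars ∪ w.vars := fun _ h => Or.inl (Or.inr h)
  have hw : w.vars ⊆ x.vars ∪ y.vars ∪ w.vars := fun _ h => Or.inr h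
  have h1 := Set.empty_subset (x.vars ∪ y.vars ∪ w.vars)
  have hc : (((y.pow j.2.1).mul x).mul (y.inv.pow j.2.1)).vars ⊆ x.vars ∪ y.vars ∪ w.vars :=
    Set.union_subset (Set.union_subset ((hp _ _).trans hy) hx) ((hp _ _).trans hy)
  unfold stdTerms
  split_ifs
  · exact Set.union_subset ((hp _ _).trans hx) h1
  · exact Set.union_subset (Set.union_subset hx hc) (Set.union_subset hc hx)
  · exact Set.union_subset ((hp y (j.2.1 + 1)).trans hy) h1
  · exact Set.union_subset ((hp y 1).trans hy) h1
  · exact Set.union_subset ((hh _ _ _).trans (Set.union_subset hx hy)) h1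
  · exact Set.union_subset ((hp _ _).trans (Set.union_subset hy ((hp _ _).trans hw))) h1
  · exact Set.union_subset hx ((hh _ _ _).trans (Set.union_subset hw hy))
  · exact Set.union_subset ((hp y 1).trans hy) h1

theorem vars_genLit (x y z : GTerm) (j : ℕ × ℕ × List ℕ) :
    (genLit x y z j).vars ⊆ x.vars ∪ y.vars ∪ z.vars := by
  have hx : x.vars ⊆ x.vars ∪ y.vars ∪ z.vars := fun _ h => Or.inl (Or.inl h)
  have hy : y.vars ⊆ x.vars ∪ y.vars ∪ z.vars := fun _ h => Or.inl (Or.inr h)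
  have hz : z.vars ⊆ x.vars ∪ y.vars ∪ z.vars := fun _ h => Or.inr h
  exact Set.union_subset (Set.union_subset ((GTerm.vars_pow _ _).trans hy) hz)
    (Set.union_subset ((GTerm.vars_horner _ _ _).trans (Set.union_subset hx hy))
      ((GTerm.vars_pow _ _).trans hy))

/-! ### Primitive recursiveness of the families of literals -/

section Primrec

variable {α : Type*} [Primcodable α] {x y w : α → GTerm} {j : α → ℕ × ℕ × List ℕ}

theorem primrec_literal {b : α → Bool} {p : α → GTerm × GTerm} (hb : Primrec b)
    (hp : Primrec p) : Primrec fun a => literal (b a) (p a) := by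
  have he : Primrec fun a => QF.eq (p a).1 (p a).2 :=
    QF.primrec_eq.comp (Primrec.fst.comp hp) (Primrec.snd.comp hp)
  exact Primrec.cond hb he (QF.primrec_not.comp he)

theorem primrec_stdTerms (d : ℕ) (hx : Primrec x) (hy : Primrec y) (hw : Primrec w)
    (hj : Primrec j) : Primrec fun a => stdTerms d (x a) (y a) (w a) (j a) := by
  have h1 : Primrec fun a => (j a).1 := Primrec.fst.comp hj
  have hk : Primrec fun a => (j a).2.1 := Primrec.fst.comp (Primrec.snd.comp hj)
  have hc : Primrec fun a => (j a).2.2 := Primrec.snd.comp (Primrec.snd.comp hj)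
  have hone : Primrec fun _ : α => GTerm.one := Primrec.const _
  have hcase (i : ℕ) : PrimrecPred fun a => (j a).1 = i := Primrec.eq.comp h1 (Primrec.const i)
  have hconj := GTerm.primrec_mul.comp (GTerm.primrec_mul.comp (GTerm.primrec_pow.comp hy hk) hx)
    (GTerm.primrec_pow.comp (GTerm.primrec_inv.comp hy) hk)
  have hy1 := (GTerm.primrec_pow.comp hy (Primrec.const 1)).pair hone
  refine Primrec.ite (hcase 0) ((GTerm.primrec_pow.comp hx (Primrec.const d)).pair hone) ?_
  refine Primrec.ite (hcase 1)
    ((GTerm.primrec_mul.comp hx hconj).pair (GTerm.primrec_mul.comp hconj hx)) ?_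
  refine Primrec.ite (hcase 2)
    ((GTerm.primrec_pow.comp hy (Primrec.succ.comp hk)).pair hone) ?_
  refine Primrec.ite (hcase 3) (Primrec.ite ((primrecPred_forall_dvd d).comp hc) hy1
    ((GTerm.primrec_horner hx hy hc).pair hone)) ?_
  refine Primrec.ite (hcase 4) ((GTerm.primrec_pow.comp (GTerm.primrec_mul.comp
    (GTerm.primrec_inv.comp hy) (GTerm.primrec_pow.comp hw
      (Primrec.nat_add.comp hk (Primrec.const 2)))) (Primrec.const d)).pair hone) ?_
  exact Primrec.ite ((primrecPred_nonunitCoeffs d).comp hc)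
    (hx.pair (GTerm.primrec_horner hw hy hc)) hy1

theorem primrec_stdLit (d : ℕ) (hx : Primrec x) (hy : Primrec y) (hw : Primrec w)
    (hj : Primrec j) : Primrec fun a => stdLit d (x a) (y a) (w a) (j a) :=
  primrec_literal
    (Primrec.nat_lt.decide.comp (Primrec.fst.comp hj) (Primrec.const 2))
    (primrec_stdTerms d hx hy hw hj)

theorem primrec_stdNeg (d : ℕ) (hx : Primrec x) (hy : Primrec y) (hw : Primrec w)
    (hj : Primrec j) : Primrec fun a => stdNeg d (x a) (y a) (w a) (j a) :=
  primrec_literal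
    (Primrec.not.comp (Primrec.nat_lt.decide.comp (Primrec.fst.comp hj) (Primrec.const 2)))
    (primrec_stdTerms d hx hy hw hj)

theorem primrec_genLit (hx : Primrec x) (hy : Primrec y) (hw : Primrec w) (hj : Primrec j) :
    Primrec fun a => genLit (x a) (y a) (w a) (j a) :=
  QF.primrec_eq.comp
    (GTerm.primrec_mul.comp (GTerm.primrec_pow.comp hy (Primrec.fst.comp hj)) hw)
    (GTerm.primrec_mul.comp
      (GTerm.primrec_horner hx hy (Primrec.snd.comp (Primrec.snd.comp hj)))
      (GTerm.primrec_pow.comp hy (Primrec.fst.comp (Primrec.snd.comp hj))))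

end Primrec

/-! ### Meaning of the literals in a group -/

section Semantics

variable {M : Type}

theorem realize_stdNeg [GroupSig M] (v : ℕ → M) (d : ℕ) (x y w : GTerm) (j : ℕ × ℕ × List ℕ) :
    (stdNeg d x y w j).Realize v ↔ ¬ (stdLit d x y w j).Realize v := by
  unfold stdNeg stdLit literal
  cases decide (j.1 < 2) <;> simp [QF.Realize]

/-- The condition on the values of the terms expressed by `stdLit`. -/
def StdCond [Group M] (d : ℕ) (x y w : M) (j : ℕ × ℕ × List ℕ) : Prop :=
  if j.1 = 0 then x ^ d = 1
  else if j.1 = 1 then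
    x * (y ^ j.2.1 * x * y⁻¹ ^ j.2.1) = y ^ j.2.1 * x * y⁻¹ ^ j.2.1 * x
  else if j.1 = 2 then y ^ (j.2.1 + 1) ≠ 1
  else if j.1 = 3 then if ∀ i ∈ j.2.2, d ∣ i then y ^ 1 ≠ 1 else horner x y j.2.2 ≠ 1
  else if j.1 = 4 then (y⁻¹ * w ^ (j.2.1 + 2)) ^ d ≠ 1
  else if NonunitCoeffs d j.2.2 then x ≠ horner w y j.2.2 else y ^ 1 ≠ 1

theorem realize_stdLit [Group M] (v : ℕ → M) (d : ℕ) (x y w : GTerm) (j : ℕ × ℕ × List ℕ) :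
    (stdLit d x y w j).Realize v ↔ StdCond d (x.eval v) (y.eval v) (w.eval v) j := by
  obtain ⟨i, k, c⟩ := j
  have h1 : GTerm.one.eval v = 1 := rfl
  have hmul (s t : GTerm) : (s.mul t).eval v = s.eval v * t.eval v := rfl
  have hinv (s : GTerm) : s.inv.eval v = (s.eval v)⁻¹ := rfl
  rcases i with _ | _ | _ | _ | _ | i
  · simp [stdLit, stdTerms, StdCond, literal, QF.Realize, GTerm.eval_pow, h1]
  · simp [stdLit, stdTerms, StdCond, literal, QF.Realize, GTerm.eval_pow, hmul, hinv]
  · simp [stdLit, stdTerms, StdCond, literal, QF.Realize, GTerm.eval_pow, h1]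
  · by_cases hc : ∀ i ∈ c, d ∣ i
    · simp [stdLit, stdTerms, StdCond, literal, QF.Realize, GTerm.eval_pow, h1, if_pos hc]
    · simp [stdLit, stdTerms, StdCond, literal, QF.Realize, GTerm.eval_horner, h1, if_neg hc]
  · simp [stdLit, stdTerms, StdCond, literal, QF.Realize, GTerm.eval_pow, h1, hmul, hinv]
  · by_cases hc : NonunitCoeffs d c
    · simp [stdLit, stdTerms, StdCond, literal, QF.Realize, GTerm.eval_horner, if_pos hc]
    · simp [stdLit, stdTerms, StdCond, literal, QF.Realize, GTerm.eval_pow, h1, if_neg hc]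

/-- Packs the conditions into one computable family of literals in `x`, `y` and a single universally
quantified `w`, which makes standardness Π₁. -/
theorem forall_stdCond_iff [Group M] (d : ℕ) (x y : M) :
    (∀ w j, StdCond d x y w j) ↔ IsStdPair d x y := by
  constructor
  · intro h
    refine ⟨?_, fun k => ?_, fun k => ?_, fun c hc => ?_, fun w k => ?_, fun w c hc => ?_⟩
    · simpa [StdCond] using h 1 (0, 0, [])
    · simpa [StdCond] using h 1 (1, k, [])
    · simpa [StdCond] using h 1 (2, k, [])
    · simpa [StdCond, if_neg hc] using h 1 (3, 0, c)
    · simpa [StdCond] using h w (4, k, [])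
    · simpa [StdCond, if_pos hc] using h w (5, 0, c)
  · intro h w j
    have h1 : y ^ 1 ≠ 1 := h.pow_ne_one 0
    unfold StdCond
    split_ifs with _ _ _ _ hc _ hc
    · exact h.pow_eq_one
    · exact h.commute _
    · exact h.pow_ne_one _
    · exact h1
    · exact h.horner_ne_one _ hc
    · exact h.primitive _ _
    · exact h.ne_horner _ _ hc
    · exact h1

theorem realize_genLit [Group M] (v : ℕ → M) (x y z : GTerm) (j : ℕ × ℕ × List ℕ) :
    (genLit x y z j).Realize v ↔ y.eval v ^ j.1 * z.eval v =
      horner (x.eval v) (y.eval v) j.2.2 * y.eval v ^ j.2.1 := by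
  rw [← GTerm.eval_pow, ← GTerm.eval_pow, ← GTerm.eval_horner]
  rfl

end Semantics

/-! ## Structures satisfying the group axioms -/

/-- The group axioms, for a structure in the signature of groups. -/
def GroupAxioms (M : Type) [GroupSig M] : Prop :=
  (∀ a b c : M, a * b * c = a * (b * c)) ∧ (∀ a : M, 1 * a = a) ∧ ∀ a : M, a⁻¹ * a = 1

/-- The equality of signature structures allows an arbitrary structure to be replaced by the one
coming from a group, without transport. -/
theorem GroupAxioms.exists_group {M : Type} [S : GroupSig M] (h : GroupAxioms M) :
    ∃ G : Group M, @Group.toGroupSig M G = S :=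
  ⟨Group.ofLeftAxioms h.1 h.2.1 h.2.2, rfl⟩

theorem groupAxioms_of_group (M : Type) [Group M] : GroupAxioms M :=
  ⟨mul_assoc, one_mul, inv_mul_cancel⟩

/-- A group with a standard pair, in which every standard pair generates. -/
def IsLampLike (d : ℕ) (M : Type) [Group M] : Prop :=
  (∃ x y : M, IsStdPair d x y) ∧ ∀ x y : M, IsStdPair d x y → Generates x y

theorem IsStdPair.map {M N : Type*} [Group M] [Group N] (f : M ≃* N) {d : ℕ} {x y : M}
    (h : IsStdPair d x y) : IsStdPair d (f x) (f y) where
  pow_eq_one := by rw [← map_pow, h.pow_eq_one, map_one]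
  commute k := by
    have := congrArg f (h.commute k)
    simpa only [map_mul, map_pow, map_inv] using this
  pow_ne_one k := by
    rw [← map_pow]
    exact (f.map_ne_one_iff).2 (h.pow_ne_one k)
  horner_ne_one c hc := by
    rw [← horner_map]
    exact (f.map_ne_one_iff).2 (h.horner_ne_one c hc)
  primitive w k := by
    obtain ⟨w, rfl⟩ := f.surjective w
    have := (f.map_ne_one_iff).2 (h.primitive w k)
    simpa only [map_mul, map_pow, map_inv] using this
  ne_horner w c hc := by
    obtain ⟨w, rfl⟩ := f.surjective w
    rw [← horner_map]
    exact f.injective.ne (h.ne_horner w c hc)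

theorem Generates.map {M N : Type*} [Group M] [Group N] (f : M ≃* N) {x y : M}
    (h : Generates x y) : Generates (f x) (f y) := by
  intro z
  obtain ⟨z, rfl⟩ := f.surjective z
  obtain ⟨m, n, c, hz⟩ := h z
  refine ⟨m, n, c, ?_⟩
  have := congrArg f hz
  simpa only [map_mul, map_pow, horner_map] using this

theorem IsLampLike.map {M N : Type} [Group M] [Group N] (f : M ≃* N) {d : ℕ}
    (h : IsLampLike d M) : IsLampLike d N := by
  obtain ⟨⟨x, y, hxy⟩, hgen⟩ := h
  refine ⟨⟨f x, f y, hxy.map f⟩, fun x y hxy => ?_⟩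
  have := (hgen _ _ (hxy.map f.symm)).map f
  simpa using this

/-- One standard pair that generates already determines the group; conversely standardness and
generation are invariant under isomorphism, so it suffices that all standard pairs of the lamp group
generate. -/
theorem isLampLike_iff {d : ℕ} (hd : 1 ≤ d) (M : Type) [Group M] :
    IsLampLike d M ↔ Nonempty (LampGroup d ℤ ≃* M) := by
  constructor
  · rintro ⟨⟨x, y, hxy⟩, hgen⟩
    exact hxy.nonempty_mulEquiv hd (hgen x y hxy)
  · rintro ⟨f⟩
    exact IsLampLike.map f ⟨⟨_, _, LampGroup.isStdPair_base_shift hd⟩,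
      fun x y hxy => LampGroup.generates_of_isStdPair hd hxy⟩

theorem SigIso.groupAxioms {M N : Type} [GroupSig M] [Group N] (h : SigIso M N) :
    GroupAxioms M := by
  obtain ⟨f, hmul, hinv, hone⟩ := h
  refine ⟨fun a b c => f.injective ?_, fun a => f.injective ?_, fun a => f.injective ?_⟩
  · rw [hmul, hmul, hmul, hmul]
    exact mul_assoc (f a) (f b) (f c)
  · rw [hmul, hone]
    exact one_mul (f a)
  · rw [hmul, hinv, hone]
    exact inv_mul_cancel (f a)

theorem sigIso_iff_nonempty_mulEquiv {M N : Type} [Group M] [Group N] :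
    SigIso M N ↔ Nonempty (M ≃* N) := by
  constructor
  · rintro ⟨f, hmul, -⟩
    exact ⟨⟨f, hmul⟩⟩
  · rintro ⟨f⟩
    exact ⟨f.toEquiv, map_mul f, map_inv f, map_one f⟩

theorem sigIso_lamplighter_iff {d : ℕ} (hd : 1 ≤ d) (M : Type) [Group M] :
    SigIso M (Lamplighter d) ↔ IsLampLike d M := by
  rw [isLampLike_iff hd, sigIso_iff_nonempty_mulEquiv]
  exact ⟨fun ⟨f⟩ => ⟨(f.trans (lamplighterEquiv d)).symm⟩,
    fun ⟨f⟩ => ⟨((lamplighterEquiv d).trans f).symm⟩⟩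

/-! ## The Scott sentence -/

namespace InfFormula

/-- Every computable family of codes is listed by the index of a computable disjunction and of a
computable conjunction. -/
theorem exists_index {g : ℕ → List ℕ × ℕ × ℕ} (hg : Computable g) :
    ∃ e, ∀ n, (∀ (M : Type) [GroupSig M] (v : ℕ → M), (ofIndex (n + 1) true e).Realize v ↔
        ∃ j, ∃ w : ℕ → M, (∀ k, k ∉ (g j).1 → w k = v k) ∧
          (ofIndex (min (g j).2.1 n) false (g j).2.2).Realize w) ∧
      (∀ (M : Type) [GroupSig M] (v : ℕ → M), (ofIndex (n + 1) false e).Realize v ↔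
        ∀ j, ∀ w : ℕ → M, (∀ k, k ∉ (g j).1 → w k = v k) →
          (ofIndex (min (g j).2.1 n) true (g j).2.2).Realize w) ∧
      (ofIndex (n + 1) true e).freeVars =
        ⋃ j, (ofIndex (min (g j).2.1 n) false (g j).2.2).freeVars \ {k | k ∈ (g j).1} ∧
      (ofIndex (n + 1) false e).freeVars =
        ⋃ j, (ofIndex (min (g j).2.1 n) true (g j).2.2).freeVars \ {k | k ∈ (g j).1} := by
  obtain ⟨e, he⟩ := exists_ceSet_eq_range (g := fun j => Encodable.encode (g j))
    (Computable.encode.comp hg)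
  refine ⟨e, fun n => ⟨fun M _ v => ?_, fun M _ v => ?_, ?_, ?_⟩⟩
  · rw [ofIndex, Realize, he]
    simp only [Realize, Set.mem_range, exists_exists_eq_and, Denumerable.ofNat_encode]
  · rw [ofIndex, Realize, he]
    simp only [Realize, Set.mem_range, forall_exists_index, forall_apply_eq_imp_iff,
      Denumerable.ofNat_encode]
  · rw [ofIndex, freeVars, he]
    simp only [freeVars, Set.biUnion_range, Denumerable.ofNat_encode]
  · rw [ofIndex, freeVars, he]
    simp only [freeVars, Set.biUnion_range, Denumerable.ofNat_encode]

theorem realize_ofIndex_zero {M : Type} [GroupSig M] (b : Bool) (p : QF) (v : ℕ → M) :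
    (ofIndex 0 b p.toNat).Realize v ↔ p.Realize v := by
  rw [ofIndex, QF.ofNat_toNat, Realize]

theorem freeVars_ofIndex_zero (b : Bool) (p : QF) : (ofIndex 0 b p.toNat).freeVars = p.vars := by
  rw [ofIndex, QF.ofNat_toNat, freeVars]

/-- The group axioms as a quantifier-free formula. -/
def groupLaw : QF :=
  .and (.eq (((GTerm.var 0).mul (.var 1)).mul (.var 2))
    ((GTerm.var 0).mul ((GTerm.var 1).mul (.var 2))))
    (.and (.eq (GTerm.one.mul (.var 0)) (.var 0)) (.eq ((GTerm.var 0).inv.mul (.var 0)) .one))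

theorem forall_groupLaw_iff {M : Type} [GroupSig M] :
    (∀ v : ℕ → M, groupLaw.Realize v) ↔ GroupAxioms M := by
  constructor
  · intro h
    refine ⟨fun a b c => ?_, fun a => ?_, fun a => ?_⟩
    · exact (h fun n => if n = 0 then a else if n = 1 then b else c).1
    · exact (h fun _ => a).2.1
    · exact (h fun _ => a).2.2
  · intro h v
    exact ⟨h.1 _ _ _, h.2.1 _, h.2.2 _⟩

/-- Variables 0 and 1 stand for the pair; variable 2 is the quantified `w`. -/
theorem exists_index_std (d : ℕ) : ∃ e,
    (∀ (M : Type) [Group M] (v : ℕ → M),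
      (ofIndex 1 false e).Realize v ↔ IsStdPair d (v 0) (v 1)) ∧
    (ofIndex 1 false e).freeVars ⊆ {0, 1} := by
  let lit : ℕ → QF := fun j => stdLit d (.var 0) (.var 1) (.var 2) (Denumerable.ofNat _ j)
  have hlit : Primrec lit := primrec_stdLit d (.const _) (.const _) (.const _) (.ofNat _)
  have hg : Computable fun j => (([2], 0, (lit j).toNat) : List ℕ × ℕ × ℕ) :=
    ((Primrec.const [2]).pair ((Primrec.const 0).pair (QF.primrec_toNat.comp hlit))).to_comp
  obtain ⟨e, he⟩ := exists_index hg
  obtain ⟨-, h2, -, h4⟩ := he 0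
  refine ⟨e, fun M _ v => ?_, ?_⟩
  · rw [h2, ← forall_stdCond_iff]
    simp only [Nat.zero_min, realize_ofIndex_zero, lit, realize_stdLit, GTerm.eval]
    constructor
    · intro h a j
      have := h (Encodable.encode j) (Function.update v 2 a) fun k hk =>
        Function.update_of_ne (by simpa using hk) _ _
      simpa only [Denumerable.ofNat_encode, Function.update_self, ne_eq, OfNat.zero_ne_ofNat,
        OfNat.one_ne_ofNat, not_false_eq_true, Function.update_of_ne] using this
    · intro h j w hw
      rw [hw 0 (by simp), hw 1 (by simp)]
      exact h _ _
  · rw [h4]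
    refine Set.iUnion_subset fun j => ?_
    simp only [Nat.zero_min, freeVars_ofIndex_zero, lit]
    rintro k ⟨hk, hk2⟩
    rw [stdLit, vars_literal] at hk
    have := vars_stdTerms _ _ _ _ _ hk
    simp only [GTerm.vars, Set.mem_union, Set.mem_singleton_iff] at this
    have hk2 : k ≠ 2 := by simpa using hk2
    rcases this with (h | h) | h <;> simp_all

/-- An implication from a Π₁ to a Σ₁ condition is a single Σ₁ disjunction. Codes with tag 0 list the
ways in which the pair may fail to be standard, with variable 2 as witness; all other codes list the
equations expressing `z`, which is variable 3. -/
theorem exists_index_gen (d : ℕ) : ∃ e,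
    (∀ (M : Type) [Group M] (v : ℕ → M),
      (ofIndex 1 true e).Realize v ↔ (IsStdPair d (v 0) (v 1) →
        ∃ (m n : ℕ) (c : List ℕ), v 1 ^ m * v 3 = horner (v 0) (v 1) c * v 1 ^ n)) ∧
    (ofIndex 1 true e).freeVars ⊆ {0, 1, 3} := by
  let lit : ℕ → QF := fun j => if (Denumerable.ofNat (ℕ × ℕ × ℕ × List ℕ) j).1 = 0
    then stdNeg d (.var 0) (.var 1) (.var 2) (Denumerable.ofNat (ℕ × ℕ × ℕ × List ℕ) j).2
    else genLit (.var 0) (.var 1) (.var 3) (Denumerable.ofNat (ℕ × ℕ × ℕ × List ℕ) j).2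
  have hlit : Primrec lit := by
    have hj : Primrec (Denumerable.ofNat (ℕ × ℕ × ℕ × List ℕ)) := .ofNat _
    exact Primrec.ite (Primrec.eq.comp (Primrec.fst.comp hj) (Primrec.const 0))
      (primrec_stdNeg d (.const _) (.const _) (.const _) (Primrec.snd.comp hj))
      (primrec_genLit (.const _) (.const _) (.const _) (Primrec.snd.comp hj))
  have hg : Computable fun j => (([2], 0, (lit j).toNat) : List ℕ × ℕ × ℕ) :=
    ((Primrec.const [2]).pair ((Primrec.const 0).pair (QF.primrec_toNat.comp hlit))).to_comp
  obtain ⟨e, he⟩ := exists_index hg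
  obtain ⟨h1, -, h3, -⟩ := he 0
  refine ⟨e, fun M _ v => ?_, ?_⟩
  · rw [h1, ← forall_stdCond_iff]
    simp only [Nat.zero_min, realize_ofIndex_zero]
    constructor
    · rintro ⟨j, w, hw, hj⟩ hstd
      simp only [lit] at hj
      generalize Denumerable.ofNat (ℕ × ℕ × ℕ × List ℕ) j = p at hj
      obtain ⟨b, p⟩ := p
      cases b with
      | zero =>
        simp only [if_true, realize_stdNeg, realize_stdLit, GTerm.eval] at hj
        rw [hw 0 (by simp), hw 1 (by simp)] at hj
        exact absurd (hstd _ _) hj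
      | succ b =>
        simp only [Nat.add_eq_zero_iff, one_ne_zero, and_false, if_false, realize_genLit,
          GTerm.eval] at hj
        rw [hw 0 (by simp), hw 1 (by simp), hw 3 (by simp)] at hj
        exact ⟨_, _, _, hj⟩
    · intro h
      by_cases hstd : ∀ w j, StdCond d (v 0) (v 1) w j
      · obtain ⟨m, n, c, hz⟩ := h hstd
        refine ⟨Encodable.encode (1, m, n, c), v, fun _ _ => rfl, ?_⟩
        simp only [lit, Denumerable.ofNat_encode, one_ne_zero, if_false, realize_genLit, GTerm.eval]
        exact hz
      · push Not at hstd
        obtain ⟨a, j, hj⟩ := hstd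
        refine ⟨Encodable.encode (0, j), Function.update v 2 a, fun k hk =>
          Function.update_of_ne (by simpa using hk) _ _, ?_⟩
        simp only [lit, Denumerable.ofNat_encode, if_true, realize_stdNeg, realize_stdLit,
          GTerm.eval]
        simpa using hj
  · rw [h3]
    refine Set.iUnion_subset fun j => ?_
    simp only [Nat.zero_min, freeVars_ofIndex_zero, lit]
    rintro k ⟨hk, hk2⟩
    have hk2 : k ≠ 2 := by simpa using hk2
    generalize Denumerable.ofNat (ℕ × ℕ × ℕ × List ℕ) j = p at hk
    obtain ⟨b, p⟩ := p
    cases b with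
    | zero =>
      rw [if_pos rfl, stdNeg, vars_literal] at hk
      have := vars_stdTerms _ _ _ _ _ hk
      simp only [GTerm.vars, Set.mem_union, Set.mem_singleton_iff] at this
      rcases this with (h | h) | h <;> simp_all
    | succ b =>
      rw [if_neg (by simp)] at hk
      have := vars_genLit _ _ _ _ hk
      simp only [GTerm.vars, Set.mem_union, Set.mem_singleton_iff] at this
      rcases this with (h | h) | h <;> simp_all

theorem exists_sigma_sentence (d : ℕ) : ∃ e,
    (∀ (M : Type) [Group M] (v : ℕ → M),
      (ofIndex 2 true e).Realize v ↔ ∃ x y : M, IsStdPair d x y) ∧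
    (ofIndex 2 true e).freeVars = ∅ := by
  obtain ⟨e₁, h₁, hv₁⟩ := exists_index_std d
  obtain ⟨e, he⟩ := exists_index (g := fun _ => ([0, 1], 1, e₁)) (Computable.const _)
  obtain ⟨h, -, hv, -⟩ := he 1
  refine ⟨e, fun M _ v => ?_, ?_⟩
  · rw [h]
    simp only [min_self, h₁]
    constructor
    · rintro ⟨-, w, -, hw⟩
      exact ⟨_, _, hw⟩
    · rintro ⟨x, y, hxy⟩
      refine ⟨0, Function.update (Function.update v 0 x) 1 y, fun k hk => ?_, ?_⟩
      · simp only [List.mem_cons, List.not_mem_nil, or_false, not_or] at hk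
        rw [Function.update_of_ne hk.2, Function.update_of_ne hk.1]
      · simpa [Function.update_of_ne] using hxy
  · rw [hv]
    simp only [min_self, Set.iUnion_const]
    rw [Set.sdiff_eq_empty]
    exact hv₁.trans fun k hk => by simpa using hk

/-- The group axioms are one of the conjuncts, at `j = 0`; every other `j` repeats the generation
statement. Hence the first claim must cover arbitrary structures, and only then may a group be
assumed. -/
theorem exists_pi_sentence (d : ℕ) : ∃ e,
    (∀ (M : Type) [GroupSig M], (∀ v : ℕ → M, (ofIndex 2 false e).Realize v) → GroupAxioms M) ∧
    (∀ (M : Type) [Group M], (∀ v : ℕ → M, (ofIndex 2 false e).Realize v) ↔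
      ∀ x y : M, IsStdPair d x y → Generates x y) ∧
    (ofIndex 2 false e).freeVars = ∅ := by
  obtain ⟨e₁, h₁, hv₁⟩ := exists_index_gen d
  let g : ℕ → List ℕ × ℕ × ℕ := fun j =>
    if j = 0 then ([0, 1, 2], 0, groupLaw.toNat) else ([0, 1, 3], 1, e₁)
  have hg : Computable g :=
    Computable.ite (ComputablePred.nat_eq Computable.id (Computable.const 0))
      (Computable.const _) (Computable.const _)
  obtain ⟨e, he⟩ := exists_index hg
  obtain ⟨-, h, -, hv⟩ := he 1
  refine ⟨e, fun M _ hM => ?_, fun M _ => ?_, ?_⟩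
  · rw [← forall_groupLaw_iff]
    intro v
    have := (h M v).1 (hM v) 0 v fun _ _ => rfl
    simpa [g, realize_ofIndex_zero] using this
  · constructor
    · intro hM x y hxy z
      let w : ℕ → M := fun n => if n = 0 then x else if n = 1 then y else z
      have := (h M w).1 (hM w) 1 w fun _ _ => rfl
      simp only [g, one_ne_zero, if_false, min_self, h₁] at this
      exact this hxy
    · intro hM v
      rw [h]
      intro j w _
      by_cases hj : j = 0
      · have := (forall_groupLaw_iff (M := M)).2 (groupAxioms_of_group M) w
        simpa [g, hj, realize_ofIndex_zero] using this
      · have hg1 : g j = ([0, 1, 3], 1, e₁) := by simp [g, hj]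
        simp only [hg1, min_self, h₁]
        exact fun hstd => hM _ _ hstd _
  · rw [hv, Set.iUnion_eq_empty]
    intro j
    by_cases hj : j = 0
    · subst hj
      simp only [g, if_true, Nat.zero_min, freeVars_ofIndex_zero]
      rw [Set.sdiff_eq_empty]
      intro k hk
      simp only [groupLaw, QF.vars, GTerm.vars, Set.mem_union, Set.mem_singleton_iff,
        Set.mem_empty_iff_false] at hk
      simp only [Set.mem_ofPred_eq, List.mem_cons]
      tauto
    · have hg1 : g j = ([0, 1, 3], 1, e₁) := by simp [g, hj]
      simp only [hg1, min_self]
      rw [Set.sdiff_eq_empty]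
      exact hv₁.trans fun k hk => by simpa using hk

theorem exists_scottSentence {d : ℕ} (hd : 1 ≤ d) :
    ∃ p : InfFormula, p.IsComputableDSigma 2 ∧ p.IsScottSentence (Lamplighter d) := by
  obtain ⟨e, he, hve⟩ := exists_sigma_sentence d
  obtain ⟨e', hax, he', hve'⟩ := exists_pi_sentence d
  have key (M : Type) [Group M] : SigIso M (Lamplighter d) ↔
      (∀ v : ℕ → M, (ofIndex 2 true e).Realize v) ∧
        ∀ v : ℕ → M, (ofIndex 2 false e').Realize v := by
    rw [sigIso_lamplighter_iff hd, he', IsLampLike]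
    exact and_congr_left' ⟨fun h v => (he M v).2 h, fun h => (he M fun _ => 1).1 (h _)⟩
  refine ⟨(ofIndex 2 true e).and (ofIndex 2 false e'), ⟨_, _, ⟨e, rfl⟩, ⟨e', rfl⟩, rfl⟩, ?_, ?_⟩
  · simp [IsSentence, InfFormula.and, freeVars, hve, hve']
  · intro M S _
    have hand : ((ofIndex 2 true e).and (ofIndex 2 false e')).Models M ↔
        (∀ v : ℕ → M, (ofIndex 2 true e).Realize v) ∧
          ∀ v : ℕ → M, (ofIndex 2 false e').Realize v := by
      simp [Models, InfFormula.and, Realize, forall_and]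
    rw [hand]
    constructor
    · intro h
      -- The Π₂ half supplies the group axioms, before either half is interpreted.
      obtain ⟨G, rfl⟩ := (hax M h.2).exists_group
      exact (key M).2 h
    · intro h
      obtain ⟨G, rfl⟩ := h.groupAxioms.exists_group
      exact (key M).1 h

end InfFormula

/-! ## `Π₂` sets of indices -/

/-- The parity of the existential witness tells which of the two sets it is for. -/
theorem IsSigmaTwo.union {S T : Set ℕ} (hS : IsSigmaTwo S) (hT : IsSigmaTwo T) :
    IsSigmaTwo (S ∪ T) := by
  obtain ⟨R, hR, hSR⟩ := hS
  obtain ⟨Q, hQ, hTQ⟩ := hT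
  have hdiv : Computable fun p : ℕ × ℕ × ℕ => (p.1, p.2.1 / 2, p.2.2) :=
    (Primrec.fst.pair ((Primrec.nat_div.comp (Primrec.fst.comp Primrec.snd) (Primrec.const 2)).pair
      (Primrec.snd.comp Primrec.snd))).to_comp
  have hmod (r : ℕ) : ComputablePred fun p : ℕ × ℕ × ℕ => p.2.1 % 2 = r :=
    ComputablePred.nat_eq (Primrec.nat_mod.comp (Primrec.fst.comp Primrec.snd)
      (Primrec.const 2)).to_comp (Computable.const r)
  refine ⟨fun p => (p.2.1 % 2 = 0 ∧ R (p.1, p.2.1 / 2, p.2.2)) ∨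
    (p.2.1 % 2 = 1 ∧ Q (p.1, p.2.1 / 2, p.2.2)),
    ((hmod 0).and (hR.comp hdiv)).or ((hmod 1).and (hQ.comp hdiv)), fun n => ?_⟩
  rw [Set.mem_union, hSR, hTQ]
  constructor
  · rintro (⟨x, hx⟩ | ⟨x, hx⟩)
    · exact ⟨2 * x, fun y => Or.inl ⟨Nat.mul_mod_right 2 x, by simpa using hx y⟩⟩
    · refine ⟨2 * x + 1, fun y => Or.inr ⟨Nat.mul_add_mod 2 x 1, ?_⟩⟩
      have : (2 * x + 1) / 2 = x := by omega
      simpa only [this] using hx y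
  · rintro ⟨x, hx⟩
    rcases Nat.mod_two_eq_zero_or_one x with h | h
    · exact Or.inl ⟨x / 2, fun y => ((hx y).resolve_right fun h' => by simp_all).2⟩
    · exact Or.inr ⟨x / 2, fun y => ((hx y).resolve_left fun h' => by simp_all).2⟩

/-- `φ_e` takes the value `v` at the Gödel number of `p`. -/
def HasVal (e : ℕ) (p : QF) (v : ℕ) : Prop := phi e p.toNat = Part.some v

/-- The set of all `e` such that for every `a` there is `b` such that `φ_e` takes one of the
values listed in `cl (a, b)`. -/
def clauseSet {α β : Type*} (cl : α × β → List (QF × ℕ)) : Set ℕ :=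
  {e | ∀ a, ∃ b, ∃ q ∈ cl (a, b), HasVal e q.1 q.2}

theorem hasVal_iff {e : ℕ} {p : QF} {v : ℕ} : HasVal e p v ↔
    ∃ s, Nat.Partrec.Code.evaln s (Denumerable.ofNat _ e) p.toNat = some v := by
  rw [HasVal, Part.eq_some_iff, phi, Nat.Partrec.Code.evaln_complete]
  rfl

/-- Membership fails for some `a` when no `b` and no number of steps `s` produce a listed value; the
pair `(s, b)` is coded as one universal number. -/
theorem isSigmaTwo_compl_clauseSet {α β : Type*} [Primcodable α] [Primcodable β] [Inhabited α]
    [Inhabited β] {cl : α × β → List (QF × ℕ)} (hcl : Primrec cl) :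
    IsSigmaTwo (clauseSet cl)ᶜ := by
  -- Numbers that code nothing are read as the default element, which leaves the ranges of both
  -- quantifiers unchanged.
  let f : ℕ × ℕ × ℕ → List (QF × ℕ) := fun p =>
    cl ((Encodable.decode p.2.1).getD default, (Encodable.decode p.2.2.unpair.2).getD default)
  have hf : Primrec f := by
    have hx : Primrec fun p : ℕ × ℕ × ℕ => p.2.1 := Primrec.fst.comp Primrec.snd
    have hy : Primrec fun p : ℕ × ℕ × ℕ => p.2.2.unpair.2 :=
      Primrec.snd.comp (Primrec.unpair.comp (Primrec.snd.comp Primrec.snd))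
    exact hcl.comp ((Primrec.option_getD.comp (Primrec.decode.comp hx) (Primrec.const _)).pair
      (Primrec.option_getD.comp (Primrec.decode.comp hy) (Primrec.const _)))
  have hR : PrimrecRel fun (q : QF × ℕ) (se : ℕ × ℕ) =>
      Nat.Partrec.Code.evaln se.1 (Denumerable.ofNat _ se.2) q.1.toNat = some q.2 := by
    refine Primrec.eq.comp (Nat.Partrec.Code.primrec_evaln.comp
      (((Primrec.fst.comp Primrec.snd).pair ((Primrec.ofNat _).comp
        (Primrec.snd.comp Primrec.snd))).pair (QF.primrec_toNat.comp
          (Primrec.fst.comp Primrec.fst)))) (Primrec.option_some.comp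
            (Primrec.snd.comp Primrec.fst))
  have hse : Primrec fun p : ℕ × ℕ × ℕ => (p.2.2.unpair.1, p.1) :=
    (Primrec.fst.comp (Primrec.unpair.comp (Primrec.snd.comp Primrec.snd))).pair Primrec.fst
  refine ⟨_, (hR.exists_mem_list.comp hf hse).not.computablePred, fun e => ?_⟩
  rw [Set.mem_compl_iff, clauseSet, Set.mem_ofPred_eq]
  push Not
  simp only [hasVal_iff, f]
  push Not
  constructor
  · rintro ⟨a, ha⟩
    refine ⟨Encodable.encode a, fun y q hq => ?_⟩
    rw [Encodable.encodek, Option.getD_some] at hq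
    exact ha _ q hq _
  · rintro ⟨x, hx⟩
    refine ⟨(Encodable.decode x).getD default, fun b q hq s => ?_⟩
    have h := hx (Nat.pair s (Encodable.encode b)) q
    simp only [Nat.unpair_pair, Encodable.encodek, Option.getD_some] at h
    exact h hq

theorem isSigmaTwo_compl_forall_mem {α β : Type*} [Primcodable α] [Primcodable β] [Inhabited α]
    [Inhabited β] (L : List (α × β → List (QF × ℕ))) (hL : ∀ cl ∈ L, Primrec cl) :
    IsSigmaTwo {e | ∀ cl ∈ L, e ∈ clauseSet cl}ᶜ := by
  induction L with
  | nil =>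
    refine ⟨fun _ => False, PrimrecPred.computablePred
      (Primrec.primrecPred (p := fun _ => False) (Primrec.const false)), fun n => by simp⟩
  | cons cl L ih =>
    have := (isSigmaTwo_compl_clauseSet (hL cl (by simp))).union
      (ih fun cl h => hL cl (by simp [h]))
    convert this using 1
    ext e
    simp only [List.mem_cons, forall_eq_or_imp, Set.mem_compl_iff, Set.mem_ofPred_eq,
      Set.mem_union]
    tauto

/-! ## Axioms for atomic diagrams -/

/-- Equations have the numbers `4 * n`, and their negations `4 * (4 * n) + 1`. -/
theorem QF.isLiteral_iff (p : QF) : p.IsLiteral ↔ p.toNat % 4 = 0 ∨ p.toNat % 16 = 1 := by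
  constructor
  · rintro ⟨s, t, rfl | rfl⟩ <;> simp only [QF.toNat] <;> omega
  · intro h
    cases p with
    | eq s t => exact ⟨s, t, Or.inl rfl⟩
    | not p =>
      cases p with
      | eq s t => exact ⟨s, t, Or.inr rfl⟩
      | not p => simp only [QF.toNat] at h; omega
      | and p q => simp only [QF.toNat] at h; omega
      | or p q => simp only [QF.toNat] at h; omega
    | and p q => simp only [QF.toNat] at h; omega
    | or p q => simp only [QF.toNat] at h; omega

instance : Inhabited GTerm := ⟨.one⟩

instance : Inhabited QF := ⟨.eq .one .one⟩

/-- Clauses saying that only literals hold, and that all values are `0` or `1`. -/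
def literalClause (a : QF × Unit) : List (QF × ℕ) :=
  if a.1.toNat % 4 = 0 ∨ a.1.toNat % 16 = 1 then [(a.1, 0), (a.1, 1)] else [(a.1, 0)]

/-- Clauses saying that distinct constants name distinct elements. -/
def constantClause (a : (ℕ × ℕ) × Unit) : List (QF × ℕ) :=
  if a.1.1 = a.1.2 then [(.eq (.var a.1.1) (.var a.1.2), 0), (.eq (.var a.1.1) (.var a.1.2), 1)]
  else [(.eq (.var a.1.1) (.var a.1.2), 0)]

/-- Clauses saying that every term has a value which is named by a constant. -/
def valueClause (a : GTerm × ℕ) : List (QF × ℕ) :=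
  [(.eq a.1 a.1, 0), (.eq a.1 (.var a.2), 1)]

/-- The laws of equality and the axioms of groups; a term `t` is defined if `t = t` is true. -/
def termClauses : List ((GTerm × GTerm × GTerm × GTerm) × Unit → List (QF × ℕ)) :=
  -- Each clause is an implication: the value `0` refutes a premise, the value `1` asserts a
  -- conclusion.
  [fun a => [(.eq a.1.1 a.1.2.1, 0), (.eq a.1.2.1 a.1.1, 1)],
   fun a => [(.eq a.1.1 a.1.2.1, 0), (.eq a.1.2.1 a.1.2.2.1, 0), (.eq a.1.1 a.1.2.2.1, 1)],
   fun a => [(.not (.eq a.1.1 a.1.2.1), 0), (.eq a.1.1 a.1.1, 1)],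
   fun a => [(.not (.eq a.1.1 a.1.2.1), 0), (.eq a.1.2.1 a.1.2.1, 1)],
   fun a => [(.eq a.1.1.inv a.1.1.inv, 0), (.eq a.1.1 a.1.1, 1)],
   fun a => [(.eq (a.1.1.mul a.1.2.1) (a.1.1.mul a.1.2.1), 0), (.eq a.1.1 a.1.1, 1)],
   fun a => [(.eq (a.1.1.mul a.1.2.1) (a.1.1.mul a.1.2.1), 0), (.eq a.1.2.1 a.1.2.1, 1)],
   fun _ => [(.eq .one .one, 1)],
   fun a => [(.eq a.1.1 a.1.2.1, 0), (.eq a.1.1.inv a.1.2.1.inv, 1)],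
   fun a => [(.eq a.1.1 a.1.2.1, 0), (.eq a.1.2.2.1 a.1.2.2.2, 0),
     (.eq (a.1.1.mul a.1.2.2.1) (a.1.2.1.mul a.1.2.2.2), 1)],
   fun a => [(.eq a.1.1 a.1.1, 0), (.eq a.1.2.1 a.1.2.1, 0), (.eq a.1.1 a.1.2.1, 1),
     (.not (.eq a.1.1 a.1.2.1), 1)],
   fun a => [(.eq a.1.1 a.1.2.1, 0), (.not (.eq a.1.1 a.1.2.1), 0)],
   fun a => [(.eq a.1.1 a.1.1, 0), (.eq a.1.2.1 a.1.2.1, 0), (.eq a.1.2.2.1 a.1.2.2.1, 0),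
     (.eq ((a.1.1.mul a.1.2.1).mul a.1.2.2.1) (a.1.1.mul (a.1.2.1.mul a.1.2.2.1)), 1)],
   fun a => [(.eq a.1.1 a.1.1, 0), (.eq (GTerm.one.mul a.1.1) a.1.1, 1)],
   fun a => [(.eq a.1.1 a.1.1, 0), (.eq (a.1.1.inv.mul a.1.1) .one, 1)]]

/-- Clauses saying that every standard pair generates. -/
def genClause (d : ℕ) (a : (ℕ × ℕ × ℕ) × ℕ × ℕ × ℕ × List ℕ) : List (QF × ℕ) :=
  [(.eq (.var a.1.1) (.var a.1.1), 0), (.eq (.var a.1.2.1) (.var a.1.2.1), 0),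
    (.eq (.var a.1.2.2) (.var a.1.2.2), 0),
    (stdNeg d (.var a.1.1) (.var a.1.2.1) (.var a.2.1) a.2.2, 1),
    (genLit (.var a.1.1) (.var a.1.2.1) (.var a.1.2.2) a.2.2, 1)]

/-- Clauses saying that there is no standard pair. -/
def noStdClause (d : ℕ) (a : (ℕ × ℕ) × ℕ × ℕ × ℕ × List ℕ) : List (QF × ℕ) :=
  [(.eq (.var a.1.1) (.var a.1.1), 0), (.eq (.var a.1.2) (.var a.1.2), 0),
    (stdNeg d (.var a.1.1) (.var a.1.2) (.var a.2.1) a.2.2, 1)]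

/-! ### Primitive recursiveness of the clauses -/

theorem primrec_clause_cons {α : Type*} [Primcodable α] {p : α → QF} {v : ℕ}
    {l : α → List (QF × ℕ)} (hp : Primrec p) (hl : Primrec l) :
    Primrec fun a => (p a, v) :: l a :=
  Primrec.list_cons.comp (hp.pair (Primrec.const v)) hl

theorem primrec_literalClause : Primrec literalClause := by
  have hp : Primrec fun a : QF × Unit => a.1 := Primrec.fst
  have hn := QF.primrec_toNat.comp hp
  refine Primrec.ite (PrimrecPred.or
    (Primrec.eq.comp (Primrec.nat_mod.comp hn (Primrec.const 4)) (Primrec.const 0))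
    (Primrec.eq.comp (Primrec.nat_mod.comp hn (Primrec.const 16)) (Primrec.const 1))) ?_ ?_
  · exact primrec_clause_cons hp (primrec_clause_cons hp (Primrec.const []))
  · exact primrec_clause_cons hp (Primrec.const [])

theorem primrec_constantClause : Primrec constantClause := by
  have h1 : Primrec fun a : (ℕ × ℕ) × Unit => a.1.1 := Primrec.fst.comp Primrec.fst
  have h2 : Primrec fun a : (ℕ × ℕ) × Unit => a.1.2 := Primrec.snd.comp Primrec.fst
  have hp := QF.primrec_eq.comp (GTerm.primrec_var.comp h1) (GTerm.primrec_var.comp h2)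
  refine Primrec.ite (Primrec.eq.comp h1 h2) ?_ ?_
  · exact primrec_clause_cons hp (primrec_clause_cons hp (Primrec.const []))
  · exact primrec_clause_cons hp (Primrec.const [])

theorem primrec_valueClause : Primrec valueClause :=
  primrec_clause_cons (QF.primrec_eq.comp Primrec.fst Primrec.fst)
    (primrec_clause_cons (QF.primrec_eq.comp Primrec.fst (GTerm.primrec_var.comp Primrec.snd))
      (Primrec.const []))

theorem primrec_termClauses : ∀ cl ∈ termClauses, Primrec cl := by
  have h1 : Primrec fun a : (GTerm × GTerm × GTerm × GTerm) × Unit => a.1.1 :=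
    Primrec.fst.comp Primrec.fst
  have h2 : Primrec fun a : (GTerm × GTerm × GTerm × GTerm) × Unit => a.1.2.1 :=
    Primrec.fst.comp (Primrec.snd.comp Primrec.fst)
  have h3 : Primrec fun a : (GTerm × GTerm × GTerm × GTerm) × Unit => a.1.2.2.1 :=
    Primrec.fst.comp (Primrec.snd.comp (Primrec.snd.comp Primrec.fst))
  have h4 : Primrec fun a : (GTerm × GTerm × GTerm × GTerm) × Unit => a.1.2.2.2 :=
    Primrec.snd.comp (Primrec.snd.comp (Primrec.snd.comp Primrec.fst))
  simp only [termClauses, List.forall_mem_cons, List.not_mem_nil, false_imp_iff, implies_true,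
    and_true]
  refine ⟨?_, ?_, ?_, ?_, ?_, ?_, ?_, ?_, ?_, ?_, ?_, ?_, ?_, ?_, ?_⟩
  all_goals
    repeat' first
      | with_reducible exact h1
      | with_reducible exact h2
      | with_reducible exact h3
      | with_reducible exact h4
      | with_reducible exact Primrec.const _
      | with_reducible refine primrec_clause_cons ?_ ?_
      | with_reducible refine QF.primrec_eq.comp ?_ ?_
      | with_reducible refine QF.primrec_not.comp ?_
      | with_reducible refine GTerm.primrec_mul.comp ?_ ?_
      | with_reducible refine GTerm.primrec_inv.comp ?_

theorem primrec_genClause (d : ℕ) : Primrec (genClause d) := by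
  have h1 : Primrec fun a : (ℕ × ℕ × ℕ) × ℕ × ℕ × ℕ × List ℕ => GTerm.var a.1.1 :=
    GTerm.primrec_var.comp (Primrec.fst.comp Primrec.fst)
  have h2 : Primrec fun a : (ℕ × ℕ × ℕ) × ℕ × ℕ × ℕ × List ℕ => GTerm.var a.1.2.1 :=
    GTerm.primrec_var.comp (Primrec.fst.comp (Primrec.snd.comp Primrec.fst))
  have h3 : Primrec fun a : (ℕ × ℕ × ℕ) × ℕ × ℕ × ℕ × List ℕ => GTerm.var a.1.2.2 :=
    GTerm.primrec_var.comp (Primrec.snd.comp (Primrec.snd.comp Primrec.fst))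
  have h4 : Primrec fun a : (ℕ × ℕ × ℕ) × ℕ × ℕ × ℕ × List ℕ => GTerm.var a.2.1 :=
    GTerm.primrec_var.comp (Primrec.fst.comp Primrec.snd)
  have h5 : Primrec fun a : (ℕ × ℕ × ℕ) × ℕ × ℕ × ℕ × List ℕ => a.2.2 :=
    Primrec.snd.comp Primrec.snd
  exact primrec_clause_cons (QF.primrec_eq.comp h1 h1)
    (primrec_clause_cons (QF.primrec_eq.comp h2 h2)
    (primrec_clause_cons (QF.primrec_eq.comp h3 h3)
    (primrec_clause_cons (primrec_stdNeg d h1 h2 h4 h5)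
    (primrec_clause_cons (primrec_genLit h1 h2 h3 h5) (Primrec.const [])))))

theorem primrec_noStdClause (d : ℕ) : Primrec (noStdClause d) := by
  have h1 : Primrec fun a : (ℕ × ℕ) × ℕ × ℕ × ℕ × List ℕ => GTerm.var a.1.1 :=
    GTerm.primrec_var.comp (Primrec.fst.comp Primrec.fst)
  have h2 : Primrec fun a : (ℕ × ℕ) × ℕ × ℕ × ℕ × List ℕ => GTerm.var a.1.2 :=
    GTerm.primrec_var.comp (Primrec.snd.comp Primrec.fst)
  have h4 : Primrec fun a : (ℕ × ℕ) × ℕ × ℕ × ℕ × List ℕ => GTerm.var a.2.1 :=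
    GTerm.primrec_var.comp (Primrec.fst.comp Primrec.snd)
  have h5 : Primrec fun a : (ℕ × ℕ) × ℕ × ℕ × ℕ × List ℕ => a.2.2 :=
    Primrec.snd.comp Primrec.snd
  exact primrec_clause_cons (QF.primrec_eq.comp h1 h1)
    (primrec_clause_cons (QF.primrec_eq.comp h2 h2)
    (primrec_clause_cons (primrec_stdNeg d h1 h2 h4 h5) (Primrec.const [])))

/-- The conditions on `φ_e` which say that it is the characteristic function of the atomic diagram
of a group. -/
structure DiagramAxioms (e : ℕ) : Prop where
  neg : ∀ p, HasVal e p 0 ↔ ¬ HasVal e p 1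
  lit : ∀ p, HasVal e p 1 → p.IsLiteral
  const : ∀ u v, HasVal e (.eq (.var u) (.var v)) 1 → u = v
  value : ∀ s, HasVal e (.eq s s) 1 → ∃ u, HasVal e (.eq s (.var u)) 1
  symm : ∀ s t, HasVal e (.eq s t) 1 → HasVal e (.eq t s) 1
  trans : ∀ s t r, HasVal e (.eq s t) 1 → HasVal e (.eq t r) 1 → HasVal e (.eq s r) 1
  ne_left : ∀ s t, HasVal e (.not (.eq s t)) 1 → HasVal e (.eq s s) 1
  ne_right : ∀ s t, HasVal e (.not (.eq s t)) 1 → HasVal e (.eq t t) 1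
  of_inv : ∀ s : GTerm, HasVal e (.eq s.inv s.inv) 1 → HasVal e (.eq s s) 1
  of_mul_left : ∀ s t : GTerm, HasVal e (.eq (s.mul t) (s.mul t)) 1 → HasVal e (.eq s s) 1
  of_mul_right : ∀ s t : GTerm, HasVal e (.eq (s.mul t) (s.mul t)) 1 → HasVal e (.eq t t) 1
  one : HasVal e (.eq .one .one) 1
  inv : ∀ s t : GTerm, HasVal e (.eq s t) 1 → HasVal e (.eq s.inv t.inv) 1
  mul : ∀ s s' t t' : GTerm, HasVal e (.eq s s') 1 → HasVal e (.eq t t') 1 →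
    HasVal e (.eq (s.mul t) (s'.mul t')) 1
  eq_or_ne : ∀ s t, HasVal e (.eq s s) 1 → HasVal e (.eq t t) 1 →
    HasVal e (.eq s t) 1 ∨ HasVal e (.not (.eq s t)) 1
  not_both : ∀ s t, HasVal e (.eq s t) 1 → ¬ HasVal e (.not (.eq s t)) 1
  assoc : ∀ s t r : GTerm, HasVal e (.eq s s) 1 → HasVal e (.eq t t) 1 → HasVal e (.eq r r) 1 →
    HasVal e (.eq ((s.mul t).mul r) (s.mul (t.mul r))) 1
  one_mul : ∀ s : GTerm, HasVal e (.eq s s) 1 → HasVal e (.eq (GTerm.one.mul s) s) 1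
  inv_mul : ∀ s : GTerm, HasVal e (.eq s s) 1 → HasVal e (.eq (s.inv.mul s) .one) 1

theorem HasVal.eq {e : ℕ} {p : QF} {v w : ℕ} (h : HasVal e p v) (h' : HasVal e p w) : v = w :=
  Part.some_injective (h.symm.trans h')

/-- A partial function has at most one value at each argument, so demanding the value `0`, or the
value `1` at a literal, gives totality, values in `{0, 1}` and truth of literals only. -/
theorem mem_clauseSet_literalClause {e : ℕ} : e ∈ clauseSet literalClause ↔
    (∀ p, HasVal e p 0 ↔ ¬ HasVal e p 1) ∧ ∀ p, HasVal e p 1 → p.IsLiteral := by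
  have hex : e ∈ clauseSet literalClause ↔
      ∀ p, HasVal e p 0 ∨ (p.IsLiteral ∧ HasVal e p 1) := by
    simp only [clauseSet, Set.mem_ofPred_eq, literalClause, exists_const]
    refine forall_congr' fun p => ?_
    by_cases h : p.IsLiteral
    · simp [if_pos (p.isLiteral_iff.1 h), h]
    · simp [if_neg (mt p.isLiteral_iff.2 h), h]
  have hne (p : QF) (h0 : HasVal e p 0) (h1 : HasVal e p 1) : False := absurd (h0.eq h1) (by simp)
  rw [hex]
  constructor
  · intro h
    refine ⟨fun p => ⟨fun h0 h1 => hne p h0 h1, fun h1 => (h p).resolve_right fun h' => h1 h'.2⟩,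
      fun p h1 => ((h p).resolve_left fun h0 => hne p h0 h1).1⟩
  · rintro ⟨h, h'⟩ p
    by_cases h1 : HasVal e p 1
    · exact Or.inr ⟨h' p h1, h1⟩
    · exact Or.inl ((h p).2 h1)

theorem diagramAxioms_iff {e : ℕ} : DiagramAxioms e ↔
    (e ∈ clauseSet literalClause ∧ e ∈ clauseSet constantClause) ∧
      e ∈ clauseSet valueClause ∧ ∀ cl ∈ termClauses, e ∈ clauseSet cl := by
  rw [mem_clauseSet_literalClause]
  have hconst (h : ∀ p, HasVal e p 0 ↔ ¬ HasVal e p 1) : e ∈ clauseSet constantClause ↔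
      ∀ u v, HasVal e (.eq (.var u) (.var v)) 1 → u = v := by
    simp only [clauseSet, Set.mem_ofPred_eq, constantClause, exists_const, Prod.forall]
    refine forall₂_congr fun u v => ?_
    by_cases huv : u = v
    · simp only [huv, if_true, List.mem_cons, List.not_mem_nil, or_false, exists_eq_or_imp,
        exists_eq_left, h, implies_true, iff_true]
      exact (em _).symm
    · simp [huv, h]
  constructor
  · intro h
    refine ⟨⟨⟨h.neg, h.lit⟩, (hconst h.neg).2 h.const⟩, ?_, ?_⟩
    · simp only [clauseSet, Set.mem_ofPred_eq, valueClause, List.mem_cons, List.not_mem_nil,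
        or_false, exists_eq_or_imp, exists_eq_left, h.neg]
      intro s
      by_cases hs : HasVal e (.eq s s) 1
      · obtain ⟨u, hu⟩ := h.value s hs
        exact ⟨u, Or.inr hu⟩
      · exact ⟨0, Or.inl hs⟩
    · simp only [termClauses, List.forall_mem_cons, List.not_mem_nil, false_imp_iff, implies_true,
        and_true]
      simp only [clauseSet, Set.mem_ofPred_eq, exists_const, Prod.forall, List.mem_cons,
        List.not_mem_nil, or_false, exists_eq_or_imp, exists_eq_left, h.neg]
      refine ⟨fun s t _ _ => ?_, fun s t r _ => ?_, fun s t _ _ => ?_, fun s t _ _ => ?_,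
        fun s _ _ _ => ?_, fun s t _ _ => ?_, fun s t _ _ => ?_, fun _ _ _ _ => h.one,
        fun s t _ _ => ?_, fun s s' t t' => ?_, fun s t _ _ => ?_, fun s t _ _ => ?_,
        fun s t r _ => ?_, fun s _ _ _ => ?_, fun s _ _ _ => ?_⟩
      · have := h.symm s t; tauto
      · have := h.trans s t r; tauto
      · have := h.ne_left s t; tauto
      · have := h.ne_right s t; tauto
      · have := h.of_inv s; tauto
      · have := h.of_mul_left s t; tauto
      · have := h.of_mul_right s t; tauto
      · have := h.inv s t; tauto
      · have := h.mul s s' t t'; tauto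
      · have := h.eq_or_ne s t; tauto
      · have := h.not_both s t; tauto
      · have := h.assoc s t r; tauto
      · have := h.one_mul s; tauto
      · have := h.inv_mul s; tauto
  · rintro ⟨⟨⟨neg, lit⟩, hc⟩, hv, ht⟩
    simp only [clauseSet, Set.mem_ofPred_eq, valueClause, List.mem_cons, List.not_mem_nil,
      or_false, exists_eq_or_imp, exists_eq_left, neg] at hv
    simp only [termClauses, List.forall_mem_cons, List.not_mem_nil, false_imp_iff, implies_true,
      and_true] at ht
    simp only [clauseSet, Set.mem_ofPred_eq, exists_const, Prod.forall, List.mem_cons,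
      List.not_mem_nil, or_false, exists_eq_or_imp, exists_eq_left, neg] at ht
    obtain ⟨h1, h2, h3, h4, h5, h6, h7, h8, h9, h10, h11, h12, h13, h14, h15⟩ := ht
    -- Filler for the components of the quadruple that a clause does not mention.
    have o := GTerm.one
    exact
      { neg := neg
        lit := lit
        const := (hconst neg).1 hc
        value := fun s hs => (hv s).imp fun u hu => hu.resolve_left fun h => h hs
        symm := fun s t => by have := h1 s t o o; tauto
        trans := fun s t r => by have := h2 s t r o; tauto
        ne_left := fun s t => by have := h3 s t o o; tauto
        ne_right := fun s t => by have := h4 s t o o; tauto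
        of_inv := fun s => by have := h5 s o o o; tauto
        of_mul_left := fun s t => by have := h6 s t o o; tauto
        of_mul_right := fun s t => by have := h7 s t o o; tauto
        one := h8 o o o o
        inv := fun s t => by have := h9 s t o o; tauto
        mul := fun s s' t t' => by have := h10 s s' t t'; tauto
        eq_or_ne := fun s t => by have := h11 s t o o; tauto
        not_both := fun s t => by have := h12 s t o o; tauto
        assoc := fun s t r => by have := h13 s t r o; tauto
        one_mul := fun s => by have := h14 s o o o; tauto
        inv_mul := fun s => by have := h15 s o o o; tauto }

/-! ## From the axioms to a structure -/

/-- The universe of the structure with the given diagram. -/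
def diagramUniverse (e : ℕ) : Set ℕ := {k | HasVal e (.eq (.var k) (.var k)) 1}

theorem nameAssignment_of_mem {U : Set ℕ} [GroupSig U] {k : ℕ} (hk : k ∈ U) :
    nameAssignment U k = ⟨k, hk⟩ :=
  dif_pos hk

namespace DiagramAxioms

variable {e : ℕ}

/-- Truth of `s = s` serves as definedness, and it propagates to subterms and back by the closure
axioms. -/
theorem refl_iff (h : DiagramAxioms e) (s : GTerm) :
    HasVal e (.eq s s) 1 ↔ s.vars ⊆ diagramUniverse e := by
  induction s with
  | one => exact ⟨fun _ => Set.empty_subset _, fun _ => h.one⟩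
  | var k =>
    rw [GTerm.vars, Set.singleton_subset_iff]
    exact Iff.rfl
  | inv t ih => exact ⟨fun hs => ih.1 (h.of_inv t hs), fun hs => h.inv _ _ (ih.2 hs)⟩
  | mul s t ihs iht =>
    rw [GTerm.vars, Set.union_subset_iff, ← ihs, ← iht]
    exact ⟨fun hs => ⟨h.of_mul_left s t hs, h.of_mul_right s t hs⟩,
      fun hs => h.mul _ _ _ _ hs.1 hs.2⟩

theorem exists_value (h : DiagramAxioms e) :
    ∃ f : GTerm → ℕ, ∀ s, s.vars ⊆ diagramUniverse e → HasVal e (.eq s (.var (f s))) 1 := by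
  have hex (s : GTerm) : ∃ u, s.vars ⊆ diagramUniverse e → HasVal e (.eq s (.var u)) 1 := by
    by_cases hs : s.vars ⊆ diagramUniverse e
    · exact (h.value s ((h.refl_iff s).2 hs)).imp fun u hu _ => hu
    · exact ⟨0, fun h => absurd h hs⟩
  exact Classical.skolem.1 hex

/-- A term model in which every class of equal terms contains a constant, by `value`, and only one,
by `const`. The constants themselves therefore serve as universe, and operations are computed by
naming the value of a formal product or inverse. -/
theorem exists_structure (h : DiagramAxioms e) :
    ∃ _ : GroupSig (diagramUniverse e), GroupAxioms (diagramUniverse e) ∧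
      DecidesSet e (atomicDiagram (diagramUniverse e)) := by
  obtain ⟨f, hf⟩ := h.exists_value
  have hmem (s : GTerm) (hs : s.vars ⊆ diagramUniverse e) : f s ∈ diagramUniverse e :=
    h.trans _ _ _ (h.symm _ _ (hf s hs)) (hf s hs)
  have hv (u : diagramUniverse e) : (GTerm.var u).vars ⊆ diagramUniverse e :=
    Set.singleton_subset_iff.2 u.2
  let S : GroupSig (diagramUniverse e) :=
    { mul := fun u v => ⟨f ((GTerm.var u).mul (.var v)), hmem _ (Set.union_subset (hv u) (hv v))⟩
      inv := fun u => ⟨f (GTerm.var u).inv, hmem _ (hv u)⟩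
      one := ⟨f .one, hmem _ (Set.empty_subset _)⟩ }
  have heval (s : GTerm) (hs : s.vars ⊆ diagramUniverse e) :
      HasVal e (.eq s (.var ((s.eval (nameAssignment (diagramUniverse e)) :
        diagramUniverse e) : ℕ))) 1 := by
    induction s with
    | one => exact hf _ hs
    | var k =>
      have hk : k ∈ diagramUniverse e := hs rfl
      rw [GTerm.eval, nameAssignment_of_mem hk]
      exact hk
    | inv t ih =>
      exact h.trans _ _ _ (h.inv _ _ (ih hs)) (hf (GTerm.var _).inv (hv _))
    | mul s t ihs iht =>
      exact h.trans _ _ _ (h.mul _ _ _ _ (ihs fun _ hx => hs (Or.inl hx))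
        (iht fun _ hx => hs (Or.inr hx)))
        (hf ((GTerm.var _).mul (.var _)) (Set.union_subset (hv _) (hv _)))
  have heq (s t : GTerm) (hs : s.vars ⊆ diagramUniverse e) (ht : t.vars ⊆ diagramUniverse e) :
      HasVal e (.eq s t) 1 ↔ s.eval (nameAssignment (diagramUniverse e)) =
        t.eval (nameAssignment (diagramUniverse e)) := by
    constructor
    · intro hst
      exact Subtype.ext (h.const _ _ (h.trans _ _ _ (h.symm _ _ (heval s hs))
        (h.trans _ _ _ hst (heval t ht))))
    · intro hst
      have := heval s hs
      rw [hst] at this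
      exact h.trans _ _ _ this (h.symm _ _ (heval t ht))
  refine ⟨S, ⟨fun a b c => ?_, fun a => ?_, fun a => ?_⟩, ?_⟩
  · have := (heq (((GTerm.var a).mul (.var b)).mul (.var c))
      ((GTerm.var a).mul ((GTerm.var b).mul (.var c)))
      (Set.union_subset (Set.union_subset (hv a) (hv b)) (hv c))
      (Set.union_subset (hv a) (Set.union_subset (hv b) (hv c)))).1
        (h.assoc (.var a) (.var b) (.var c) a.2 b.2 c.2)
    simpa only [GTerm.eval, nameAssignment_of_mem (Subtype.mem _)] using this
  · have := (heq (GTerm.one.mul (.var a)) (.var a)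
      (Set.union_subset (Set.empty_subset _) (hv a)) (hv a)).1
        (h.one_mul (.var a) a.2)
    simpa only [GTerm.eval, nameAssignment_of_mem (Subtype.mem _)] using this
  · have := (heq ((GTerm.var a).inv.mul (.var a)) .one
      (Set.union_subset (hv a) (hv a)) (Set.empty_subset _)).1
        (h.inv_mul (.var a) a.2)
    simpa only [GTerm.eval, nameAssignment_of_mem (Subtype.mem _)] using this
  · have key (p : QF) : HasVal e p 1 ↔ p.IsLiteral ∧ p.vars ⊆ diagramUniverse e ∧
        p.Realize (nameAssignment (diagramUniverse e)) := by
      constructor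
      · intro hp
        refine ⟨h.lit p hp, ?_⟩
        obtain ⟨s, t, rfl | rfl⟩ := h.lit p hp
        · have hs := (h.refl_iff s).1 (h.trans _ _ _ hp (h.symm _ _ hp))
          have ht := (h.refl_iff t).1 (h.trans _ _ _ (h.symm _ _ hp) hp)
          exact ⟨Set.union_subset hs ht, (heq s t hs ht).1 hp⟩
        · have hs := (h.refl_iff s).1 (h.ne_left _ _ hp)
          have ht := (h.refl_iff t).1 (h.ne_right _ _ hp)
          exact ⟨Set.union_subset hs ht, fun hst => h.not_both _ _ ((heq s t hs ht).2 hst) hp⟩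
      · rintro ⟨⟨s, t, rfl | rfl⟩, hvars, hp⟩
        · obtain ⟨hs, ht⟩ := Set.union_subset_iff.1 hvars
          exact (heq s t hs ht).2 hp
        · obtain ⟨hs, ht⟩ := Set.union_subset_iff.1 hvars
          exact (h.eq_or_ne s t ((h.refl_iff s).2 hs) ((h.refl_iff t).2 ht)).resolve_left
            fun hst => hp ((heq s t hs ht).1 hst)
    intro n
    have hn := QF.toNat_ofNat n
    constructor
    · rintro ⟨p, hp1, hp2, hp3, rfl⟩
      exact (key p).2 ⟨hp1, hp2, hp3⟩
    · intro hnot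
      have : HasVal e (QF.ofNat n) 0 := by
        rw [h.neg, key]
        rintro ⟨h1, h2, h3⟩
        exact hnot ⟨_, h1, h2, h3, hn.symm⟩
      rwa [HasVal, hn] at this

end DiagramAxioms

/-! ## From a structure to the axioms -/

section Decides

variable {e : ℕ} {U : Set ℕ}

theorem DecidesSet.hasVal_one_iff [GroupSig U] (h : DecidesSet e (atomicDiagram U)) (p : QF) :
    HasVal e p 1 ↔ p.IsLiteral ∧ p.vars ⊆ U ∧ p.Realize (nameAssignment U) := by
  constructor
  · intro hp
    by_contra hne
    have : HasVal e p 0 := (h p.toNat).2 fun ⟨q, h1, h2, h3, h4⟩ => by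
      have : p = q := QF.equivNat.injective h4
      subst this
      exact hne ⟨h1, h2, h3⟩
    exact absurd (this.eq hp) (by simp)
  · rintro ⟨h1, h2, h3⟩
    exact (h p.toNat).1 ⟨p, h1, h2, h3, rfl⟩

theorem DecidesSet.hasVal_zero_iff [GroupSig U] (h : DecidesSet e (atomicDiagram U)) (p : QF) :
    HasVal e p 0 ↔ ¬ HasVal e p 1 := by
  constructor
  · intro h0 h1
    exact absurd (h0.eq h1) (by simp)
  · intro h1
    by_cases hp : p.toNat ∈ atomicDiagram U
    · exact absurd ((h _).1 hp) h1
    · exact (h _).2 hp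

theorem DecidesSet.hasVal_eq_iff [GroupSig U] (h : DecidesSet e (atomicDiagram U)) (s t : GTerm) :
    HasVal e (.eq s t) 1 ↔ (s.vars ⊆ U ∧ t.vars ⊆ U) ∧
      s.eval (nameAssignment U) = t.eval (nameAssignment U) := by
  rw [h.hasVal_one_iff, ← Set.union_subset_iff]
  exact and_iff_right ⟨s, t, Or.inl rfl⟩

theorem DecidesSet.hasVal_ne_iff [GroupSig U] (h : DecidesSet e (atomicDiagram U)) (s t : GTerm) :
    HasVal e (.not (.eq s t)) 1 ↔ (s.vars ⊆ U ∧ t.vars ⊆ U) ∧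
      s.eval (nameAssignment U) ≠ t.eval (nameAssignment U) := by
  rw [h.hasVal_one_iff, ← Set.union_subset_iff]
  exact and_iff_right ⟨s, t, Or.inr rfl⟩

theorem DecidesSet.hasVal_var_iff [GroupSig U] (h : DecidesSet e (atomicDiagram U)) (k : ℕ) :
    HasVal e (.eq (.var k) (.var k)) 1 ↔ k ∈ U := by
  rw [h.hasVal_eq_iff]
  simp [GTerm.vars]

theorem DecidesSet.diagramAxioms [Group U] (h : DecidesSet e (atomicDiagram U)) :
    DiagramAxioms e where
  neg := h.hasVal_zero_iff
  lit p hp := ((h.hasVal_one_iff p).1 hp).1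
  const u v huv := by
    obtain ⟨⟨hu, hv⟩, he⟩ := (h.hasVal_eq_iff _ _).1 huv
    have hu' : u ∈ U := hu rfl
    have hv' : v ∈ U := hv rfl
    rw [GTerm.eval, GTerm.eval, nameAssignment_of_mem hu', nameAssignment_of_mem hv'] at he
    exact congrArg Subtype.val he
  value s hs := by
    rw [h.hasVal_eq_iff] at hs
    refine ⟨((s.eval (nameAssignment U) : U) : ℕ), ?_⟩
    rw [h.hasVal_eq_iff, GTerm.eval, nameAssignment_of_mem (Subtype.mem _)]
    exact ⟨⟨hs.1.1, Set.singleton_subset_iff.2 (Subtype.mem _)⟩, rfl⟩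
  symm s t := by
    simp only [h.hasVal_eq_iff]
    exact fun hs => ⟨hs.1.symm, hs.2.symm⟩
  trans s t r := by
    simp only [h.hasVal_eq_iff]
    exact fun hs ht => ⟨⟨hs.1.1, ht.1.2⟩, hs.2.trans ht.2⟩
  ne_left s t := by
    simp only [h.hasVal_eq_iff, h.hasVal_ne_iff]
    exact fun hs => ⟨⟨hs.1.1, hs.1.1⟩, trivial⟩
  ne_right s t := by
    simp only [h.hasVal_eq_iff, h.hasVal_ne_iff]
    exact fun hs => ⟨⟨hs.1.2, hs.1.2⟩, trivial⟩
  of_inv s := by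
    simp only [h.hasVal_eq_iff, GTerm.vars]
    exact fun hs => ⟨hs.1, trivial⟩
  of_mul_left s t := by
    simp only [h.hasVal_eq_iff, GTerm.vars, Set.union_subset_iff]
    exact fun hs => ⟨⟨hs.1.1.1, hs.1.1.1⟩, trivial⟩
  of_mul_right s t := by
    simp only [h.hasVal_eq_iff, GTerm.vars, Set.union_subset_iff]
    exact fun hs => ⟨⟨hs.1.1.2, hs.1.1.2⟩, trivial⟩
  one := by
    simp [h.hasVal_eq_iff, GTerm.vars]
  inv s t := by
    simp only [h.hasVal_eq_iff, GTerm.vars, GTerm.eval]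
    exact fun hs => ⟨hs.1, congrArg _ hs.2⟩
  mul s s' t t' := by
    simp only [h.hasVal_eq_iff, GTerm.vars, GTerm.eval, Set.union_subset_iff]
    exact fun hs ht => ⟨⟨⟨hs.1.1, ht.1.1⟩, hs.1.2, ht.1.2⟩, congrArg₂ _ hs.2 ht.2⟩
  eq_or_ne s t := by
    simp only [h.hasVal_eq_iff, h.hasVal_ne_iff]
    intro hs ht
    exact (em _).imp (fun he => ⟨⟨hs.1.1, ht.1.1⟩, he⟩) fun he => ⟨⟨hs.1.1, ht.1.1⟩, he⟩
  not_both s t := by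
    simp only [h.hasVal_eq_iff, h.hasVal_ne_iff]
    exact fun hs ht => ht.2 hs.2
  assoc s t r := by
    simp only [h.hasVal_eq_iff, GTerm.vars, GTerm.eval, Set.union_subset_iff]
    exact fun hs ht hr => ⟨⟨⟨⟨hs.1.1, ht.1.1⟩, hr.1.1⟩, hs.1.1, ht.1.1, hr.1.1⟩, mul_assoc _ _ _⟩
  one_mul s := by
    simp only [h.hasVal_eq_iff, GTerm.vars, GTerm.eval, Set.union_subset_iff]
    exact fun hs => ⟨⟨⟨Set.empty_subset _, hs.1.1⟩, hs.1.1⟩, one_mul _⟩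
  inv_mul s := by
    simp only [h.hasVal_eq_iff, GTerm.vars, GTerm.eval, Set.union_subset_iff]
    exact fun hs => ⟨⟨⟨hs.1.1, hs.1.1⟩, Set.empty_subset _⟩, inv_mul_cancel _⟩

theorem DecidesSet.hasVal_stdNeg_iff [Group U] (h : DecidesSet e (atomicDiagram U)) (d : ℕ)
    (x y w : U) (j : ℕ × ℕ × List ℕ) :
    HasVal e (stdNeg d (.var x) (.var y) (.var w) j) 1 ↔ ¬ StdCond d x y w j := by
  have hvars : (stdNeg d (.var x) (.var y) (.var w) j).vars ⊆ U := by
    rw [stdNeg, vars_literal]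
    exact (vars_stdTerms _ _ _ _ _).trans (Set.union_subset (Set.union_subset
      (Set.singleton_subset_iff.2 x.2) (Set.singleton_subset_iff.2 y.2))
      (Set.singleton_subset_iff.2 w.2))
  rw [h.hasVal_one_iff, and_iff_right (show (stdNeg d (.var x) (.var y) (.var w) j).IsLiteral from
    isLiteral_literal _ _), and_iff_right hvars,
    realize_stdNeg, realize_stdLit]
  simp only [GTerm.eval, nameAssignment_of_mem (Subtype.mem _)]

theorem DecidesSet.hasVal_genLit_iff [Group U] (h : DecidesSet e (atomicDiagram U))
    (x y z : U) (j : ℕ × ℕ × List ℕ) :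
    HasVal e (genLit (.var x) (.var y) (.var z) j) 1 ↔
      y ^ j.1 * z = horner x y j.2.2 * y ^ j.2.1 := by
  have hvars : (genLit (.var x) (.var y) (.var z) j).vars ⊆ U := by
    exact (vars_genLit _ _ _ _).trans (Set.union_subset (Set.union_subset
      (Set.singleton_subset_iff.2 x.2) (Set.singleton_subset_iff.2 y.2))
      (Set.singleton_subset_iff.2 z.2))
  rw [h.hasVal_one_iff, and_iff_right ⟨_, _, Or.inl rfl⟩, and_iff_right hvars, realize_genLit]
  simp only [GTerm.eval, nameAssignment_of_mem (Subtype.mem _)]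

/-- The literal need not mention `w`, so `w` is not known to belong to `U`; its value under
`nameAssignment` is an element of `U` in any case and serves as the counterexample. -/
theorem DecidesSet.not_stdCond_of_hasVal [Group U] (h : DecidesSet e (atomicDiagram U)) (d : ℕ)
    (x y : U) (w : ℕ) (j : ℕ × ℕ × List ℕ)
    (hw : HasVal e (stdNeg d (.var x) (.var y) (.var w) j) 1) :
    ¬ StdCond d x y (nameAssignment U w) j := by
  have hw' := ((h.hasVal_one_iff _).1 hw).2.2
  rw [realize_stdNeg, realize_stdLit] at hw'
  simpa only [GTerm.eval, nameAssignment_of_mem (Subtype.mem _)] using hw'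

theorem DecidesSet.mem_noStdClause_iff [Group U] (h : DecidesSet e (atomicDiagram U)) (d : ℕ) :
    e ∈ clauseSet (noStdClause d) ↔ ¬ ∃ x y : U, IsStdPair d x y := by
  simp only [clauseSet, Set.mem_ofPred_eq, noStdClause, List.mem_cons, List.not_mem_nil, or_false,
    exists_eq_or_imp, exists_eq_left, h.hasVal_zero_iff, h.hasVal_var_iff, ← forall_stdCond_iff]
  push Not
  constructor
  · intro hx x y
    obtain ⟨⟨w, j⟩, hw⟩ := hx (x, y)
    have hw' := (hw.resolve_left fun h => h x.2).resolve_left fun h => h y.2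
    exact ⟨_, j, h.not_stdCond_of_hasVal d x y w j hw'⟩
  · rintro hx ⟨x, y⟩
    by_cases hxU : x ∈ U
    · by_cases hyU : y ∈ U
      · obtain ⟨w, j, hw⟩ := hx ⟨x, hxU⟩ ⟨y, hyU⟩
        exact ⟨(w, j), Or.inr (Or.inr ((h.hasVal_stdNeg_iff d ⟨x, hxU⟩ ⟨y, hyU⟩ w j).2 hw))⟩
      · exact ⟨(0, 0, 0, []), Or.inr (Or.inl hyU)⟩
    · exact ⟨(0, 0, 0, []), Or.inl hxU⟩

theorem DecidesSet.mem_genClause_iff [Group U] (h : DecidesSet e (atomicDiagram U)) (d : ℕ) :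
    e ∈ clauseSet (genClause d) ↔ ∀ x y : U, IsStdPair d x y → Generates x y := by
  simp only [clauseSet, Set.mem_ofPred_eq, genClause, List.mem_cons, List.not_mem_nil, or_false,
    exists_eq_or_imp, exists_eq_left, h.hasVal_zero_iff, h.hasVal_var_iff]
  constructor
  · intro hx x y hxy z
    obtain ⟨⟨w, j⟩, hw⟩ := hx (x, y, z)
    rcases hw with hw | hw | hw | hw | hw
    · exact absurd x.2 hw
    · exact absurd y.2 hw
    · exact absurd z.2 hw
    · exact absurd ((forall_stdCond_iff d x y).2 hxy _ _) (h.not_stdCond_of_hasVal d x y w j hw)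
    · exact ⟨_, _, _, (h.hasVal_genLit_iff x y z j).1 hw⟩
  · rintro hx ⟨x, y, z⟩
    by_cases hxU : x ∈ U
    · by_cases hyU : y ∈ U
      · by_cases hzU : z ∈ U
        · by_cases hxy : IsStdPair d (⟨x, hxU⟩ : U) ⟨y, hyU⟩
          · obtain ⟨m, n, c, hz⟩ := hx _ _ hxy ⟨z, hzU⟩
            exact ⟨(0, m, n, c), Or.inr (Or.inr (Or.inr (Or.inr
              ((h.hasVal_genLit_iff ⟨x, hxU⟩ ⟨y, hyU⟩ ⟨z, hzU⟩ (m, n, c)).2 hz))))⟩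
          · rw [← forall_stdCond_iff] at hxy
            push Not at hxy
            obtain ⟨w, j, hw⟩ := hxy
            exact ⟨(w, j), Or.inr (Or.inr (Or.inr (Or.inl
              ((h.hasVal_stdNeg_iff d ⟨x, hxU⟩ ⟨y, hyU⟩ w j).2 hw))))⟩
        · exact ⟨(0, 0, 0, []), Or.inr (Or.inr (Or.inl hzU))⟩
      · exact ⟨(0, 0, 0, []), Or.inr (Or.inl hyU)⟩
    · exact ⟨(0, 0, 0, []), Or.inl hxU⟩

end Decides

theorem mem_indexSet_lamplighter_iff {d : ℕ} (hd : 1 ≤ d) (e : ℕ) :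
    e ∈ indexSet (Lamplighter d) ↔
      DiagramAxioms e ∧ e ∈ clauseSet (genClause d) ∧ e ∉ clauseSet (noStdClause d) := by
  have key (U : Set ℕ) [Group U] (h : DecidesSet e (atomicDiagram U)) :
      SigIso U (Lamplighter d) ↔
        e ∈ clauseSet (genClause d) ∧ e ∉ clauseSet (noStdClause d) := by
    rw [sigIso_lamplighter_iff hd, IsLampLike, h.mem_genClause_iff, h.mem_noStdClause_iff, not_not,
      and_comm]
  constructor
  · rintro ⟨U, S, h, hiso⟩
    obtain ⟨G, rfl⟩ := hiso.groupAxioms.exists_group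
    exact ⟨h.diagramAxioms, (key U h).1 hiso⟩
  · rintro ⟨hax, h⟩
    obtain ⟨S, hS, hdec⟩ := hax.exists_structure
    obtain ⟨G, rfl⟩ := hS.exists_group
    exact ⟨_, _, hdec, (key _ hdec).2 h⟩

/-- Existence of a standard pair is the Σ₂ set `S₁`; the failures of all Π₂ requirements, those of
the diagram and that of generation, together form `S₂`. -/
theorem isDSigmaTwo_indexSet_lamplighter {d : ℕ} (hd : 1 ≤ d) :
    IsDSigmaTwo (indexSet (Lamplighter d)) := by
  refine ⟨(clauseSet (noStdClause d))ᶜ, _,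
    isSigmaTwo_compl_clauseSet (primrec_noStdClause d),
    (((isSigmaTwo_compl_clauseSet primrec_literalClause).union
      (isSigmaTwo_compl_clauseSet primrec_constantClause)).union
    ((isSigmaTwo_compl_clauseSet primrec_valueClause).union
      (isSigmaTwo_compl_forall_mem termClauses primrec_termClauses))).union
    (isSigmaTwo_compl_clauseSet (primrec_genClause d)), ?_⟩
  ext e
  rw [mem_indexSet_lamplighter_iff hd, diagramAxioms_iff]
  simp only [Set.mem_sdiff, Set.mem_union, Set.mem_compl_iff, Set.mem_ofPred_eq]
  tauto

/-! ## Index sets and families of groups with decidable word problem -/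

theorem SigIso.symm {M N : Type} [GroupSig M] [GroupSig N] (h : SigIso M N) : SigIso N M := by
  obtain ⟨f, hmul, hinv, hone⟩ := h
  refine ⟨f.symm, fun x y => ?_, fun x => ?_, ?_⟩ <;> rw [Equiv.symm_apply_eq]
  · rw [hmul, f.apply_symm_apply, f.apply_symm_apply]
  · rw [hinv, f.apply_symm_apply]
  · exact hone.symm

theorem SigIso.trans {M N P : Type} [GroupSig M] [GroupSig N] [GroupSig P] (h : SigIso M N)
    (h' : SigIso N P) : SigIso M P := by
  obtain ⟨f, hmul, hinv, hone⟩ := h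
  obtain ⟨f', hmul', hinv', hone'⟩ := h'
  refine ⟨f.trans f', fun x y => ?_, fun x => ?_, ?_⟩
  · simp only [Equiv.trans_apply, hmul, hmul']
  · simp only [Equiv.trans_apply, hinv, hinv']
  · simp only [Equiv.trans_apply, hone, hone']

/-- A diagram determines its structure: the universe consists of the `k` for which `x_k = x_k` is
listed, and the operations are given by the listed equations. So an index cannot describe two
non-isomorphic structures. -/
theorem DecidesSet.sigIso {e : ℕ} {U V : Set ℕ} [S : GroupSig U] [S' : GroupSig V]
    (h : DecidesSet e (atomicDiagram U)) (h' : DecidesSet e (atomicDiagram V)) : SigIso U V := by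
  have key (s t : GTerm) : ((s.vars ⊆ U ∧ t.vars ⊆ U) ∧
      s.eval (nameAssignment U) = t.eval (nameAssignment U)) ↔ ((s.vars ⊆ V ∧ t.vars ⊆ V) ∧
      s.eval (nameAssignment V) = t.eval (nameAssignment V)) := by
    rw [← h.hasVal_eq_iff, h'.hasVal_eq_iff]
  have hUV : U = V := Set.ext fun k => by rw [← h.hasVal_var_iff, h'.hasVal_var_iff]
  subst hUV
  have hsub (x : U) : (GTerm.var x).vars ⊆ U := Set.singleton_subset_iff.2 x.2
  refine ⟨Equiv.refl _, fun x y => ?_, fun x => ?_, ?_⟩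
  · have := ((key ((GTerm.var x).mul (.var y)) (.var (S.mul x y : U))).1
      ⟨⟨Set.union_subset (hsub x) (hsub y), hsub _⟩, by
        simp only [GTerm.eval, nameAssignment_of_mem (Subtype.mem _)]; rfl⟩).2
    simp only [GTerm.eval, nameAssignment_of_mem (Subtype.mem _)] at this
    exact this.symm
  · have := ((key (GTerm.var x).inv (.var (S.inv x : U))).1
      ⟨⟨hsub x, hsub _⟩, by
        simp only [GTerm.eval, nameAssignment_of_mem (Subtype.mem _)]⟩).2
    simp only [GTerm.eval, nameAssignment_of_mem (Subtype.mem _)] at this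
    exact this.symm
  · have := ((key GTerm.one (.var (S.one : U))).1
      ⟨⟨Set.empty_subset _, hsub _⟩, by
        simp only [GTerm.eval, nameAssignment_of_mem (Subtype.mem _)]; rfl⟩).2
    simp only [GTerm.eval, nameAssignment_of_mem (Subtype.mem _)] at this
    exact this.symm

/-! ### Words in the generators and terms in words -/

theorem GTerm.eval_congr {M : Type} [GroupSig M] {v v' : ℕ → M} (t : GTerm)
    (h : ∀ k ∈ t.vars, v k = v' k) : t.eval v = t.eval v' := by
  induction t with
  | one => rfl
  | var k => exact h k rfl
  | inv t ih => rw [GTerm.eval, GTerm.eval, ih h]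
  | mul s t ihs iht =>
    rw [GTerm.eval, GTerm.eval, ihs fun k hk => h k (Or.inl hk), iht fun k hk => h k (Or.inr hk)]

theorem GTerm.map_eval {M N : Type} [Group M] [Group N] (f : M →* N) (v : ℕ → M) (t : GTerm) :
    f (t.eval v) = t.eval fun k => f (v k) := by
  induction t with
  | one => exact map_one f
  | var k => rfl
  | inv t ih => exact (map_inv f _).trans (congrArg _ ih)
  | mul s t ihs iht => exact (map_mul f _ _).trans (congrArg₂ _ ihs iht)

/-- The value of a word, where `(k, b)` stands for the `k`-th generator or its inverse. -/
def wordVal {M : Type} [Group M] (g : ℕ → M) (w : List (ℕ × Bool)) : M :=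
  (w.map fun p => cond p.2 (g p.1) (g p.1)⁻¹).prod

/-- The formal inverse of a word. -/
def wordInv (w : List (ℕ × Bool)) : List (ℕ × Bool) := (w.map fun p => (p.1, !p.2)).reverse

section WordVal

variable {M : Type} [Group M] (g : ℕ → M)

theorem wordVal_append (w w' : List (ℕ × Bool)) :
    wordVal g (w ++ w') = wordVal g w * wordVal g w' := by
  simp [wordVal]

theorem wordVal_wordInv (w : List (ℕ × Bool)) : wordVal g (wordInv w) = (wordVal g w)⁻¹ := by
  induction w with
  | nil => simp [wordVal, wordInv]
  | cons p w ih =>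
    have h : wordInv (p :: w) = wordInv w ++ [(p.1, !p.2)] := by simp [wordInv]
    rw [h, wordVal_append, ih]
    obtain ⟨k, b⟩ := p
    cases b <;> simp [wordVal]

theorem wordVal_append_wordInv_eq_one_iff (w w' : List (ℕ × Bool)) :
    wordVal g (w ++ wordInv w') = 1 ↔ wordVal g w = wordVal g w' := by
  rw [wordVal_append, wordVal_wordInv, mul_inv_eq_one]

theorem exists_wordVal_eq {x : M} (hx : x ∈ Subgroup.closure (Set.range g)) :
    ∃ w, wordVal g w = x := by
  induction hx using Subgroup.closure_induction with
  | mem x hx =>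
    obtain ⟨k, rfl⟩ := hx
    exact ⟨[(k, true)], by simp [wordVal]⟩
  | one => exact ⟨[], rfl⟩
  | mul x y _ _ hx hy =>
    obtain ⟨w, rfl⟩ := hx
    obtain ⟨w', rfl⟩ := hy
    exact ⟨w ++ w', wordVal_append g w w'⟩
  | inv x _ hx =>
    obtain ⟨w, rfl⟩ := hx
    exact ⟨wordInv w, wordVal_wordInv g w⟩

end WordVal

theorem primrec_wordInv : Primrec wordInv :=
  Primrec.list_reverse.comp (Primrec.list_map .id
    (((Primrec.fst.comp .snd).pair (Primrec.not.comp (Primrec.snd.comp .snd))).to₂))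

/-- The word with a given number. -/
def natWord (k : ℕ) : List (ℕ × Bool) := (Encodable.decode k).getD []

theorem primrec_natWord : Primrec natWord :=
  Primrec.option_getD.comp Primrec.decode (Primrec.const [])

/-- The word obtained from a term by substituting the `k`-th word for the variable `x_k`. -/
def GTerm.word (t : GTerm) : List (ℕ × Bool) := t.fold [] natWord wordInv (· ++ ·)

theorem GTerm.wordVal_word {M : Type} [Group M] (g : ℕ → M) (t : GTerm) :
    wordVal g t.word = t.eval fun k => wordVal g (natWord k) := by
  induction t with
  | one => rfl
  | var k => rfl
  | inv t ih => exact (wordVal_wordInv g _).trans (congrArg _ ih)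
  | mul s t ihs iht => exact (wordVal_append g _ _).trans (congrArg₂ _ ihs iht)

theorem GTerm.computable_word : Computable GTerm.word := by
  have := Computable.gterm_fold (α := Unit) (o := fun _ => []) (v := fun _ => natWord)
    (i := fun _ => wordInv) (m := fun _ p => p.1 ++ p.2) (Computable.const [])
    (primrec_natWord.to_comp.comp Computable.snd) (primrec_wordInv.to_comp.comp Computable.snd)
    (Primrec.list_append.to_comp.comp (Computable.fst.comp Computable.snd)
      (Computable.snd.comp Computable.snd))
  exact this.comp (Computable.const ()) Computable.id

/-- The numbers of words which are the first ones with their value. -/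
def firstWords {M : Type} [Group M] (g : ℕ → M) : Set ℕ :=
  {k | ∀ j < k, wordVal g (natWord j) ≠ wordVal g (natWord k)}

theorem bijective_firstWords {M : Type} [Group M] {g : ℕ → M}
    (hg : Subgroup.closure (Set.range g) = ⊤) :
    Function.Bijective fun k : firstWords g => wordVal g (natWord k) := by
  classical
  constructor
  · intro j k h
    refine Subtype.ext (le_antisymm ?_ ?_)
    · exact not_lt.1 fun hlt => j.2 k hlt h.symm
    · exact not_lt.1 fun hlt => k.2 j hlt h
  · intro x
    obtain ⟨w, hw⟩ := exists_wordVal_eq g (hg ▸ Subgroup.mem_top x)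
    have hex : ∃ k, wordVal g (natWord k) = x :=
      ⟨Encodable.encode w, by rw [natWord, Encodable.encodek, Option.getD_some, hw]⟩
    exact ⟨⟨Nat.find hex, fun j hj h => Nat.find_min hex hj (h.trans (Nat.find_spec hex))⟩,
      Nat.find_spec hex⟩

/-- The group structure is transported along the bijection with least word numbers. Evaluating a
term then amounts to substituting words for its constants. -/
theorem exists_structure_firstWords {M : Type} [Group M] {g : ℕ → M}
    (hg : Subgroup.closure (Set.range g) = ⊤) :
    ∃ _ : GroupSig (firstWords g), SigIso (firstWords g) M ∧
      ∀ t s : GTerm, s.vars ⊆ firstWords g → t.vars ⊆ firstWords g →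
        (s.eval (nameAssignment (firstWords g)) = t.eval (nameAssignment (firstWords g)) ↔
          wordVal g s.word = wordVal g t.word) := by
  let E := Equiv.ofBijective _ (bijective_firstWords hg)
  let _ : Group (firstWords g) := E.group
  have hE (s : GTerm) (hs : s.vars ⊆ firstWords g) :
      E (s.eval (nameAssignment (firstWords g))) = wordVal g s.word := by
    rw [GTerm.wordVal_word]
    refine (GTerm.map_eval E.mulEquiv.toMonoidHom _ s).trans (GTerm.eval_congr s fun k hk => ?_)
    rw [nameAssignment_of_mem (hs hk)]
    rfl
  refine ⟨inferInstance, sigIso_iff_nonempty_mulEquiv.2 ⟨E.mulEquiv⟩, fun t s hs ht => ?_⟩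
  rw [← hE s hs, ← hE t ht]
  exact E.injective.eq_iff.symm

/-! ### Computable copies, uniformly from word problems -/

section Family

variable {G : ℕ → Type} [∀ n, Group (G n)] {g : ∀ n, ℕ → G n}

theorem computablePred_wordVal_eq
    (hW : ComputablePred fun p : ℕ × List (ℕ × Bool) => wordVal (g p.1) p.2 = 1) :
    ComputablePred fun p : ℕ × List (ℕ × Bool) × List (ℕ × Bool) =>
      wordVal (g p.1) p.2.1 = wordVal (g p.1) p.2.2 := by
  refine (hW.comp (f := fun p : ℕ × List (ℕ × Bool) × List (ℕ × Bool) =>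
    (p.1, p.2.1 ++ wordInv p.2.2)) ?_).of_eq fun p => wordVal_append_wordInv_eq_one_iff _ _ _
  exact (Primrec.fst.pair (Primrec.list_append.comp (Primrec.fst.comp Primrec.snd)
    (primrec_wordInv.comp (Primrec.snd.comp Primrec.snd)))).to_comp

theorem computablePred_mem_firstWords
    (hW : ComputablePred fun p : ℕ × List (ℕ × Bool) => wordVal (g p.1) p.2 = 1) :
    ComputablePred fun p : ℕ × ℕ => p.2 ∈ firstWords (g p.1) := by
  refine ComputablePred.forall_lt (P := fun (p : ℕ × ℕ) j =>
    wordVal (g p.1) (natWord j) ≠ wordVal (g p.1) (natWord p.2)) (k := Prod.snd) ?_ Computable.snd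
  refine ComputablePred.not ((computablePred_wordVal_eq hW).comp
    (f := fun p : (ℕ × ℕ) × ℕ => (p.1.1, natWord p.2, natWord p.1.2)) ?_)
  exact ((Primrec.fst.comp Primrec.fst).pair ((primrec_natWord.comp Primrec.snd).pair
    (primrec_natWord.comp (Primrec.snd.comp Primrec.fst)))).to_comp

theorem computablePred_vars_subset {U : ℕ → Set ℕ}
    (hU : ComputablePred fun p : ℕ × ℕ => p.2 ∈ U p.1) :
    ComputablePred fun p : ℕ × GTerm => p.2.vars ⊆ U p.1 := by
  classical
  -- The fold counts the occurrences of variables outside `U n`.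
  have hf : Computable₂ fun (n : ℕ) (t : GTerm) =>
      t.fold 0 (fun k => if k ∈ U n then 0 else 1) id fun x y => x + y :=
    Computable.gterm_fold (α := ℕ) (σ := ℕ) (o := fun _ => 0)
      (v := fun n k => if k ∈ U n then 0 else 1) (i := fun _ => id) (m := fun _ p => p.1 + p.2)
      (Computable.const 0) (Computable.ite hU (Computable.const 0) (Computable.const 1))
      Computable.snd (Primrec.nat_add.to_comp.comp (Computable.fst.comp Computable.snd)
      (Computable.snd.comp Computable.snd))
  refine (ComputablePred.nat_eq hf (Computable.const 0)).of_eq fun p => ?_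
  obtain ⟨n, t⟩ := p
  induction t with
  | one => simp [GTerm.fold, GTerm.vars]
  | var k => by_cases hk : k ∈ U n <;> simp [GTerm.fold, GTerm.vars, hk]
  | inv t ih => exact ih
  | mul s t ihs iht =>
    simp only [GTerm.fold, GTerm.vars, Set.union_subset_iff] at ihs iht ⊢
    rw [← ihs, ← iht, Nat.add_eq_zero_iff]

/-- Least words for the elements form a decidable universe, and the truth of a literal over it is an
instance of the word problem. This decision procedure is uniform in `n`, so the `s`-`m`-`n` theorem
gives the reduction. -/
theorem exists_computable_mem_indexSet_iff (A : Type) [GroupSig A]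
    (hg : ∀ n, Subgroup.closure (Set.range (g n)) = ⊤)
    (hW : ComputablePred fun p : ℕ × List (ℕ × Bool) => wordVal (g p.1) p.2 = 1) :
    ∃ f : ℕ → ℕ, Computable f ∧ ∀ n, f n ∈ indexSet A ↔ SigIso (G n) A := by
  classical
  let D : ℕ × GTerm × GTerm → Prop := fun p =>
    p.2.1.vars ⊆ firstWords (g p.1) ∧ p.2.2.vars ⊆ firstWords (g p.1)
  let E : ℕ × GTerm × GTerm → Prop := fun p =>
    wordVal (g p.1) p.2.1.word = wordVal (g p.1) p.2.2.word
  have hD : ComputablePred D := by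
    have h := computablePred_vars_subset (U := fun n => firstWords (g n))
      (computablePred_mem_firstWords hW)
    exact (h.comp (f := fun p : ℕ × GTerm × GTerm => (p.1, p.2.1))
      (Computable.fst.pair (Computable.fst.comp Computable.snd))).and
      (h.comp (f := fun p : ℕ × GTerm × GTerm => (p.1, p.2.2))
      (Computable.fst.pair (Computable.snd.comp Computable.snd)))
  have hE : ComputablePred E :=
    (computablePred_wordVal_eq hW).comp (f := fun p : ℕ × GTerm × GTerm =>
      (p.1, p.2.1.word, p.2.2.word)) (Computable.fst.pair
        ((GTerm.computable_word.comp (Computable.fst.comp Computable.snd)).pair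
          (GTerm.computable_word.comp (Computable.snd.comp Computable.snd))))
  let q : ℕ → ℕ → ℕ × GTerm × GTerm := fun n m =>
    (n, GTerm.ofNat m.unpair.1, GTerm.ofNat m.unpair.2)
  have hq : Primrec₂ q := Primrec.fst.pair
    ((GTerm.primrec_ofNat.comp (Primrec.fst.comp (Primrec.unpair.comp Primrec.snd))).pair
      (GTerm.primrec_ofNat.comp (Primrec.snd.comp (Primrec.unpair.comp Primrec.snd))))
  have hdiv (k : ℕ) : Primrec fun p : ℕ × ℕ => q p.1 (p.2 / k) :=
    hq.comp Primrec.fst (Primrec.nat_div.comp Primrec.snd (Primrec.const k))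
  have hmod (k r : ℕ) : ComputablePred fun p : ℕ × ℕ => p.2 % k = r :=
    ComputablePred.nat_eq (Primrec.nat_mod.comp Primrec.snd (Primrec.const k)).to_comp
      (Computable.const r)
  let P : ℕ × ℕ → Prop := fun p => (p.2 % 4 = 0 ∧ D (q p.1 (p.2 / 4)) ∧ E (q p.1 (p.2 / 4))) ∨
    (p.2 % 16 = 1 ∧ D (q p.1 (p.2 / 16)) ∧ ¬ E (q p.1 (p.2 / 16)))
  have hP : ComputablePred P :=
    ((hmod 4 0).and ((hD.comp (hdiv 4).to_comp).and (hE.comp (hdiv 4).to_comp))).or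
      ((hmod 16 1).and ((hD.comp (hdiv 16).to_comp).and (hE.comp (hdiv 16).to_comp).not))
  obtain ⟨f, hf, hphi⟩ := exists_computable_index (F := fun n c => if P (n, c) then 1 else 0)
    (Computable.ite hP (Computable.const 1) (Computable.const 0))
  refine ⟨f, hf, fun n => ?_⟩
  obtain ⟨S, hiso, hS⟩ := exists_structure_firstWords (hg n)
  have hqe (s t : GTerm) : q n (Nat.pair s.toNat t.toNat) = (n, s, t) := by
    simp only [q, Nat.unpair_pair, GTerm.ofNat_toNat]
  have hmem (p : QF) : (p.IsLiteral ∧ p.vars ⊆ firstWords (g n) ∧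
      p.Realize (nameAssignment (firstWords (g n)))) ↔ P (n, p.toNat) := by
    have hnot (hp : ¬ p.IsLiteral) : ¬ P (n, p.toNat) := by
      rw [QF.isLiteral_iff] at hp
      rintro (h | h)
      · exact hp (Or.inl h.1)
      · exact hp (Or.inr h.1)
    by_cases hp : p.IsLiteral
    · rw [and_iff_right hp]
      obtain ⟨s, t, rfl | rfl⟩ := hp
      · have h1 : (QF.eq s t).toNat % 4 = 0 := by simp only [QF.toNat]; omega
        have h2 : (QF.eq s t).toNat % 16 ≠ 1 := by simp only [QF.toNat]; omega
        have h3 : (QF.eq s t).toNat / 4 = Nat.pair s.toNat t.toNat := by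
          simp only [QF.toNat]; omega
        simp only [P, h1, h2, h3, hqe, true_and, false_and, or_false, D, E, QF.vars,
          Set.union_subset_iff]
        exact and_congr_right fun h => hS t s h.1 h.2
      · have h1 : (QF.eq s t).not.toNat % 4 ≠ 0 := by simp only [QF.toNat]; omega
        have h2 : (QF.eq s t).not.toNat % 16 = 1 := by simp only [QF.toNat]; omega
        have h3 : (QF.eq s t).not.toNat / 16 = Nat.pair s.toNat t.toNat := by
          simp only [QF.toNat]; omega
        simp only [P, h1, h2, h3, hqe, true_and, false_and, false_or, D, E, QF.vars,
          Set.union_subset_iff]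
        exact and_congr_right fun h => not_congr (hS t s h.1 h.2)
    · exact iff_of_false (fun h => hp h.1) (hnot hp)
  have hdec : DecidesSet (f n) (atomicDiagram (firstWords (g n))) := by
    intro c
    have hc : c ∈ atomicDiagram (firstWords (g n)) ↔ P (n, c) := by
      rw [← QF.toNat_ofNat c, ← hmem]
      constructor
      · rintro ⟨p, h1, h2, h3, h4⟩
        rw [QF.equivNat.injective h4]
        exact ⟨h1, h2, h3⟩
      · rintro ⟨h1, h2, h3⟩
        exact ⟨_, h1, h2, h3, rfl⟩
    rw [hc, hphi]
    exact ⟨fun h => by rw [if_pos h], fun h => by rw [if_neg h]⟩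
  constructor
  · rintro ⟨V, S', hdec', hA⟩
    -- Any other structure with the same diagram is isomorphic to the one just built.
    exact (hiso.symm.trans (hdec.sigIso hdec')).trans hA
  · intro h
    exact ⟨_, S, hdec, hiso.trans h⟩

end Family

/-! ## The word problem for groups of lamps -/

theorem map_wordVal {M N : Type} [Group M] [Group N] (f : M →* N) (g : ℕ → M)
    (w : List (ℕ × Bool)) : f (wordVal g w) = wordVal (fun k => f (g k)) w := by
  rw [wordVal, map_list_prod, List.map_map, wordVal]
  congr 2
  funext p
  cases h : p.2 <;> simp [h]

theorem Finset.sum_range_getD {α M : Type*} [AddCommMonoid M] (f : α → M) (a : α) (l : List α) :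
    ∑ i ∈ Finset.range l.length, f (l.getD i a) = (l.map f).sum := by
  induction l with
  | nil => rfl
  | cons b l ih =>
    rw [List.length_cons, Finset.sum_range_succ', List.map_cons, List.sum_cons, ← ih, add_comm]
    rfl

theorem List.take_succ_getD {α : Type*} (a : α) {l : List α} {k : ℕ} (hk : k < l.length) :
    l.take (k + 1) = l.take k ++ [l.getD k a] := by
  simp [hk]

theorem primrec_list_take {α : Type*} [Primcodable α] :
    Primrec₂ fun (l : List α) (k : ℕ) => l.take k := by
  have h : Primrec₂ fun (l : List α) (k : ℕ) =>
      (List.range k).filterMap fun i => l[i]? :=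
    Primrec.listFilterMap (Primrec.list_range.comp Primrec.snd)
      (Primrec.list_getElem?.comp (Primrec.fst.comp Primrec.fst) Primrec.snd)
  refine h.of_eq fun l k => ?_
  induction k with
  | zero => rfl
  | succ k ih =>
    rw [List.range_succ, List.filterMap_append, ih, List.take_add_one]
    cases h : l[k]? <;> simp [h]

namespace LampGroup

variable {d : ℕ} {A : Type} [AddCommGroup A]

/-- The generators of a group of lamps: the lamp at the origin and given shifts. -/
noncomputable def gens (d : ℕ) (v : ℕ → A) : ℕ → LampGroup d A
  | 0 => base (AddMonoidAlgebra.single 0 1)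
  | k + 1 => shift (v (k + 1))

/-- The number of times that a letter changes the current lamp. -/
def lampChange (d : ℕ) (p : ℕ × Bool) : ℕ := if p.1 = 0 then cond p.2 1 (d - 1) else 0

/-- The position of the lamplighter at time `i`. -/
def posAt (v : ℕ → A) (w : List (ℕ × Bool)) (i : ℕ) : Multiplicative A :=
  wordVal (fun k => Multiplicative.ofAdd (v k)) (w.take i)

theorem ofAdd_pos_wordVal_gens {v : ℕ → A} (hv : v 0 = 0) (w : List (ℕ × Bool)) :
    Multiplicative.ofAdd (wordVal (gens d v) w).pos =
      wordVal (fun k => Multiplicative.ofAdd (v k)) w := by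
  refine (map_wordVal posHom (gens d v) w).trans ?_
  congr 1
  funext k
  cases k
  · exact congrArg Multiplicative.ofAdd hv.symm
  · rfl

theorem lamps_wordVal_singleton (hd : 1 ≤ d) (v : ℕ → A) (p : ℕ × Bool) :
    (wordVal (gens d v) [p]).lamps = AddMonoidAlgebra.single 0 (lampChange d p : ZMod d) := by
  obtain ⟨_ | k, b⟩ := p
  · cases b
    · simp [wordVal, gens, lampChange, Nat.cast_sub hd, ← AddMonoidAlgebra.one_def,
        AddMonoidAlgebra.single_neg]
    · simp [wordVal, gens, lampChange]
  · cases b <;> simp [wordVal, gens, lampChange]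

/-- The letter read at time `i` acts on the lamp at the current position of the lamplighter. -/
theorem lamps_wordVal_take (hd : 1 ≤ d) {v : ℕ → A} (hv : v 0 = 0) (w : List (ℕ × Bool)) {k : ℕ}
    (hk : k ≤ w.length) : (wordVal (gens d v) (w.take k)).lamps =
      ∑ i ∈ Finset.range k, AddMonoidAlgebra.single (posAt v w i).toAdd
        (lampChange d (w.getD i (0, true)) : ZMod d) := by
  induction k with
  | zero => simp [wordVal]
  | succ k ih =>
    rw [List.take_succ_getD (0, true) hk, wordVal_append, mul_lamps, ih (by omega),
      Finset.sum_range_succ, lamps_wordVal_singleton hd, AddMonoidAlgebra.single_mul_single,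
      one_mul, add_zero, posAt, ← ofAdd_pos_wordVal_gens (d := d) hv, toAdd_ofAdd]

/-- Coefficients away from the points `p j` vanish anyway, so finitely many equations suffice, and
testing them only requires comparing the points. -/
theorem sum_single_eq_zero_iff {ι : Type} [DecidableEq A] (s : Finset ι) (p : ι → A)
    (c : ι → ZMod d) : ∑ i ∈ s, AddMonoidAlgebra.single (p i) (c i) = 0 ↔
      ∀ j ∈ s, ∑ i ∈ s, (if p i = p j then c i else 0) = 0 := by
  have hcoeff (a : A) : (∑ i ∈ s, AddMonoidAlgebra.single (p i) (c i)).coeff a =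
      ∑ i ∈ s, if p i = a then c i else 0 := by
    simp [AddMonoidAlgebra.coeff_sum, Finsupp.single_apply]
  constructor
  · intro h j _
    rw [← hcoeff, h]
    rfl
  · intro h
    refine AddMonoidAlgebra.coeff_injective (Finsupp.ext fun a => ?_)
    refine (hcoeff a).trans ?_
    by_cases ha : ∃ j ∈ s, p j = a
    · obtain ⟨j, hj, rfl⟩ := ha
      exact h j hj
    · push Not at ha
      exact Finset.sum_eq_zero fun i hi => if_neg (ha i hi)

-- This reduces the word problem to that of `A`: the lamplighter must return to the origin, and at
-- each visited position the changes must cancel modulo `d`. Inverse letters count as `d - 1`, so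
-- the sums stay in `ℕ`.
open Classical in
theorem wordVal_gens_eq_one_iff (hd : 1 ≤ d) {v : ℕ → A} (hv : v 0 = 0) (w : List (ℕ × Bool)) :
    wordVal (gens d v) w = 1 ↔ posAt v w w.length = posAt v w 0 ∧
      ∀ j < w.length, d ∣ ∑ i ∈ Finset.range w.length,
        if posAt v w i = posAt v w j then lampChange d (w.getD i (0, true)) else 0 := by
  have h1 : (wordVal (gens d v) w).pos = 0 ↔ posAt v w w.length = posAt v w 0 := by
    rw [posAt, List.take_length, ← ofAdd_pos_wordVal_gens (d := d) hv]
    exact Iff.rfl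
  have h2 : (wordVal (gens d v) w).lamps = 0 ↔
      ∀ j < w.length, d ∣ ∑ i ∈ Finset.range w.length,
        if posAt v w i = posAt v w j then lampChange d (w.getD i (0, true)) else 0 := by
    have := lamps_wordVal_take hd hv w le_rfl
    rw [List.take_length] at this
    rw [this, sum_single_eq_zero_iff]
    simp only [Finset.mem_range, ← ZMod.natCast_eq_zero_iff, Nat.cast_sum, Nat.cast_ite,
      Nat.cast_zero]
    exact Iff.rfl
  rw [← h1, ← h2, LampGroup.ext_iff, and_comm]
  rfl

theorem computablePred_wordVal_gens {A : ℕ → Type} [∀ n, AddCommGroup (A n)] (hd : 1 ≤ d)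
    {v : ∀ n, ℕ → A n} (h0 : ∀ n, v n 0 = 0) (hv : ComputablePred fun p : ℕ × List (ℕ × Bool) =>
      wordVal (fun k => Multiplicative.ofAdd (v p.1 k)) p.2 = 1) :
    ComputablePred fun p : ℕ × List (ℕ × Bool) => wordVal (gens d (v p.1)) p.2 = 1 := by
  classical
  have hQ : ComputablePred fun p : (ℕ × List (ℕ × Bool)) × ℕ × ℕ =>
      posAt (v p.1.1) p.1.2 p.2.1 = posAt (v p.1.1) p.1.2 p.2.2 := by
    refine (computablePred_wordVal_eq (G := fun n => Multiplicative (A n))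
      (g := fun n k => Multiplicative.ofAdd (v n k)) hv).comp
      (f := fun p : (ℕ × List (ℕ × Bool)) × ℕ × ℕ =>
      (p.1.1, p.1.2.take p.2.1, p.1.2.take p.2.2)) (Primrec.to_comp ?_)
    have h1 : Primrec fun p : (ℕ × List (ℕ × Bool)) × ℕ × ℕ => p.1.2 :=
      Primrec.snd.comp Primrec.fst
    exact (Primrec.fst.comp Primrec.fst).pair ((primrec_list_take.comp h1
      (Primrec.fst.comp Primrec.snd)).pair (primrec_list_take.comp h1
        (Primrec.snd.comp Primrec.snd)))
  have hlen : Primrec fun p : ℕ × List (ℕ × Bool) => p.2.length :=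
    Primrec.list_length.comp Primrec.snd
  have hchange : Primrec (lampChange d) :=
    Primrec.ite (Primrec.eq.comp Primrec.fst (Primrec.const 0))
      (Primrec.cond Primrec.snd (Primrec.const 1) (Primrec.const (d - 1))) (Primrec.const 0)
  refine ComputablePred.of_eq ?_ fun p => (wordVal_gens_eq_one_iff hd (h0 p.1) p.2).symm
  refine (hQ.comp (f := fun p : ℕ × List (ℕ × Bool) => (p, p.2.length, 0))
    (Primrec.id.pair (hlen.pair (Primrec.const 0))).to_comp).and
      (ComputablePred.forall_lt (ComputablePred.dvd_const d ?_) hlen.to_comp)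
  refine Computable.sum_range (α := (ℕ × List (ℕ × Bool)) × ℕ) (F := fun a i =>
    if posAt (v a.1.1) a.1.2 i = posAt (v a.1.1) a.1.2 a.2 then
      lampChange d (a.1.2.getD i (0, true)) else 0) ?_ (hlen.comp Primrec.fst).to_comp
  refine Computable.ite (hQ.comp (f := fun p : ((ℕ × List (ℕ × Bool)) × ℕ) × ℕ =>
    (p.1.1, p.2, p.1.2)) ?_) ?_ (Computable.const 0)
  · exact ((Primrec.fst.comp Primrec.fst).pair (Primrec.snd.pair
      (Primrec.snd.comp Primrec.fst))).to_comp
  · exact (hchange.comp ((Primrec.list_getD (0, true)).comp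
      (Primrec.snd.comp (Primrec.fst.comp Primrec.fst)) Primrec.snd)).to_comp

end LampGroup

/-! ## Counters for `Σ₂` sets -/

/-- Search for a witness `x`: check `R (n, x, y)` for `y = 0, 1, …`, and pass to `x + 1` at the
first failure. The counter is the current candidate, and it comes to rest exactly when a true
witness exists. -/
theorem exists_counter {S : Set ℕ} (hS : IsSigmaTwo S) :
    ∃ c : ℕ → ℕ → ℕ, Computable₂ c ∧ (∀ n, Monotone (c n)) ∧ (∀ n s, c n s ≤ s) ∧
      ∀ n, n ∈ S ↔ ∃ s, ∀ t, c n t ≤ c n s := by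
  classical
  obtain ⟨R, hR, hS⟩ := hS
  let step : ℕ → ℕ × ℕ → ℕ × ℕ := fun n p => if R (n, p) then (p.1, p.2 + 1) else (p.1 + 1, 0)
  let scan : ℕ → ℕ → ℕ × ℕ := fun n s => Nat.rec (0, 0) (fun _ p => step n p) s
  have hstep : Computable₂ step :=
    Computable.ite hR
      ((Primrec.fst.comp Primrec.snd).pair
        (Primrec.succ.comp (Primrec.snd.comp Primrec.snd))).to_comp
      ((Primrec.succ.comp (Primrec.fst.comp Primrec.snd)).pair (Primrec.const 0)).to_comp
  have hscan : Computable₂ scan :=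
    Computable.nat_rec (α := ℕ × ℕ) (f := Prod.snd) (g := fun _ => (0, 0))
      (h := fun a p => step a.1 p.2) Computable.snd (Computable.const _)
      (hstep.comp (Computable.fst.comp Computable.fst) (Computable.snd.comp Computable.snd))
  have hsucc (n s : ℕ) : scan n (s + 1) = step n (scan n s) := rfl
  have htrue {n s : ℕ} (h : R (n, scan n s)) :
      scan n (s + 1) = ((scan n s).1, (scan n s).2 + 1) := by rw [hsucc]; exact if_pos h
  have hfalse {n s : ℕ} (h : ¬ R (n, scan n s)) : scan n (s + 1) = ((scan n s).1 + 1, 0) := by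
    rw [hsucc]; exact if_neg h
  have hmono (n : ℕ) : Monotone fun s => (scan n s).1 := by
    refine monotone_nat_of_le_succ fun s => ?_
    by_cases h : R (n, scan n s)
    · rw [htrue h]
    · rw [hfalse h]; exact Nat.le_succ _
  -- Every abandoned candidate has been refuted, so the scan never passes a true witness.
  have hbelow (n s : ℕ) : ∀ x < (scan n s).1, ∃ y, ¬ R (n, x, y) := by
    induction s with
    | zero => exact fun x hx => absurd hx (Nat.not_lt_zero x)
    | succ s ih =>
      by_cases h : R (n, scan n s)
      · rw [htrue h]; exact ih
      · rw [hfalse h]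
        intro x hx
        rcases Nat.lt_succ_iff_lt_or_eq.1 hx with hx | rfl
        · exact ih x hx
        · exact ⟨_, h⟩
  have hup (n s : ℕ) : ∀ y < (scan n s).2, R (n, (scan n s).1, y) := by
    induction s with
    | zero => exact fun x hx => absurd hx (Nat.not_lt_zero x)
    | succ s ih =>
      by_cases h : R (n, scan n s)
      · rw [htrue h]
        intro y hy
        rcases Nat.lt_succ_iff_lt_or_eq.1 hy with hy | rfl
        · exact ih y hy
        · exact h
      · rw [hfalse h]; exact fun x hx => absurd hx (Nat.not_lt_zero x)
  refine ⟨fun n s => (scan n s).1, Computable.fst.comp hscan, hmono, fun n s => ?_, fun n => ?_⟩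
  · change (scan n s).1 ≤ s
    induction s with
    | zero => exact le_rfl
    | succ s ih =>
      by_cases h : R (n, scan n s)
      · rw [htrue h]; exact ih.trans (Nat.le_succ s)
      · rw [hfalse h]; exact Nat.succ_le_succ ih
  · rw [hS]
    constructor
    · rintro ⟨x, hx⟩
      have hle (t : ℕ) : (scan n t).1 ≤ x := by
        by_contra hlt
        obtain ⟨y, hy⟩ := hbelow n t x (not_le.1 hlt)
        exact hy (hx y)
      obtain ⟨_, ⟨⟨s, rfl⟩, hs⟩⟩ := (Set.finite_le_nat x).subset
        (Set.range_subset_iff.2 hle) |>.exists_maximal (Set.range_nonempty _)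
      exact ⟨s, fun t => (le_total _ _).elim (fun h => hs ⟨t, rfl⟩ h) id⟩
    · rintro ⟨s, hs⟩
      refine ⟨(scan n s).1, fun y => ?_⟩
      have heq (t : ℕ) : (scan n (s + t)).1 = (scan n s).1 :=
        le_antisymm (hs _) (hmono n (Nat.le_add_right s t))
      -- Once the candidate is final, each further step verifies one more `y`.
      have hgrow (t : ℕ) : t ≤ (scan n (s + t)).2 := by
        induction t with
        | zero => exact Nat.zero_le _
        | succ t ih =>
          have h : R (n, scan n (s + t)) := by
            by_contra h
            have := congrArg Prod.fst (hfalse h)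
            rw [show s + t + 1 = s + (t + 1) by omega, heq, heq] at this
            simp at this
          rw [show s + (t + 1) = s + t + 1 by omega, htrue h]
          exact Nat.succ_le_succ ih
      have := hup n (s + (y + 1)) y (hgrow (y + 1))
      rwa [heq] at this

/-! ## Groups of positions -/

/-- The least `t` such that `c` grows between `s` and `t` gives the position `(2 ^ t, 0)`; if there
is no such `t` then the position is `(0, 1)`. -/
noncomputable def jumpPos (c : ℕ → ℕ) (s : ℕ) : ℚ × ℚ :=
  open Classical in if h : ∃ t, c s < c t then (2 ^ Nat.find h, 0) else (0, 1)

/-- Generators of the group of positions given by two counters. -/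
noncomputable def counterPos (c c' : ℕ → ℕ) (k : ℕ) : ℚ × ℚ :=
  if k = 0 then 0 else if k % 2 = 0 then ((2 ^ c (k / 2))⁻¹, 0) else jumpPos c' (k / 2)

/-- The number of `t < m` such that `c` does not grow between `s` and `t`. -/
def jumpBound (c : ℕ → ℕ) (m s : ℕ) : ℕ := ∑ t ∈ Finset.range m, if c t ≤ c s then 1 else 0

/-- The approximation of the first coordinate of `counterPos c c' k` at the stage `m`, multiplied
by `2 ^ m`. -/
def approxPos (c c' : ℕ → ℕ) (m k : ℕ) : ℕ :=
  if k = 0 then 0 else if k % 2 = 0 then 2 ^ (m - c (k / 2)) else 2 ^ (m + jumpBound c' m (k / 2))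

theorem jumpBound_of_forall {c : ℕ → ℕ} {m s : ℕ} (h : ∀ t < m, c t ≤ c s) :
    jumpBound c m s = m := by
  rw [jumpBound, Finset.sum_congr rfl fun t ht => if_pos (h t (Finset.mem_range.1 ht))]
  simp

/-- By monotonicity the stages at which `c` has not grown form an initial segment, so counting them
finds the first stage of growth. -/
theorem jumpPos_of_lt {c : ℕ → ℕ} (hc : Monotone c) {m s t : ℕ} (hst : c s < c t) (ht : t ≤ m) :
    jumpPos c s = (2 ^ jumpBound c m s, 0) ∧ jumpBound c m s ≤ t := by
  classical
  have hex : ∃ t, c s < c t := ⟨t, hst⟩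
  have hle : Nat.find hex ≤ t := Nat.find_min' hex hst
  have hb : jumpBound c m s = Nat.find hex := by
    rw [jumpBound, ← Finset.sum_filter_add_sum_filter_not (Finset.range m) (· < Nat.find hex)]
    rw [Finset.sum_congr rfl fun t ht =>
      if_pos (not_lt.1 (Nat.find_min hex (Finset.mem_filter.1 ht).2)),
      Finset.sum_congr rfl fun t ht => if_neg (not_le.2 ((Nat.find_spec hex).trans_le
        (hc (not_lt.1 (Finset.mem_filter.1 ht).2))))]
    have : (Finset.range m).filter (· < Nat.find hex) = Finset.range (Nat.find hex) := by
      ext i; simp only [Finset.mem_filter, Finset.mem_range]; omega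
    rw [this]; simp
  rw [hb]
  refine ⟨?_, hle⟩
  rw [jumpPos, dif_pos hex]

theorem jumpPos_of_forall {c : ℕ → ℕ} {m s : ℕ} (h : ∀ t < m, c t ≤ c s) :
    (∃ t, m ≤ t ∧ jumpPos c s = (2 ^ t, 0)) ∨ jumpPos c s = (0, 1) := by
  classical
  by_cases hex : ∃ t, c s < c t
  · refine Or.inl ⟨Nat.find hex, ?_, ?_⟩
    · by_contra hlt
      exact absurd (Nat.find_spec hex) (not_lt.2 (h _ (not_le.1 hlt)))
    · rw [jumpPos, dif_pos hex]
  · exact Or.inr (dif_neg hex)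

theorem jumpPos_congr {c : ℕ → ℕ} {s t : ℕ} (h : c s = c t) : jumpPos c s = jumpPos c t := by
  unfold jumpPos
  generalize c s = x at h ⊢
  subst h
  rfl

/-- The sum of the values of the letters of a word. -/
def wordSum {A : Type*} [AddCommGroup A] (v : ℕ → A) (w : List (ℕ × Bool)) : A :=
  (w.map fun p => cond p.2 (v p.1) (-v p.1)).sum

theorem wordSum_cons {A : Type*} [AddCommGroup A] (v : ℕ → A) (p : ℕ × Bool)
    (w : List (ℕ × Bool)) : wordSum v (p :: w) = cond p.2 1 (-1 : ℤ) • v p.1 + wordSum v w := by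
  obtain ⟨k, b⟩ := p
  cases b <;> simp [wordSum]

theorem wordVal_ofAdd {A : Type} [AddCommGroup A] (v : ℕ → A) (w : List (ℕ × Bool)) :
    wordVal (fun k => Multiplicative.ofAdd (v k)) w = Multiplicative.ofAdd (wordSum v w) := by
  induction w with
  | nil => rfl
  | cons p w ih =>
    have h := congrArg
      (cond p.2 (Multiplicative.ofAdd (v p.1)) (Multiplicative.ofAdd (v p.1))⁻¹ * ·) ih
    obtain ⟨k, b⟩ := p
    cases b <;> exact h

/-- If the first coordinates are small then multiples of a second element, which is large or
independent, do not cancel them. -/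
theorem add_zsmul_eq_zero_iff {m : ℕ} {W : ℚ × ℚ}
    (hW : (∃ t, m ≤ t ∧ W = (2 ^ t, 0)) ∨ W = (0, 1)) {r : ℚ} (hr : |r| < 2 ^ m) (a : ℤ) :
    ((r, 0) : ℚ × ℚ) + a • W = 0 ↔ r + a * 2 ^ m = 0 := by
  have key {t : ℕ} (ht : m ≤ t) : r + a * 2 ^ t = 0 ↔ r = 0 ∧ a = 0 := by
    constructor
    · intro h
      have ha : a = 0 := by
        by_contra ha
        have h1 : (1 : ℚ) ≤ |(a : ℚ)| := by exact_mod_cast Int.one_le_abs ha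
        have h2 : (2 : ℚ) ^ m ≤ 2 ^ t := pow_le_pow_right₀ (by norm_num) ht
        have h3 : |r| = |(a : ℚ)| * 2 ^ t := by
          rw [eq_neg_of_add_eq_zero_left h, abs_neg, abs_mul,
            abs_of_pos (by positivity : (0 : ℚ) < 2 ^ t)]
        nlinarith [pow_pos (by norm_num : (0 : ℚ) < 2) t]
      subst ha
      simpa using h
    · rintro ⟨rfl, rfl⟩
      simp
  rw [key le_rfl]
  rcases hW with ⟨t, ht, rfl⟩ | rfl
  · rw [← key ht]
    simp [Prod.ext_iff]
  · simp [Prod.ext_iff]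

/-- The stage `m` leaves room for `w.length` letters of size at most `2 ^ K`. An unsettled jump is
replaced by `2 ^ m`, which is too large to be cancelled by them, just like its true value, which is
either larger or independent. -/
theorem wordSum_counterPos_eq_zero_iff {c c' : ℕ → ℕ} (hc : ∀ s, c s ≤ s) (hc' : Monotone c')
    {w : List (ℕ × Bool)} {K m : ℕ} (hK : ∀ p ∈ w, p.1 ≤ K) (hm : w.length + K ≤ m) :
    wordSum (counterPos c c') w = 0 ↔ wordSum (fun k => (approxPos c c' m k : ℤ)) w = 0 := by
  have hcast : wordSum (fun k => (approxPos c c' m k : ℤ)) w = 0 ↔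
      wordSum (fun k => (approxPos c c' m k / 2 ^ m : ℚ)) w = 0 := by
    have : wordSum (fun k => (approxPos c c' m k / 2 ^ m : ℚ)) w =
        (wordSum (fun k => (approxPos c c' m k : ℤ)) w : ℤ) / 2 ^ m := by
      clear hK hm
      induction w with
      | nil => simp [wordSum]
      | cons p w ih =>
        rw [wordSum_cons, wordSum_cons, ih]
        push_cast
        simp only [zsmul_eq_mul, smul_eq_mul]
        push_cast
        ring
    rw [this, div_eq_zero_iff, or_iff_left (by positivity)]
    exact Int.cast_eq_zero.symm
  rw [hcast]
  have hU {k : ℕ} (hk : k ≤ K) (h0 : k ≠ 0) (h2 : k % 2 = 0) :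
      (approxPos c c' m k / 2 ^ m : ℚ) = (2 ^ c (k / 2))⁻¹ := by
    have hle : c (k / 2) ≤ m := (hc _).trans (by omega)
    rw [approxPos, if_neg h0, if_pos h2]
    push_cast
    rw [div_eq_iff (by positivity), ← div_eq_inv_mul, eq_div_iff (by positivity), ← pow_add,
      Nat.sub_add_cancel hle]
  have hV {k : ℕ} (h0 : k ≠ 0) (h2 : ¬ k % 2 = 0) :
      (approxPos c c' m k / 2 ^ m : ℚ) = 2 ^ jumpBound c' m (k / 2) := by
    rw [approxPos, if_neg h0, if_neg h2, pow_add]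
    push_cast
    field_simp
  -- If `c'` has passed `c' K` before stage `m`, all jumps in the word are settled and the
  -- approximations are exact. Otherwise a jump is either settled by stage `K`, or has counter value
  -- `c' K` and so equals `jumpPos c' K`.
  by_cases hlate : ∃ t < m, c' K < c' t
  · obtain ⟨t, ht, hKt⟩ := hlate
    have hletter {k : ℕ} (hk : k ≤ K) :
        counterPos c c' k = ((approxPos c c' m k / 2 ^ m : ℚ), 0) := by
      by_cases h0 : k = 0
      · simp [h0, counterPos, approxPos, Prod.ext_iff]
      · by_cases h2 : k % 2 = 0
        · rw [hU hk h0 h2, counterPos, if_neg h0, if_pos h2]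
        · rw [hV h0 h2, counterPos, if_neg h0, if_neg h2]
          exact (jumpPos_of_lt hc' ((hc' (by omega : k / 2 ≤ K)).trans_lt hKt) ht.le).1
    have hsum : wordSum (counterPos c c') w =
        (wordSum (fun k => (approxPos c c' m k / 2 ^ m : ℚ)) w, 0) := by
      clear hm hcast
      induction w with
      | nil => rfl
      | cons p w ih =>
        rw [wordSum_cons, wordSum_cons, ih fun q hq => hK q (List.mem_cons_of_mem _ hq),
          hletter (hK p List.mem_cons_self)]
        simp
    rw [hsum]
    simp [Prod.ext_iff]
  · push Not at hlate
    have hletter {k : ℕ} (hk : k ≤ K) : ∃ (r : ℚ) (a : ℤ), |r| ≤ 2 ^ K ∧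
        counterPos c c' k = (r, 0) + a • jumpPos c' K ∧
        (approxPos c c' m k / 2 ^ m : ℚ) = r + a * 2 ^ m := by
      by_cases h0 : k = 0
      · exact ⟨0, 0, by simp, by simp [h0, counterPos, Prod.ext_iff], by simp [h0, approxPos]⟩
      · by_cases h2 : k % 2 = 0
        · refine ⟨(2 ^ c (k / 2))⁻¹, 0, ?_, ?_, ?_⟩
          · rw [abs_of_pos (by positivity)]
            exact (inv_le_one_of_one_le₀ (one_le_pow₀ (by norm_num))).trans
              (one_le_pow₀ (by norm_num))
          · rw [counterPos, if_neg h0, if_pos h2]; simp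
          · rw [hU hk h0 h2]; simp
        · rcases (hc' (by omega : k / 2 ≤ K)).lt_or_eq with hlt | heq
          · obtain ⟨h, hle⟩ := jumpPos_of_lt hc' hlt (by omega : K ≤ m)
            refine ⟨2 ^ jumpBound c' m (k / 2), 0, ?_, ?_, ?_⟩
            · rw [abs_of_pos (by positivity)]
              exact pow_le_pow_right₀ (by norm_num) hle
            · rw [counterPos, if_neg h0, if_neg h2, h]; simp
            · rw [hV h0 h2]; simp
          · refine ⟨0, 1, by simp, ?_, ?_⟩
            · rw [counterPos, if_neg h0, if_neg h2, jumpPos_congr heq]; simp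
            · rw [hV h0 h2, jumpBound_of_forall fun t ht => (hlate t ht).trans heq.ge]; simp
    -- The same settled part `r` and multiplicity `a` describe the true sum and its approximation,
    -- which differ only in the value given to the unsettled jump.
    have hsum : ∃ (r : ℚ) (a : ℤ), |r| ≤ w.length * 2 ^ K ∧
        wordSum (counterPos c c') w = (r, 0) + a • jumpPos c' K ∧
        wordSum (fun k => (approxPos c c' m k / 2 ^ m : ℚ)) w = r + a * 2 ^ m := by
      clear hm hcast
      induction w with
      | nil => exact ⟨0, 0, by simp, by simp [wordSum, Prod.ext_iff], by simp [wordSum]⟩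
      | cons p w ih =>
        obtain ⟨r, a, h1, h2, h3⟩ := ih fun q hq => hK q (List.mem_cons_of_mem _ hq)
        obtain ⟨r', a', h1', h2', h3'⟩ := hletter (hK p List.mem_cons_self)
        obtain ⟨ε, hε, hεr⟩ : ∃ ε : ℤ, cond p.2 1 (-1 : ℤ) = ε ∧ |(ε : ℚ) * r'| = |r'| := by
          cases p.2
          · exact ⟨-1, rfl, by simp⟩
          · exact ⟨1, rfl, by simp⟩
        refine ⟨ε * r' + r, ε * a' + a, ?_, ?_, ?_⟩
        · refine (abs_add_le _ _).trans ?_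
          rw [hεr, List.length_cons]
          push_cast
          linarith
        · rw [wordSum_cons, h2, h2', hε]
          ext <;> simp <;> ring
        · rw [wordSum_cons, h3, h3', hε]
          push_cast
          simp only [zsmul_eq_mul]
          ring
    obtain ⟨r, a, h1, h2, h3⟩ := hsum
    rw [h2, h3]
    refine add_zsmul_eq_zero_iff (jumpPos_of_forall hlate) (h1.trans_lt ?_) a
    calc (w.length * 2 ^ K : ℚ) < 2 ^ w.length * 2 ^ K := by
          gcongr
          exact_mod_cast Nat.lt_two_pow_self
      _ = 2 ^ (w.length + K) := (pow_add _ _ _).symm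
      _ ≤ 2 ^ m := pow_le_pow_right₀ (by norm_num) hm

/-- The sum of the naturals assigned to the positive or to the negative letters of a word. -/
def signedSum (b : Bool) (f : ℕ → ℕ) (w : List (ℕ × Bool)) : ℕ :=
  (w.map fun p => cond (p.2 == b) (f p.1) 0).sum

/-- Separating positive from negative letters turns the test into an equality of computable natural
numbers. -/
theorem wordSum_natCast_eq_zero_iff (f : ℕ → ℕ) (w : List (ℕ × Bool)) :
    wordSum (fun k => (f k : ℤ)) w = 0 ↔ signedSum true f w = signedSum false f w := by
  have : wordSum (fun k => (f k : ℤ)) w = signedSum true f w - signedSum false f w := by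
    induction w with
    | nil => rfl
    | cons p w ih =>
      obtain ⟨k, b⟩ := p
      rw [wordSum_cons, ih]
      cases b <;> simp [signedSum] <;> ring
  rw [this, sub_eq_zero, Nat.cast_inj]

theorem computable_list_sum {α : Type*} [Primcodable α] {f : α → ℕ × Bool → ℕ}
    {w : α → List (ℕ × Bool)} (hf : Computable₂ f) (hw : Computable w) :
    Computable fun a => ((w a).map (f a)).sum := by
  refine (Computable.sum_range (F := fun a i => f a ((w a).getD i (0, true))) (k := fun a =>
    (w a).length) ?_ (Computable.list_length.comp hw)).of_eq fun a =>
      Finset.sum_range_getD (f a) (0, true) (w a)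
  exact hf.comp Computable.fst ((Primrec.list_getD (0, true)).to_comp.comp
    (hw.comp Computable.fst) Computable.snd)

theorem primrec_two_pow : Primrec fun k : ℕ => 2 ^ k := by
  refine (Primrec.nat_rec₁ 1 (Primrec.nat_mul.comp (Primrec.const 2) Primrec.snd).to₂).of_eq
    fun k => ?_
  induction k with
  | zero => rfl
  | succ k ih => rw [pow_succ', ← ih]

theorem computable_approxPos {c c' : ℕ → ℕ → ℕ} (hc : Computable₂ c) (hc' : Computable₂ c') :
    Computable fun p : (ℕ × ℕ) × ℕ => approxPos (c p.1.1) (c' p.1.1) p.1.2 p.2 := by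
  have hn : Computable fun p : (ℕ × ℕ) × ℕ => p.1.1 := Computable.fst.comp Computable.fst
  have hm : Computable fun p : (ℕ × ℕ) × ℕ => p.1.2 := Computable.snd.comp Computable.fst
  have hs : Computable fun p : (ℕ × ℕ) × ℕ => p.2 / 2 :=
    (Primrec.nat_div.comp Primrec.snd (Primrec.const 2)).to_comp
  have hjump : Computable fun p : (ℕ × ℕ) × ℕ => jumpBound (c' p.1.1) p.1.2 (p.2 / 2) := by
    refine Computable.sum_range (F := fun (p : (ℕ × ℕ) × ℕ) t =>
      if c' p.1.1 t ≤ c' p.1.1 (p.2 / 2) then 1 else 0) ?_ hm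
    refine Computable.ite (ComputablePred.comp (p := fun q : ℕ × ℕ => q.1 ≤ q.2)
      (PrimrecPred.computablePred (Primrec.nat_le.comp Primrec.fst Primrec.snd))
      (f := fun p : ((ℕ × ℕ) × ℕ) × ℕ => (c' p.1.1.1 p.2, c' p.1.1.1 (p.1.2 / 2))) ?_)
      (Computable.const 1) (Computable.const 0)
    exact (hc'.comp (hn.comp Computable.fst) Computable.snd).pair
      (hc'.comp (hn.comp Computable.fst) (hs.comp Computable.fst))
  refine Computable.ite (ComputablePred.nat_eq Computable.snd (Computable.const 0))
    (Computable.const 0) (Computable.ite (ComputablePred.nat_eq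
      (Primrec.nat_mod.comp Primrec.snd (Primrec.const 2)).to_comp (Computable.const 0)) ?_ ?_)
  · exact primrec_two_pow.to_comp.comp (Primrec.nat_sub.to_comp.comp hm (hc.comp hn hs))
  · exact primrec_two_pow.to_comp.comp (Primrec.nat_add.to_comp.comp hm hjump)

/-- A stage at which the approximations of the positions of the letters of a word suffice. -/
def wordStage (w : List (ℕ × Bool)) : ℕ := w.length + (w.map Prod.fst).sum

theorem computable_wordStage : Computable wordStage :=
  Primrec.nat_add.to_comp.comp Computable.list_length
    (computable_list_sum (f := fun _ => Prod.fst) (Computable.fst.comp Computable.snd)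
      Computable.id)

theorem computablePred_wordVal_counterPos {c c' : ℕ → ℕ → ℕ} (hc : Computable₂ c)
    (hc' : Computable₂ c') (hle : ∀ n s, c n s ≤ s) (hmono : ∀ n, Monotone (c' n)) :
    ComputablePred fun p : ℕ × List (ℕ × Bool) =>
      wordVal (fun k => Multiplicative.ofAdd (counterPos (c p.1) (c' p.1) k)) p.2 = 1 := by
  have hsum (b : Bool) : Computable fun p : ℕ × List (ℕ × Bool) =>
      signedSum b (approxPos (c p.1) (c' p.1) (wordStage p.2)) p.2 := by
    refine computable_list_sum (f := fun (p : ℕ × List (ℕ × Bool)) q =>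
      cond (q.2 == b) (approxPos (c p.1) (c' p.1) (wordStage p.2) q.1) 0) ?_ Computable.snd
    have hletter : Computable fun q : (ℕ × List (ℕ × Bool)) × ℕ × Bool =>
        ((q.1.1, wordStage q.1.2), q.2.1) :=
      ((Computable.fst.comp Computable.fst).pair
        (computable_wordStage.comp (Computable.snd.comp Computable.fst))).pair
          (Computable.fst.comp Computable.snd)
    have hbeq : Computable fun q : (ℕ × List (ℕ × Bool)) × ℕ × Bool => q.2.2 == b :=
      (Primrec.beq.comp (Primrec.snd.comp Primrec.snd) (Primrec.const b)).to_comp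
    have happrox : Computable fun q : (ℕ × List (ℕ × Bool)) × ℕ × Bool =>
        approxPos (c q.1.1) (c' q.1.1) (wordStage q.1.2) q.2.1 := by
      have h := (computable_approxPos hc hc').comp hletter
      exact h
    exact Computable.cond hbeq happrox (Computable.const 0)
  refine (ComputablePred.nat_eq (hsum true) (hsum false)).of_eq fun p => ?_
  rw [wordVal_ofAdd, ofAdd_eq_one, ← wordSum_natCast_eq_zero_iff]
  -- The sum of all generator numbers bounds each of them.
  exact (wordSum_counterPos_eq_zero_iff (hle p.1) (hmono p.1) (K := (p.2.map Prod.fst).sum)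
    (fun q hq => List.single_le_sum (fun _ _ => Nat.zero_le _) _ (List.mem_map_of_mem hq))
    le_rfl).symm

theorem LampGroup.shift_pow {d : ℕ} {A : Type} [AddCommGroup A] (a : A) (k : ℕ) :
    (shift a : LampGroup d A) ^ k = shift (k • a) := by
  induction k with
  | zero => rw [pow_zero, zero_smul]; rfl
  | succ k ih => rw [pow_succ, ih, succ_nsmul, shift_add]

/-! ## Groups of lamps given by two counters -/

/-- The group of lamps generated by the lamp at the origin and the shifts given by two counters. -/
noncomputable def counterGroup (d : ℕ) (c c' : ℕ → ℕ) : Subgroup (LampGroup d (ℚ × ℚ)) :=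
  Subgroup.closure (Set.range (LampGroup.gens d (counterPos c c')))

/-- The generators, as elements of the group they generate. -/
noncomputable def counterGens (d : ℕ) (c c' : ℕ → ℕ) (k : ℕ) : counterGroup d c c' :=
  ⟨LampGroup.gens d (counterPos c c') k, Subgroup.subset_closure ⟨k, rfl⟩⟩

theorem closure_range_counterGens (d : ℕ) (c c' : ℕ → ℕ) :
    Subgroup.closure (Set.range (counterGens d c c')) = ⊤ := by
  refine Eq.trans (congrArg Subgroup.closure ?_) (Subgroup.closure_closure_coe_preimage
    (k := Set.range (LampGroup.gens d (counterPos c c'))))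
  ext x
  exact ⟨fun ⟨k, hk⟩ => ⟨k, congrArg Subtype.val hk⟩, fun ⟨k, hk⟩ => ⟨k, Subtype.ext hk⟩⟩

theorem computablePred_wordVal_counterGens {d : ℕ} (hd : 1 ≤ d) {c c' : ℕ → ℕ → ℕ}
    (hc : Computable₂ c) (hc' : Computable₂ c') (hle : ∀ n s, c n s ≤ s)
    (hmono : ∀ n, Monotone (c' n)) :
    ComputablePred fun p : ℕ × List (ℕ × Bool) =>
      wordVal (counterGens d (c p.1) (c' p.1)) p.2 = 1 := by
  refine (LampGroup.computablePred_wordVal_gens hd (A := fun _ => ℚ × ℚ)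
    (v := fun n => counterPos (c n) (c' n)) (fun n => if_pos rfl)
    (computablePred_wordVal_counterPos hc hc' hle hmono)).of_eq fun p => ?_
  rw [← OneMemClass.coe_eq_one]
  exact (Eq.congr_left (map_wordVal (counterGroup d (c p.1) (c' p.1)).subtype
    (counterGens d (c p.1) (c' p.1)) p.2)).symm

theorem horner_mem {M : Type*} [Group M] (H : Subgroup M) {x y : M} (hx : x ∈ H) (hy : y ∈ H)
    (c : List ℕ) : horner x y c ∈ H := by
  induction c with
  | nil => exact H.one_mem
  | cons a l ih => exact H.mul_mem (H.pow_mem hx a) (H.mul_mem (H.mul_mem hy ih) (H.inv_mem hy))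

theorem Generates.eq_top {M : Type*} [Group M] {x y : M} (h : Generates x y) {H : Subgroup M}
    (hx : x ∈ H) (hy : y ∈ H) : H = ⊤ := by
  refine eq_top_iff.2 fun z _ => ?_
  obtain ⟨m, n, c, hz⟩ := h z
  have : y ^ m * z ∈ H := hz ▸ H.mul_mem (horner_mem H hx hy c) (H.pow_mem hy n)
  exact (H.mul_mem_cancel_left (H.pow_mem hy m)).1 this

theorem counterPos_even (c c' : ℕ → ℕ) (s : ℕ) :
    counterPos c c' (2 * (s + 1)) = ((2 ^ c (s + 1))⁻¹, 0) := by
  rw [counterPos, if_neg (by omega), if_pos (by omega), Nat.mul_div_cancel_left _ two_pos]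

theorem counterPos_odd (c c' : ℕ → ℕ) (s : ℕ) : counterPos c c' (2 * s + 1) = jumpPos c' s := by
  rw [counterPos, if_neg (by omega), if_neg (by omega), show (2 * s + 1) / 2 = s by omega]

theorem shift_mem_counterGroup {d : ℕ} {c c' : ℕ → ℕ} {k : ℕ} (hk : k ≠ 0) :
    LampGroup.shift (counterPos c c' k) ∈ counterGroup d c c' := by
  obtain ⟨k, rfl⟩ := Nat.exists_eq_succ_of_ne_zero hk
  exact Subgroup.subset_closure ⟨k + 1, rfl⟩

/-- If `c` has maximum `c s` and every jump takes place, all positions are integral multiples of `2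
^ (-c s)`, and this value itself occurs. The lamp group over `ℤ` then embeds with exactly this
image. -/
theorem nonempty_mulEquiv_counterGroup {d : ℕ} (hd : 1 ≤ d) {c c' : ℕ → ℕ} (hc : Monotone c)
    (hbdd : ∃ s, ∀ t, c t ≤ c s) (hunb : ¬ ∃ s, ∀ t, c' t ≤ c' s) :
    Nonempty (counterGroup d c c' ≃* LampGroup d ℤ) := by
  obtain ⟨s, hs⟩ := hbdd
  push Not at hunb
  let φ : ℤ →+ ℚ × ℚ :=
    { toFun := fun z => (z * (2 ^ c s)⁻¹, 0)
      map_zero' := by simp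
      map_add' := fun x y => by simp [add_mul] }
  have hφ : Function.Injective φ := by
    intro x y h
    have h1 : (x * (2 ^ c s)⁻¹ : ℚ) = y * (2 ^ c s)⁻¹ := congrArg Prod.fst h
    exact_mod_cast mul_right_cancel₀ (by positivity) h1
  have hbase : LampGroup.map φ (LampGroup.base (AddMonoidAlgebra.single 0 1)) =
      (LampGroup.base (AddMonoidAlgebra.single 0 1) : LampGroup d (ℚ × ℚ)) :=
    LampGroup.ext (map_one (AddMonoidAlgebra.mapDomainRingHom (ZMod d) φ)) (map_zero φ)
  have hshift (z : ℤ) : LampGroup.map φ (LampGroup.shift z) =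
      (LampGroup.shift (φ z) : LampGroup d (ℚ × ℚ)) :=
    LampGroup.ext (map_zero (AddMonoidAlgebra.mapDomainRingHom (ZMod d) φ)) rfl
  have hrange : (LampGroup.map φ : LampGroup d ℤ →* LampGroup d (ℚ × ℚ)).range =
      counterGroup d c c' := by
    apply le_antisymm
    · rw [MonoidHom.range_eq_map, Subgroup.map_le_iff_le_comap, top_le_iff]
      refine (LampGroup.generates_of_isStdPair hd (LampGroup.isStdPair_base_shift hd)).eq_top
        (Subgroup.subset_closure ⟨0, hbase.symm⟩) ?_
      rw [Subgroup.mem_comap, hshift]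
      -- Index `0` belongs to the lamp, so even indices start at `c 1`; the maximum is still
      -- attained at `s + 1`.
      have h1 : φ 1 = counterPos c c' (2 * (s + 1)) := by
        rw [counterPos_even, le_antisymm (hs (s + 1)) (hc (Nat.le_succ s))]
        simp [φ]
      rw [h1]
      exact shift_mem_counterGroup (by omega)
    · refine (Subgroup.closure_le _).2 ?_
      rintro _ ⟨k, rfl⟩
      rcases k with _ | k
      · exact ⟨_, hbase⟩
      · suffices ∃ z, φ z = counterPos c c' (k + 1) by
          obtain ⟨z, hz⟩ := this
          exact ⟨LampGroup.shift z, (hshift z).trans (congrArg _ hz)⟩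
        rcases Nat.even_or_odd' (k + 1) with ⟨i, hi | hi⟩
        · obtain ⟨j, rfl⟩ := Nat.exists_eq_succ_of_ne_zero (by omega : i ≠ 0)
          rw [hi, counterPos_even]
          refine ⟨2 ^ (c s - c (j + 1)), Prod.ext ?_ rfl⟩
          change (((2 ^ (c s - c (j + 1)) : ℤ) : ℚ) * (2 ^ c s)⁻¹ : ℚ) = (2 ^ c (j + 1))⁻¹
          push_cast
          rw [← div_eq_mul_inv, div_eq_iff (by positivity), ← div_eq_inv_mul,
            eq_div_iff (by positivity), ← pow_add, Nat.sub_add_cancel (hs _)]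
        · rw [hi, counterPos_odd, jumpPos, dif_pos (hunb i)]
          refine ⟨2 ^ (Nat.find (hunb i) + c s), Prod.ext ?_ rfl⟩
          change (((2 ^ (_ + c s) : ℤ) : ℚ) * (2 ^ c s)⁻¹ : ℚ) = 2 ^ _
          push_cast
          rw [pow_add, mul_inv_cancel_right₀ (by positivity)]
  exact ⟨((MonoidHom.ofInjective (LampGroup.map_injective hφ)).trans
    (MulEquiv.subgroupCongr hrange)).symm⟩

/-! ### Divisible positions and positions of rank two exclude an isomorphism -/

section NotIso

variable {d : ℕ} {c c' : ℕ → ℕ}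

/-- An isomorphism with the lamplighter group reflects trivial positions. -/
theorem pos_eq_zero_of_mulEquiv {A : Type} [AddCommGroup A] [IsAddTorsionFree A] (hd : 1 ≤ d)
    {H : Subgroup (LampGroup d A)} (f : H ≃* LampGroup d ℤ) {x : H} (hx : (f x).pos = 0) :
    x.1.pos = 0 := by
  have h1 : f x ^ d = 1 := by rw [LampGroup.eq_base hx, LampGroup.base_pow_self]
  rw [← map_pow, MulEquiv.map_eq_one_iff] at h1
  have h2 : d • x.1.pos = 0 := by
    rw [← LampGroup.pow_pos', ← Subgroup.coe_pow, h1]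
    rfl
  exact (nsmul_eq_zero_iff_right (by omega)).1 h2

/-- The shift by a generator of the group of positions. -/
noncomputable def counterShift (d : ℕ) (c c' : ℕ → ℕ) (k : ℕ) : counterGroup d c c' :=
  ⟨LampGroup.shift (counterPos c c' (k + 1)), shift_mem_counterGroup (Nat.succ_ne_zero k)⟩

theorem pos_counterShift_ne_zero (hd : 1 ≤ d) (f : counterGroup d c c' ≃* LampGroup d ℤ) :
    (f (counterShift d c c' 1)).pos ≠ 0 := by
  intro h
  have := congrArg Prod.fst (pos_eq_zero_of_mulEquiv hd f h)
  rw [counterShift, LampGroup.shift_pos, counterPos_even c c' 0] at this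
  exact absurd this (by positivity)

/-- If `c` were unbounded, the shift by `2 ^ (-c 1)` would have `2 ^ k`-th roots for all `k`, so the
position of its image in `ℤ` would be divisible by every power of 2 and hence zero. -/
theorem bounded_of_mulEquiv (hd : 1 ≤ d) (f : counterGroup d c c' ≃* LampGroup d ℤ)
    (hc : Monotone c) : ∃ s, ∀ t, c t ≤ c s := by
  by_contra hunb
  push Not at hunb
  have hlarge (k : ℕ) : ∃ s, c 1 + k ≤ c (s + 1) := by
    induction k with
    | zero => exact ⟨0, le_rfl⟩
    | succ k ih =>
      obtain ⟨s, hs⟩ := ih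
      obtain ⟨t, ht⟩ := hunb (s + 1)
      exact ⟨t, by have := hc (Nat.le_succ t); simp only [Nat.succ_eq_add_one] at this; omega⟩
  have hdvd (k : ℕ) : (2 : ℤ) ^ k ∣ (f (counterShift d c c' 1)).pos := by
    obtain ⟨s, hs⟩ := hlarge k
    have hpow : counterShift d c c' 1 =
        counterShift d c c' (2 * s + 1) ^ 2 ^ (c (s + 1) - c 1) := by
      refine Subtype.ext ?_
      rw [Subgroup.coe_pow]
      simp only [counterShift]
      rw [LampGroup.shift_pow, counterPos_even c c' 0, show 2 * s + 1 + 1 = 2 * (s + 1) by ring,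
        counterPos_even]
      refine congrArg _ (Prod.ext ?_ ?_)
      · rw [Prod.smul_fst, nsmul_eq_mul]
        push_cast
        rw [← div_eq_mul_inv, eq_div_iff (by positivity), ← div_eq_inv_mul,
          div_eq_iff (by positivity), ← pow_add, Nat.sub_add_cancel (by omega)]
      · rw [Prod.smul_snd, smul_zero]
    rw [hpow, map_pow, LampGroup.pow_pos', nsmul_eq_mul]
    push_cast
    exact (pow_dvd_pow 2 (by omega)).mul_right _
  refine pos_counterShift_ne_zero hd f ?_
  by_contra h0
  -- The exponent is the absolute value of the position itself, which is smaller than that power of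
  -- 2.
  have h1 := Int.le_of_dvd (abs_pos.2 h0)
    ((dvd_abs _ _).2 (hdvd (f (counterShift d c c' 1)).pos.natAbs))
  have h2 : (f (counterShift d c c' 1)).pos.natAbs < 2 ^ (f (counterShift d c c' 1)).pos.natAbs :=
    Nat.lt_two_pow_self
  rw [Int.abs_eq_natAbs] at h1
  exact absurd h2 (not_lt.2 (by exact_mod_cast h1))

/-- If `c'` were bounded, some jump would be `(0, 1)`, independent of the even generators. But
positions in `ℤ` are commensurable, so suitable powers of the two shifts would have a quotient of
position zero. -/
theorem unbounded_of_mulEquiv (hd : 1 ≤ d) (f : counterGroup d c c' ≃* LampGroup d ℤ) :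
    ¬ ∃ s, ∀ t, c' t ≤ c' s := by
  rintro ⟨s, hs⟩
  have hV : counterPos c c' (2 * s + 1) = (0, 1) := by
    rw [counterPos_odd, jumpPos, dif_neg]
    push Not
    exact hs
  set x := counterShift d c c' 1 with hx
  set y := counterShift d c c' (2 * s) with hy
  -- The exponents are crossed so that the image positions cancel; the second coordinate of the true
  -- position is then `-(f x).pos`, which must vanish.
  have h : (f (x ^ (f y).pos * y ^ (-(f x).pos))).pos = 0 := by
    rw [map_mul, map_zpow, map_zpow, LampGroup.mul_pos', LampGroup.zpow_pos',
      LampGroup.zpow_pos']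
    simp only [smul_eq_mul]
    ring
  have h' := congrArg Prod.snd (pos_eq_zero_of_mulEquiv hd f h)
  rw [Subgroup.coe_mul, Subgroup.coe_zpow, Subgroup.coe_zpow, LampGroup.mul_pos',
    LampGroup.zpow_pos', LampGroup.zpow_pos'] at h'
  simp only [hx, hy, counterShift, LampGroup.shift_pos, hV, counterPos_even c c' 0] at h'
  refine pos_counterShift_ne_zero hd f ?_
  simpa [hx, counterShift, counterPos_even c c' 0] using h'

end NotIso

theorem isMCompleteDSigmaTwo_indexSet_lamplighter {d : ℕ} (hd : 1 ≤ d) :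
    IsMCompleteDSigmaTwo (indexSet (Lamplighter d)) := by
  refine ⟨isDSigmaTwo_indexSet_lamplighter hd, ?_⟩
  rintro _ ⟨S₁, S₂, h₁, h₂, rfl⟩
  obtain ⟨c, hc, hmono, hle, hS₁⟩ := exists_counter h₁
  obtain ⟨c', hc', hmono', -, hS₂⟩ := exists_counter h₂
  obtain ⟨f, hf, hmem⟩ := exists_computable_mem_indexSet_iff
    (G := fun n => counterGroup d (c n) (c' n)) (g := fun n => counterGens d (c n) (c' n))
    (Lamplighter d) (fun n => closure_range_counterGens d (c n) (c' n))
    (computablePred_wordVal_counterGens hd hc hc' hle hmono')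
  refine ⟨f, hf, fun n => ?_⟩
  change _ ↔ f n ∈ _
  rw [hmem, sigIso_lamplighter_iff hd, isLampLike_iff hd]
  change n ∈ S₁ ∧ n ∉ S₂ ↔ _
  rw [hS₁, hS₂]
  constructor
  · rintro ⟨hb, hu⟩
    exact (nonempty_mulEquiv_counterGroup hd (hmono n) hb hu).map MulEquiv.symm
  · rintro ⟨φ⟩
    exact ⟨bounded_of_mulEquiv hd φ.symm (hmono n), unbounded_of_mulEquiv hd φ.symm⟩

theorem mainTheorem8 (d : ℕ) (hd : 1 ≤ d) :
    (∃ p : InfFormula, p.IsComputableDSigma 2 ∧ p.IsScottSentence (Lamplighter d)) ∧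
      IsMCompleteDSigmaTwo (indexSet (Lamplighter d)) :=
  ⟨InfFormula.exists_scottSentence hd, isMCompleteDSigmaTwo_indexSet_lamplighter hd⟩
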